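/- A temporal graph $\mathcal G=(V,\mathcal E,T)$ consists of a finite vertex set $V$, a lifetime $T\ge 1$ and a set $\mathcal E\subseteq\binom V2\times\{1,\dots,T\}$ of time-edges such that every label $1,\dots,T$ is used; its underlying graph joins $u$ and $v$ whenever $(\{u,v\},t)\in\mathcal E$ for some $t$. A temporal $(s,z)$-path of length $k$ is a sequence of time-edges $(\{v_{i-1},v_i\},t_i)_{i=1}^k$ with pairwise distinct vertices $s=v_0,v_1,\dots,v_k=z$ and $t_1\le\dots\le t_k$. For $\varepsilon>0$, an $\varepsilon$-approximation to a number $N$ is a rational $\hat N$ with $(1-\varepsilon)N\le\hat N\le(1+\varepsilon)N$. Running times are worst-case numbers of steps of a random access machine with fair coin tosses whose elementary operations (including addition and subtraction, but not multiplication) cost one step each. The following hold. (1) There is a randomised algorithm which, given a temporal graph $\mathcal G$ with $n$ vertices and lifetime $T$, vertices $s,z$, a number $k\ge 0$ and rational error parameters $\varepsilon>0$ and $0<\delta<1$, outputs, with probability at least $1-\delta$, an $\varepsilon$-approximation to the number of temporal $(s,z)$-paths in $\mathcal G$ with exactly $k$ edges. Its running time is $$\mathcal O\bigl(k!\,e^k\cdot\max\{1,\log(1/\delta)\}\cdot\max\{1,\varepsilon^{-2}\}\cdot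 n^2T^2\bigr).$$ (2) The length of any path in a finite graph is bounded by a (computable) function of the vertex cover number of the graph, and also by a (computable) function of its treedepth. (3) The problem #Temporal Path (given $\mathcal G,s,z$, determine the number $N$ of temporal $(s,z)$-paths in $\mathcal G$) admits an FPTRAS parameterised by the vertex cover number of the underlying graph, and also one parameterised by the treedepth of the underlying graph. Here an FPTRAS with parameter $\kappa$ is a randomised algorithm which, given an instance $I=(\mathcal G,s,z)$ and rational $\varepsilon>0$ and $0<\delta<1$, outputs, with probability at least $1-\delta$, an $\varepsilon$-approximation to $N$, in time $f(\kappa(I))\cdot\mathrm{poly}(|V|+|\mathcal E|,1/\varepsilon,\log(1/\delta))$ for some computable function $f$. -/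

import Mathlib

namespace TemporalPaths

/-! ### Temporal graphs and temporal paths -/

/-- A finite, undirected, simple temporal graph on `V` with a positive lifetime `T`: a set of
time-edges `({u, v}, t)` with `u ≠ v` and `t ∈ {1, …, T}`, in which every label of
`{1, …, T}` is used at least once. -/
structure TemporalGraph (V : Type*) where
  lifetime : ℕ
  lifetime_pos : 0 < lifetime
  timeEdges : Finset (Sym2 V × ℕ)
  not_isDiag : ∀ e ∈ timeEdges, ¬ e.1.IsDiag
  label_mem : ∀ e ∈ timeEdges, e.2 ∈ Finset.Icc 1 lifetime
  label_used : ∀ t ∈ Finset.Icc 1 lifetime, ∃ e ∈ timeEdges, e.2 = t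

/-- The underlying static graph of a temporal graph. -/
def TemporalGraph.underlying {V : Type*} (G : TemporalGraph V) : SimpleGraph V where
  Adj u v := ∃ t, (s(u, v), t) ∈ G.timeEdges
  symm := ⟨fun u v h => by
    obtain ⟨t, ht⟩ := h
    exact ⟨t, by rwa [Sym2.eq_swap]⟩⟩
  loopless := ⟨fun v h => by
    obtain ⟨t, ht⟩ := h
    exact G.not_isDiag _ ht (by simp)⟩

/-- `P` is a temporal `(s, z)`-path: a sequence of time-edges `({v_{i-1}, v_i}, t_i)`,
`i = 1, …, k`, with pairwise distinct vertices `s = v_0, …, v_k = z` and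
`t_i ≤ t_{i+1}`. Its length is `P.length`. (The empty sequence is a path iff `s = z`.) -/
def TemporalGraph.IsTemporalPath {V : Type*} (G : TemporalGraph V) (s z : V)
    (P : List (Sym2 V × ℕ)) : Prop :=
  (∃ v : Fin (P.length + 1) → V, Function.Injective v ∧ v 0 = s ∧ v (Fin.last P.length) = z ∧
      ∀ i : Fin P.length, (P.get i).1 = s(v i.castSucc, v i.succ)) ∧
    (∀ e ∈ P, e ∈ G.timeEdges) ∧
    P.IsChain (fun e f => e.2 ≤ f.2)

/-- The number of temporal `(s, z)`-paths. -/
noncomputable def TemporalGraph.numPaths {V : Type*} (G : TemporalGraph V) (s z : V) : ℕ :=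
  {P | G.IsTemporalPath s z P}.ncard

/-- The number of temporal `(s, z)`-paths with exactly `k` edges. -/
noncomputable def TemporalGraph.numPathsOfLength {V : Type*} (G : TemporalGraph V) (s z : V)
    (k : ℕ) : ℕ :=
  {P | G.IsTemporalPath s z P ∧ P.length = k}.ncard

/-! ### Structural parameters of static graphs -/

/-- `H` is contained in the closure of a rooted forest of height at most `d`. The forest is given
by its ancestor order (`u ≤ v` iff `u` is an ancestor of `v` or `u = v`): a partial order in
which the elements below any `v` form a chain. The closure joins comparable vertices, and the
height is the largest number of vertices on a path from a root. -/
def HasTreedepthAtMost {V : Type*} (H : SimpleGraph V) (d : ℕ) : Prop :=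
  ∃ _ : PartialOrder V,
    (∀ v : V, IsChain (· ≤ ·) (Set.Iic v)) ∧
    (∀ u v : V, H.Adj u v → u ≤ v ∨ v ≤ u) ∧
    ∀ v : V, (Set.Iic v).encard ≤ d

/-- The treedepth of a (finite) graph. -/
noncomputable def treedepth {V : Type*} (H : SimpleGraph V) : ℕ :=
  sInf {d | HasTreedepthAtMost H d}

/-- The vertex cover number of a (finite) graph as a natural number. -/
noncomputable def vertexCoverNumber {V : Type*} (H : SimpleGraph V) : ℕ :=
  H.vertexCoverNum.toNat

/-! ### A random access machine with fair coins

Structured programs over natural number variables and natural number arrays, indexed by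
arbitrary natural numbers. The only arithmetic is addition and truncated subtraction; every
elementary operation (and every evaluation of a test) costs one time step. With this instruction
set unit cost is a reasonable measure: in `t` steps the bit length of any number grows by at
most `t` plus a constant that depends on the program, so that running times are polynomially
related to those of Turing machines. -/

/-- Programs. Variables and arrays are named by natural numbers. -/
inductive Program : Type
  /-- do nothing -/
  | skip : Program
  /-- `x := c` -/
  | const (x c : ℕ) : Program
  /-- `x := y + z` -/
  | add (x y z : ℕ) : Program
  /-- `x := max (y - z) 0` -/
  | sub (x y z : ℕ) : Program
  /-- `x := a[y]` -/
  | load (x a y : ℕ) : Program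
  /-- `a[x] := y` -/
  | store (a x y : ℕ) : Program
  /-- `x :=` a fair coin toss in `{0, 1}` -/
  | flip (x : ℕ) : Program
  /-- first `p`, then `q` -/
  | seq (p q : Program) : Program
  /-- if `x < y` then `p` else `q` -/
  | ifLT (x y : ℕ) (p q : Program) : Program
  /-- while `x < y` do `p` -/
  | whileLT (x y : ℕ) (p : Program) : Program

/-- Machine states: the values of variables and array cells, and the number of coins tossed. -/
@[ext]
structure State where
  var : ℕ → ℕ
  arr : ℕ → ℕ → ℕ
  coins : ℕ

/-- Assign the value `c` to the variable `x`. -/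
def State.setVar (σ : State) (x c : ℕ) : State :=
  { σ with var := Function.update σ.var x c }

/-- Assign the value `c` to the cell `i` of the array `a`. -/
def State.setArr (σ : State) (a i c : ℕ) : State :=
  { σ with arr := Function.update σ.arr a (Function.update (σ.arr a) i c) }

/-- `Exec ω p σ t σ'`: if the coin tosses come up as `ω 0, ω 1, …`, then the program `p`, started
in `σ`, halts after exactly `t` steps in the state `σ'`. -/
inductive Exec (ω : ℕ → Bool) : Program → State → ℕ → State → Prop
  | skip (σ : State) : Exec ω .skip σ 1 σ
  | const (σ : State) (x c : ℕ) : Exec ω (.const x c) σ 1 (σ.setVar x c)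
  | add (σ : State) (x y z : ℕ) :
      Exec ω (.add x y z) σ 1 (σ.setVar x (σ.var y + σ.var z))
  | sub (σ : State) (x y z : ℕ) :
      Exec ω (.sub x y z) σ 1 (σ.setVar x (σ.var y - σ.var z))
  | load (σ : State) (x a y : ℕ) :
      Exec ω (.load x a y) σ 1 (σ.setVar x (σ.arr a (σ.var y)))
  | store (σ : State) (a x y : ℕ) :
      Exec ω (.store a x y) σ 1 (σ.setArr a (σ.var x) (σ.var y))
  | flip (σ : State) (x : ℕ) :
      Exec ω (.flip x) σ 1 { σ.setVar x (ω σ.coins).toNat with coins := σ.coins + 1 }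
  | seq {σ σ' σ'' : State} {t t' : ℕ} {p q : Program} :
      Exec ω p σ t σ' → Exec ω q σ' t' σ'' → Exec ω (.seq p q) σ (t + t') σ''
  | ifTrue {σ σ' : State} {t x y : ℕ} {p q : Program} :
      σ.var x < σ.var y → Exec ω p σ t σ' → Exec ω (.ifLT x y p q) σ (t + 1) σ'
  | ifFalse {σ σ' : State} {t x y : ℕ} {p q : Program} :
      ¬ σ.var x < σ.var y → Exec ω q σ t σ' → Exec ω (.ifLT x y p q) σ (t + 1) σ'
  | whileTrue {σ σ' σ'' : State} {t t' x y : ℕ} {p : Program} :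
      σ.var x < σ.var y → Exec ω p σ t σ' → Exec ω (.whileLT x y p) σ' t' σ'' →
        Exec ω (.whileLT x y p) σ (t + t' + 1) σ''
  | whileFalse {σ : State} {x y : ℕ} {p : Program} :
      ¬ σ.var x < σ.var y → Exec ω (.whileLT x y p) σ 1 σ

/-- For a fixed sequence of coin tosses, the running time and the final state are unique. -/
theorem Exec.unique {ω : ℕ → Bool} {p : Program} {σ σ₁ σ₂ : State} {t₁ t₂ : ℕ}
    (h₁ : Exec ω p σ t₁ σ₁) (h₂ : Exec ω p σ t₂ σ₂) : t₁ = t₂ ∧ σ₁ = σ₂ := by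
  induction h₁ generalizing t₂ σ₂ with
  | seq _ _ ih ih' =>
    cases h₂ with
    | seq a b =>
      obtain ⟨rfl, rfl⟩ := ih a
      obtain ⟨rfl, rfl⟩ := ih' b
      exact ⟨rfl, rfl⟩
  | ifTrue h _ ih =>
    cases h₂ with
    | ifTrue _ a => obtain ⟨rfl, rfl⟩ := ih a; exact ⟨rfl, rfl⟩
    | ifFalse h' _ => exact absurd h h'
  | ifFalse h _ ih =>
    cases h₂ with
    | ifTrue h' _ => exact absurd h' h
    | ifFalse _ a => obtain ⟨rfl, rfl⟩ := ih a; exact ⟨rfl, rfl⟩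
  | whileTrue h _ _ ih ih' =>
    cases h₂ with
    | whileTrue _ a b =>
      obtain ⟨rfl, rfl⟩ := ih a
      obtain ⟨rfl, rfl⟩ := ih' b
      exact ⟨rfl, rfl⟩
    | whileFalse h' => exact absurd h h'
  | whileFalse h =>
    cases h₂ with
    | whileTrue h' _ _ => exact absurd h' h
    | whileFalse _ => exact ⟨rfl, rfl⟩
  | _ => cases h₂; exact ⟨rfl, rfl⟩

/-- The distribution of an infinite sequence of independent fair coin tosses. -/
noncomputable def fairCoins : MeasureTheory.Measure (ℕ → Bool) :=
  MeasureTheory.Measure.infinitePi fun _ => (PMF.uniformOfFintype Bool).toMeasure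

/-! ### Counting problems and randomised approximation -/

/-- A counting problem on a machine: a type of instances, each with a size, with the value to be
computed, and with the numbers and tables through which it is presented to a program. -/
structure CountingProblem where
  Inst : Type
  size : Inst → ℕ
  count : Inst → ℕ
  header : Inst → List ℕ
  table : Inst → List (List ℕ)

/-- The initial state on an instance and rational error parameters `ε, δ > 0`: the variables
`0, 1, 2, 3` hold numerator and denominator of `ε` and of `δ`, the variables from `4` on hold the
header, the arrays `0, 1, …` hold the tables, and everything else is `0`. -/
def CountingProblem.start (F : CountingProblem) (I : F.Inst) (ε δ : ℚ) : State where
  var x := ([ε.num.toNat, ε.den, δ.num.toNat, δ.den] ++ F.header I).getD x 0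
  arr a i := ((F.table I).getD a []).getD i 0
  coins := 0

/-- The final state `σ` outputs an `ε`-approximation to `N`: the output is the rational number
with numerator variable `0` and (nonzero) denominator variable `1`. -/
def OutputsApprox (ε : ℚ) (N : ℕ) (σ : State) : Prop :=
  σ.var 1 ≠ 0 ∧
    (1 - ε) * (N : ℚ) ≤ (σ.var 0 : ℚ) / (σ.var 1 : ℚ) ∧
    (σ.var 0 : ℚ) / (σ.var 1 : ℚ) ≤ (1 + ε) * (N : ℚ)

/-- On the instance `I` with error parameters `ε, δ`, the program `p` halts within `B` steps
whatever the coins show, and with probability at least `1 - δ` it outputs an `ε`-approximation to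
the value of the instance. -/
def CountingProblem.ApproximatesWithin (F : CountingProblem) (p : Program) (I : F.Inst)
    (ε δ : ℚ) (B : ℝ) : Prop :=
  (∀ ω : ℕ → Bool, ∃ (t : ℕ) (σ : State), Exec ω p (F.start I ε δ) t σ ∧ (t : ℝ) ≤ B) ∧
  ENNReal.ofReal (1 - (δ : ℝ)) ≤
    fairCoins {ω | ∃ (t : ℕ) (σ : State),
      Exec ω p (F.start I ε δ) t σ ∧ OutputsApprox ε (F.count I) σ}

/-- The counting problem `F` with parameterisation `κ` admits an FPTRAS: a randomised
approximation scheme with running time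
`f (κ I) * poly (|I|, 1 / ε, log (1 / δ))` for a computable function `f`. -/
def CountingProblem.AdmitsFPTRAS (F : CountingProblem) (κ : F.Inst → ℕ) : Prop :=
  ∃ (p : Program) (f : ℕ → ℕ) (c d : ℕ), Computable f ∧
    ∀ (I : F.Inst) (ε δ : ℚ), 0 < ε → 0 < δ → δ < 1 →
      F.ApproximatesWithin p I ε δ
        ((f (κ I) : ℝ) *
          (c * ((F.size I : ℝ) + 1 / (ε : ℝ) + Real.log (1 / (δ : ℝ)) + 1) ^ d))

/-! ### The path counting problems -/

/-- An instance: a temporal graph with vertices `0, …, n - 1`, two vertices `s, z`, and a list of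
the time-edges as triples, each time-edge once, in any order and with its two endpoints in any
order. -/
structure PathInstance where
  n : ℕ
  graph : TemporalGraph (Fin n)
  s : Fin n
  z : Fin n
  triples : List (Fin n × Fin n × ℕ)
  triples_eq :
    ((triples.map fun e => (s(e.1, e.2.1), e.2.2) : List (Sym2 (Fin n) × ℕ)) :
      Multiset (Sym2 (Fin n) × ℕ)) = graph.timeEdges.val

/-- The tables of an instance: first endpoints, second endpoints, and labels. -/
def PathInstance.tables (I : PathInstance) : List (List ℕ) :=
  [I.triples.map fun e => (e.1 : ℕ), I.triples.map fun e => (e.2.1 : ℕ),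
    I.triples.map fun e => e.2.2]

/-- The numbers `n`, `T`, `|ℰ|`, `s`, `z` of an instance. -/
def PathInstance.numbers (I : PathInstance) : List ℕ :=
  [I.n, I.graph.lifetime, I.graph.timeEdges.card, (I.s : ℕ), (I.z : ℕ)]

/-- The problem of counting all temporal `(s, z)`-paths; the size of an instance is
`|V| + |ℰ|`. -/
noncomputable def temporalPath : CountingProblem where
  Inst := PathInstance
  size I := I.n + I.graph.timeEdges.card
  count I := I.graph.numPaths I.s I.z
  header I := I.numbers
  table I := I.tables

/-- The problem of counting the temporal `(s, z)`-paths with exactly `k` edges, where `k` is part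
of the input. -/
noncomputable def shortTemporalPath : CountingProblem where
  Inst := PathInstance × ℕ
  size I := I.1.n + I.1.graph.timeEdges.card
  count I := I.1.graph.numPathsOfLength I.1.s I.1.z I.2
  header I := I.1.numbers ++ [I.2]
  table I := I.1.tables

end TemporalPaths

/-! The algorithms count paths by colour coding. The target `z` gets colour `0`, the source `s` gets
colour `K + 1`, and every other vertex gets a random colour; a colour `1, …, K` is drawn with
probability `p = a / 2 ^ b` each. A temporal walk along which the colours count down to `0` visits
no vertex twice, hence is a path, and a path with `c` inner vertices is coloured in this way with
probability exactly `p ^ c`, because its inner vertices are distinct. For a fixed colouring, the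
dynamic program of `walkProg` counts the walks along which the colours count down: labels are
processed from `T` down to `1` and, for each label, colours from `0` upwards, so that steps with
equal labels may follow each other.

The probabilities are exactly `p ^ c`, so weighting a coloured path with `c` inner vertices by
`p ^ (-c)` makes the value of a single sample an unbiased estimate of the number of paths. That
value lies between `0` and `p ^ (-K)` times its expectation, and a multiplicative Chernoff bound
(`chernoff`) shows that a multiple of `p ^ (-K) * log (1 / δ) / ε ^ 2` independent samples give an
`ε`-approximation with probability `1 - δ` (`le_fairCoins_approx`). The denominators are cleared, so
that the machine only needs additions.

For paths with exactly `k` edges, `K = k - 1`, and `a = ⌊2 ^ b / K⌋` for the least `b` with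
`2 ^ b ≥ 2 * K ^ 2` makes `p` so close to `1 / K` that `p ^ (-K) ≤ 2 * K ^ K` (`exists_params`). The
bound `K ^ K ≤ K! * e ^ K` leads to the running time (`sampleSize_le`).

For all paths, a depth-first search from `s` is used instead of the parameter itself, which may be
hard to compute. The search tree has some height `h`. A branch of the tree is a path
with `h` vertices, so that `h` is bounded by any bound for the numbers of vertices of paths. The
tree contains the component of `s` in its closure (`DepthFirst.hasTreedepthAtMost`), so that all
paths from `s` have fewer than `2 ^ h` vertices. Hence `K = 2 ^ h` colours suffice, with
`p = 2 ^ (-h)`, and `h` is at most `2 * vc + 1` and less than `2 ^ td`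
(`length_le_vertexCoverNumber`, `length_lt_two_pow_treedepth`), where `vc` is the vertex cover
number and `td` the treedepth of the underlying graph.

Programs are verified with a Hoare logic that bounds running times: `Runs ω p B σ Q` says that `p`,
started in `σ`, halts within `B` steps in a state that satisfies `Q`. `Frame` records syntactically
which variables and arrays a program leaves alone. The input occupies the variables `0` to `9` and
the arrays `0` to `2`. The variables `14` and `15` hold `1` and `0` throughout, and `10` to `13`
hold `K`, the least number of inner vertices that is counted, `b` and `a`. The arrays `31`, `32`,
`33` hold the numbers of coloured walks, the colours and the accumulated counts, and `40`, `41` the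
marks and the stack of the search.
-/

namespace TemporalPaths

/-! ### Reasoning about programs -/

@[simp] theorem State.setVar_var (σ : State) (x c y : ℕ) :
    (σ.setVar x c).var y = if y = x then c else σ.var y := by
  simp [State.setVar, Function.update_apply]

@[simp] theorem State.setVar_arr (σ : State) (x c : ℕ) : (σ.setVar x c).arr = σ.arr := rfl

@[simp] theorem State.setVar_coins (σ : State) (x c : ℕ) : (σ.setVar x c).coins = σ.coins := rfl

@[simp] theorem State.setArr_var (σ : State) (a i c : ℕ) : (σ.setArr a i c).var = σ.var := rfl

@[simp] theorem State.setArr_coins (σ : State) (a i c : ℕ) :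
    (σ.setArr a i c).coins = σ.coins := rfl

@[simp] theorem State.setArr_arr (σ : State) (a i c b : ℕ) :
    (σ.setArr a i c).arr b = if b = a then Function.update (σ.arr a) i c else σ.arr b := by
  simp only [State.setArr, Function.update_apply]

/-- Whether the program contains an assignment to the variable `x`. -/
def Program.writesVar (x : ℕ) : Program → Bool
  | .skip => false
  | .const y _ => x == y
  | .add y _ _ => x == y
  | .sub y _ _ => x == y
  | .load y _ _ => x == y
  | .store _ _ _ => false
  | .flip y => x == y
  | .seq p q => p.writesVar x || q.writesVar x
  | .ifLT _ _ p q => p.writesVar x || q.writesVar x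
  | .whileLT _ _ p => p.writesVar x

/-- Whether the program contains an assignment to a cell of the array `a`. -/
def Program.writesArr (a : ℕ) : Program → Bool
  | .store b _ _ => a == b
  | .seq p q => p.writesArr a || q.writesArr a
  | .ifLT _ _ p q => p.writesArr a || q.writesArr a
  | .whileLT _ _ p => p.writesArr a
  | _ => false

/-- Whether the program contains a coin toss. -/
def Program.tosses : Program → Bool
  | .flip _ => true
  | .seq p q => p.tosses || q.tosses
  | .ifLT _ _ p q => p.tosses || q.tosses
  | .whileLT _ _ p => p.tosses
  | _ => false

/-- The states `σ` and `τ` agree on everything that the program does not mention as a target. -/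
structure Frame (p : Program) (σ τ : State) : Prop where
  var : ∀ x, p.writesVar x = false → τ.var x = σ.var x
  arr : ∀ a, p.writesArr a = false → τ.arr a = σ.arr a
  coins : p.tosses = false → τ.coins = σ.coins

theorem Frame.trans {p : Program} {σ τ υ : State} (h : Frame p σ τ) (h' : Frame p τ υ) :
    Frame p σ υ :=
  ⟨fun x hx => (h'.var x hx).trans (h.var x hx), fun x hx => (h'.arr x hx).trans (h.arr x hx),
    fun hx => (h'.coins hx).trans (h.coins hx)⟩

theorem Exec.frame {ω : ℕ → Bool} {p : Program} {σ τ : State} {t : ℕ} (h : Exec ω p σ t τ) :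
    Frame p σ τ := by
  induction h with
  | skip | const | add | sub | load | store | flip =>
    constructor <;> intros <;> simp_all [Program.writesVar, Program.writesArr, Program.tosses]
  | seq _ _ ih ih' =>
    refine ⟨fun x hx => ?_, fun x hx => ?_, fun hx => ?_⟩ <;>
      simp only [Program.writesVar, Program.writesArr, Program.tosses, Bool.or_eq_false_iff] at hx
    · rw [ih'.var x hx.2, ih.var x hx.1]
    · rw [ih'.arr x hx.2, ih.arr x hx.1]
    · rw [ih'.coins hx.2, ih.coins hx.1]
  | ifTrue _ _ ih =>
    refine ⟨fun x hx => ?_, fun x hx => ?_, fun hx => ?_⟩ <;>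
      simp only [Program.writesVar, Program.writesArr, Program.tosses, Bool.or_eq_false_iff] at hx
    · rw [ih.var x hx.1]
    · rw [ih.arr x hx.1]
    · rw [ih.coins hx.1]
  | ifFalse _ _ ih =>
    refine ⟨fun x hx => ?_, fun x hx => ?_, fun hx => ?_⟩ <;>
      simp only [Program.writesVar, Program.writesArr, Program.tosses, Bool.or_eq_false_iff] at hx
    · rw [ih.var x hx.2]
    · rw [ih.arr x hx.2]
    · rw [ih.coins hx.2]
  | whileTrue _ _ _ ih ih' =>
    refine ⟨fun x hx => ?_, fun x hx => ?_, fun hx => ?_⟩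
    · rw [ih'.var x hx, ih.var x hx]
    · rw [ih'.arr x hx, ih.arr x hx]
    · rw [ih'.coins hx, ih.coins hx]
  | whileFalse => exact ⟨fun _ _ => rfl, fun _ _ => rfl, fun _ => rfl⟩

/-- A program without coin tosses does the same for all outcomes of the coins. -/
theorem Exec.of_tosses {ω : ℕ → Bool} {p : Program} {σ τ : State} {t : ℕ} (h : Exec ω p σ t τ)
    (hp : p.tosses = false) (ω' : ℕ → Bool) : Exec ω' p σ t τ := by
  induction h with
  | skip σ => exact .skip σ
  | const σ x c => exact .const σ x c
  | add σ x y z => exact .add σ x y z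
  | sub σ x y z => exact .sub σ x y z
  | load σ x a y => exact .load σ x a y
  | store σ a x y => exact .store σ a x y
  | flip => simp [Program.tosses] at hp
  | seq _ _ ih ih' =>
    simp only [Program.tosses, Bool.or_eq_false_iff] at hp
    exact .seq (ih hp.1) (ih' hp.2)
  | ifTrue h _ ih =>
    simp only [Program.tosses, Bool.or_eq_false_iff] at hp
    exact .ifTrue h (ih hp.1)
  | ifFalse h _ ih =>
    simp only [Program.tosses, Bool.or_eq_false_iff] at hp
    exact .ifFalse h (ih hp.2)
  | whileTrue h _ _ ih ih' => exact .whileTrue h (ih (by simpa [Program.tosses] using hp)) (ih' hp)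
  | whileFalse h => exact .whileFalse h

/-- Started in `σ` with the coins `ω`, the program `p` halts within `B` steps in a state that
satisfies `Q`. -/
def Runs (ω : ℕ → Bool) (p : Program) (B : ℕ) (σ : State) (Q : State → Prop) : Prop :=
  ∃ (t : ℕ) (τ : State), Exec ω p σ t τ ∧ t ≤ B ∧ Q τ

namespace Runs

variable {ω : ℕ → Bool} {p q : Program} {B B' : ℕ} {σ : State} {Q Q' : State → Prop}

theorem mono (h : Runs ω p B σ Q) (hB : B ≤ B') (hQ : ∀ τ, Frame p σ τ → Q τ → Q' τ) :
    Runs ω p B' σ Q' := by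
  obtain ⟨t, τ, he, ht, hq⟩ := h
  exact ⟨t, τ, he, ht.trans hB, hQ τ he.frame hq⟩

theorem seq (h : Runs ω p B σ Q) (h' : ∀ τ, Frame p σ τ → Q τ → Runs ω q B' τ Q') :
    Runs ω (.seq p q) (B + B') σ Q' := by
  obtain ⟨t, τ, he, ht, hq⟩ := h
  obtain ⟨t', τ', he', ht', hq'⟩ := h' τ he.frame hq
  exact ⟨t + t', τ', he.seq he', by omega, hq'⟩

theorem ite {x y : ℕ} (h : σ.var x < σ.var y → Runs ω p B σ Q)
    (h' : ¬ σ.var x < σ.var y → Runs ω q B σ Q) : Runs ω (.ifLT x y p q) (B + 1) σ Q := by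
  by_cases hxy : σ.var x < σ.var y
  · obtain ⟨t, τ, he, ht, hq⟩ := h hxy
    exact ⟨t + 1, τ, he.ifTrue hxy, by omega, hq⟩
  · obtain ⟨t, τ, he, ht, hq⟩ := h' hxy
    exact ⟨t + 1, τ, he.ifFalse hxy, by omega, hq⟩

/-- A loop with a variant: if every round costs at most `B` steps, keeps the invariant `I` and
decreases `μ`, then there are at most `μ σ` rounds. -/
theorem whileLT {x y : ℕ} (I : State → Prop) (μ : State → ℕ) (h0 : I σ)
    (step : ∀ τ, Frame p σ τ → I τ → τ.var x < τ.var y →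
      Runs ω p B τ (fun τ' => I τ' ∧ μ τ' < μ τ)) :
    Runs ω (.whileLT x y p) (μ σ * (B + 1) + 1) σ (fun τ => I τ ∧ ¬ τ.var x < τ.var y) := by
  have key : ∀ (m : ℕ) (τ : State), Frame p σ τ → I τ → μ τ ≤ m →
      Runs ω (.whileLT x y p) (m * (B + 1) + 1) τ (fun τ => I τ ∧ ¬ τ.var x < τ.var y) := by
    intro m
    induction m with
    | zero =>
      intro τ hF hI hm
      by_cases hxy : τ.var x < τ.var y
      · obtain ⟨_, _, _, _, _, h⟩ := step τ hF hI hxy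
        omega
      · exact ⟨1, τ, .whileFalse hxy, by omega, hI, hxy⟩
    | succ m ih =>
      intro τ hF hI hm
      by_cases hxy : τ.var x < τ.var y
      · obtain ⟨t, τ', he, ht, hI', hμ⟩ := step τ hF hI hxy
        obtain ⟨t', τ'', he', ht', h'⟩ := ih τ' (hF.trans he.frame) hI' (by omega)
        refine ⟨t + t' + 1, τ'', .whileTrue hxy he he', ?_, h'⟩
        rw [add_mul]
        omega
      · exact ⟨1, τ, .whileFalse hxy, by omega, hI, hxy⟩
  exact key _ _ ⟨fun _ _ => rfl, fun _ _ => rfl, fun _ => rfl⟩ h0 le_rfl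

end Runs

/-- Whether the program contains no loop. -/
def Program.loopFree : Program → Bool
  | .seq p q => p.loopFree && q.loopFree
  | .ifLT _ _ p q => p.loopFree && q.loopFree
  | .whileLT _ _ _ => false
  | _ => true

/-- The largest possible running time of a program without loops. -/
def Program.cost : Program → ℕ
  | .seq p q => p.cost + q.cost
  | .ifLT _ _ p q => max p.cost q.cost + 1
  | _ => 1

/-- The final state of a program without loops. -/
def Program.result (ω : ℕ → Bool) : Program → State → State
  | .skip, σ => σ
  | .const x c, σ => σ.setVar x c
  | .add x y z, σ => σ.setVar x (σ.var y + σ.var z)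
  | .sub x y z, σ => σ.setVar x (σ.var y - σ.var z)
  | .load x a y, σ => σ.setVar x (σ.arr a (σ.var y))
  | .store a x y, σ => σ.setArr a (σ.var x) (σ.var y)
  | .flip x, σ => { σ.setVar x (ω σ.coins).toNat with coins := σ.coins + 1 }
  | .seq p q, σ => q.result ω (p.result ω σ)
  | .ifLT x y p q, σ => if σ.var x < σ.var y then p.result ω σ else q.result ω σ
  | .whileLT _ _ _, σ => σ

theorem Program.runs_result (ω : ℕ → Bool) {p : Program} (hp : p.loopFree = true) (σ : State) :
    Runs ω p p.cost σ (fun τ => τ = p.result ω σ) := by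
  induction p generalizing σ with
  | skip => exact ⟨1, _, .skip σ, le_rfl, rfl⟩
  | const x c => exact ⟨1, _, .const σ x c, le_rfl, rfl⟩
  | add x y z => exact ⟨1, _, .add σ x y z, le_rfl, rfl⟩
  | sub x y z => exact ⟨1, _, .sub σ x y z, le_rfl, rfl⟩
  | load x a y => exact ⟨1, _, .load σ x a y, le_rfl, rfl⟩
  | store a x y => exact ⟨1, _, .store σ a x y, le_rfl, rfl⟩
  | flip x => exact ⟨1, _, .flip σ x, le_rfl, rfl⟩
  | seq p q ih ih' =>
    simp only [Program.loopFree, Bool.and_eq_true] at hp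
    refine (ih hp.1 σ).seq fun τ _ hτ => ?_
    subst hτ
    exact ih' hp.2 _
  | ifLT x y p q ih ih' =>
    simp only [Program.loopFree, Bool.and_eq_true] at hp
    refine Runs.ite (fun h => ?_) (fun h => ?_)
    · refine (ih hp.1 σ).mono (le_max_left _ _) fun τ _ hτ => ?_
      simp [Program.result, h, hτ]
    · refine (ih' hp.2 σ).mono (le_max_right _ _) fun τ _ hτ => ?_
      simp [Program.result, h, hτ]
  | whileLT => simp [Program.loopFree] at hp

/-- A program without loops is verified by evaluating it. -/
theorem Runs.of_result {ω : ℕ → Bool} {p : Program} {B : ℕ} {σ : State} {Q : State → Prop}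
    (hp : p.loopFree = true) (hB : p.cost ≤ B) (hQ : Q (p.result ω σ)) : Runs ω p B σ Q :=
  (Program.runs_result ω hp σ).mono hB fun _ _ h => h ▸ hQ

@[simp] theorem State.ite_var (c : Prop) [Decidable c] (σ τ : State) (x : ℕ) :
    (if c then σ else τ).var x = if c then σ.var x else τ.var x := by
  split <;> rfl

@[simp] theorem State.ite_arr (c : Prop) [Decidable c] (σ τ : State) (a : ℕ) :
    (if c then σ else τ).arr a = fun i => if c then σ.arr a i else τ.arr a i := by
  split <;> rfl

/-- Sequential composition of programs. -/
infixr:65 " ;; " => Program.seq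

/-- If `x = y` then `p`. -/
def ifEq (x y : ℕ) (p : Program) : Program := .ifLT x y .skip (.ifLT y x .skip p)

theorem Program.result_ifEq (ω : ℕ → Bool) (x y : ℕ) (p : Program) (σ : State) :
    (ifEq x y p).result ω σ = if σ.var x = σ.var y then p.result ω σ else σ := by
  simp only [ifEq, Program.result]
  split_ifs <;> first | rfl | omega

/-- Equality takes two tests; the third extra step pays for `skip` if the variables differ. -/
theorem Runs.ifEq {ω : ℕ → Bool} {x y : ℕ} {p : Program} {B : ℕ} {σ : State}
    {Q : State → Prop} (h : σ.var x = σ.var y → Runs ω p B σ Q) (h' : σ.var x ≠ σ.var y → Q σ) :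
    Runs ω (TemporalPaths.ifEq x y p) (B + 3) σ Q := by
  have hskip : σ.var x ≠ σ.var y → Runs ω .skip 1 σ Q := fun hne =>
    ⟨1, σ, .skip σ, le_rfl, h' hne⟩
  refine Runs.ite (fun hlt => (hskip hlt.ne).mono (by omega) fun _ _ h => h) fun hlt => ?_
  refine (Runs.ite (B := B + 1) (fun hlt' => (hskip hlt'.ne').mono (by omega) fun _ _ h => h)
    fun hlt' => (h (by omega)).mono (by omega) fun _ _ h => h).mono (by omega) fun _ _ h => h

/-- If `x ≠ y` then `p`, else `q`. -/
def ifNe (x y : ℕ) (p q : Program) : Program := .ifLT x y p (.ifLT y x p q)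

theorem Runs.ifNe {ω : ℕ → Bool} {x y : ℕ} {p q : Program} {B : ℕ} {σ : State}
    {Q : State → Prop} (h : σ.var x ≠ σ.var y → Runs ω p B σ Q)
    (h' : σ.var x = σ.var y → Runs ω q B σ Q) :
    Runs ω (TemporalPaths.ifNe x y p q) (B + 3) σ Q := by
  refine (Runs.ite (B := B + 1) (fun hlt => (h hlt.ne).mono (by omega) fun _ _ h => h)
    fun hlt => Runs.ite (fun hlt' => h hlt'.ne') fun hlt' => h' (by omega)).mono (by omega)
    fun _ _ h => h

/-- `for i = 0, …, N - 1 do p`, where `N` is a variable. The variable `14` has to hold `1`, here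
and in all programs below. -/
def forLoop (i N : ℕ) (p : Program) : Program :=
  .seq (.const i 0) (.whileLT i N (.seq p (.add i i 14)))

/-- A counting loop, with an invariant `I j` that holds before the round in which the counter is
`j`. What the loop does not write to is known to be unchanged in every round. Besides its body, a
round costs a test and an increment. -/
theorem Runs.forLoop {ω : ℕ → Bool} {p : Program} {B i N : ℕ} {σ : State} (n : ℕ)
    (I : ℕ → State → Prop)
    (h1 : σ.var 14 = 1) (hN : σ.var N = n)
    (hw : p.writesVar i = false ∧ p.writesVar N = false ∧ p.writesVar 14 = false ∧ N ≠ i ∧ 14 ≠ i)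
    (h0 : I 0 (σ.setVar i 0))
    (step : ∀ j < n, ∀ τ, Frame (TemporalPaths.forLoop i N p) σ τ → τ.var i = j → I j τ →
      Runs ω p B τ (fun τ' => I (j + 1) (τ'.setVar i (j + 1)))) :
    Runs ω (TemporalPaths.forLoop i N p) (n * (B + 2) + 2) σ (I n) := by
  obtain ⟨hwi, hwN, hw1, hNi, h1i⟩ := hw
  have hF0 : Frame (TemporalPaths.forLoop i N p) σ (σ.setVar i 0) :=
    ⟨fun x hx => by
      simp only [TemporalPaths.forLoop, Program.writesVar, Bool.or_eq_false_iff] at hx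
      simp_all, fun _ _ => rfl, fun _ => rfl⟩
  refine (Runs.seq (B := 1) (B' := n * (B + 2) + 1) (q := .whileLT i N (.seq p (.add i i 14)))
    (Q := fun τ => τ = σ.setVar i 0) ⟨1, _, .const σ i 0, le_rfl, rfl⟩ ?_).mono (by omega)
    fun _ _ h => h
  rintro _ - rfl
  have := Runs.whileLT (ω := ω) (p := .seq p (.add i i 14)) (σ := σ.setVar i 0) (x := i) (y := N)
    (B := B + 1)
    (fun τ => Frame (TemporalPaths.forLoop i N p) σ τ ∧ τ.var i ≤ n ∧ I (τ.var i) τ)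
    (fun τ => n - τ.var i) ⟨hF0, by simp, by simpa using h0⟩ ?_
  · refine this.mono (by simp) fun τ _ ⟨⟨hF, hle, hI⟩, hlt⟩ => ?_
    have : τ.var N = n := by
      rw [hF.var N (by simp [TemporalPaths.forLoop, Program.writesVar, hwN, hNi]), hN]
    have : τ.var i = n := by omega
    rwa [this] at hI
  · rintro τ - ⟨hF, hle, hI⟩ hlt
    have hNn : τ.var N = n := by
      rw [hF.var N (by simp [TemporalPaths.forLoop, Program.writesVar, hwN, hNi]), hN]
    refine (step (τ.var i) (by omega) τ hF rfl hI).seq (B' := 1) fun τ' hF' hI' => ?_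
    have e1 : τ'.var i = τ.var i := hF'.var i hwi
    have e2 : τ'.var 14 = 1 := by
      rw [hF'.var 14 hw1, hF.var 14 (by simp [TemporalPaths.forLoop, Program.writesVar, hw1, h1i]),
        h1]
    refine ⟨1, _, .add τ' i i 14, le_rfl, ?_⟩
    rw [e1, e2]
    refine ⟨⟨hF.trans ?_, ?_, ?_⟩, ?_⟩
    · refine ⟨fun x hx => ?_, fun a ha => ?_, fun hc => ?_⟩
      · simp only [TemporalPaths.forLoop, Program.writesVar, Bool.or_eq_false_iff] at hx
        have := hF'.var x hx.2.1
        simp_all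
      · simp only [TemporalPaths.forLoop, Program.writesArr, Bool.or_eq_false_iff] at ha
        simpa using hF'.arr a ha.2.1
      · simp only [TemporalPaths.forLoop, Program.tosses, Bool.or_eq_false_iff] at hc
        simpa using hF'.coins hc.2.1
    · simp only [State.setVar_var, if_true]
      omega
    · simpa using hI'
    · simp only [State.setVar_var, if_true]
      omega

/-- `x := y * z` by repeated addition, with the auxiliary variable `i`. -/
def mulProg (x y z i : ℕ) : Program :=
  .seq (.const x 0) (forLoop i y (.add x x z))

theorem runs_mulProg {ω : ℕ → Bool} {x y z i : ℕ} {σ : State} (h1 : σ.var 14 = 1)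
    (hx : [y, z, i, 14].all (· ≠ x) = true) (hi : [x, y, z, 14].all (· ≠ i) = true) :
    Runs ω (mulProg x y z i) (3 * σ.var y + 3) σ
      (fun τ => τ.var x = σ.var y * σ.var z) := by
  simp only [List.all_cons, List.all_nil, Bool.and_true, Bool.and_eq_true, decide_eq_true_eq]
    at hx hi
  refine (Runs.seq (B := 1) (B' := σ.var y * (1 + 2) + 2) (Q := fun τ => τ = σ.setVar x 0)
    ⟨1, _, .const σ x 0, le_rfl, rfl⟩ ?_).mono (by omega) fun _ _ h => h
  rintro _ - rfl
  refine Runs.forLoop _ (fun j τ => τ.var x = j * σ.var z) (by simp [hx, h1]) (by simp [hx])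
    (by simp [Program.writesVar]; tauto) (by simp) ?_
  intro j hj τ hF hτi hI
  refine ⟨1, _, .add τ x x z, le_rfl, ?_⟩
  have : τ.var z = σ.var z := by
    rw [hF.var z (by simp [forLoop, Program.writesVar]; tauto)]
    simp [hx]
  simp [this, hI, hi, add_mul]

/-- `x := y ^ N`, with the auxiliary variables `i, j, w`. -/
def powProg (x y N i j w : ℕ) : Program :=
  .seq (.const x 1) (forLoop i N (.seq (mulProg w y x j) (.seq (.const x 0) (.add x x w))))

theorem runs_powProg {ω : ℕ → Bool} {x y N i j w : ℕ} {σ : State} (h1 : σ.var 14 = 1)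
    (hx : [y, N, i, j, w, 14].all (· ≠ x) = true) (hi : [x, y, N, j, w, 14].all (· ≠ i) = true)
    (hj : [x, y, N, i, w, 14].all (· ≠ j) = true) (hw : [x, y, N, i, j, 14].all (· ≠ w) = true) :
    Runs ω (powProg x y N i j w) (σ.var N * (3 * σ.var y + 7) + 3) σ
      (fun τ => τ.var x = σ.var y ^ σ.var N) := by
  simp only [List.all_cons, List.all_nil, Bool.and_true, Bool.and_eq_true, decide_eq_true_eq]
    at hx hi hj hw
  refine (Runs.seq (B := 1) (B' := σ.var N * (3 * σ.var y + 5 + 2) + 2)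
    (Q := fun τ => τ = σ.setVar x 1)
    ⟨1, _, .const σ x 1, le_rfl, rfl⟩ ?_).mono (le_of_eq (by ring)) fun _ _ h => h
  rintro _ - rfl
  refine Runs.forLoop _ (fun j τ => τ.var x = σ.var y ^ j) (by simp [hx, h1]) (by simp [hx])
    (by simp [Program.writesVar, mulProg, forLoop]; tauto) (by simp [hi]) ?_
  intro m hm τ hF hτi hI
  have ey : τ.var y = σ.var y := by
    rw [hF.var y (by simp [forLoop, mulProg, Program.writesVar]; tauto)]
    simp [hx]
  have e1 : τ.var 14 = 1 := by
    rw [hF.var 14 (by simp [forLoop, mulProg, Program.writesVar]; tauto)]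
    simp [hx, h1]
  refine (runs_mulProg (ω := ω) (σ := τ) (x := w) (y := y) (z := x) (i := j) e1
    (by simp; tauto) (by simp; tauto)).seq (B' := 2) ?_ |>.mono (by omega) fun _ _ h => h
  intro τ' hF' h'
  refine Runs.of_result rfl le_rfl ?_
  simp only [Program.result, State.setVar_var]
  simp [hx, hi, h', hI, ey, pow_succ, mul_comm]

/-! ### Temporal walks as lists of steps, and coloured walks -/

section Walks

variable {V : Type*}

/-- The list `[(v₁, t₁), …, (vₖ, tₖ)]` describes a temporal walk `u, v₁, …, vₖ = z` with
`t ≤ t₁ ≤ ⋯ ≤ tₖ`. -/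
def TemporalGraph.IsWalk (G : TemporalGraph V) (z : V) : ℕ → V → List (V × ℕ) → Prop
  | _, u, [] => u = z
  | t, u, x :: Q => t ≤ x.2 ∧ (s(u, x.1), x.2) ∈ G.timeEdges ∧ G.IsWalk z x.2 x.1 Q

/-- The sequence of time-edges of the walk from `u` described by a list of steps. -/
def edgesOf : V → List (V × ℕ) → List (Sym2 V × ℕ)
  | _, [] => []
  | u, x :: Q => (s(u, x.1), x.2) :: edgesOf x.1 Q

@[simp] theorem length_edgesOf (u : V) (Q : List (V × ℕ)) : (edgesOf u Q).length = Q.length := by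
  induction Q generalizing u with
  | nil => rfl
  | cons x Q ih => simp [edgesOf, ih]

theorem edgesOf_injective (u : V) : Function.Injective (edgesOf u) := by
  intro Q
  induction Q generalizing u with
  | nil =>
    intro Q' h
    cases Q' with
    | nil => rfl
    | cons => simp [edgesOf] at h
  | cons x Q ih =>
    intro Q' h
    cases Q' with
    | nil => simp [edgesOf] at h
    | cons y Q' =>
      simp only [edgesOf, List.cons.injEq, Prod.mk.injEq, Sym2.congr_right] at h
      obtain ⟨⟨h1, h2⟩, h3⟩ := h
      have : x = y := Prod.ext h1 h2
      subst this
      rw [ih _ h3]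

theorem getElem_edgesOf (u : V) (Q : List (V × ℕ)) (i : ℕ) (hi : i < Q.length) :
    ((edgesOf u Q)[i]'(by simpa using hi)).1 =
      s((u :: Q.map Prod.fst)[i]'(by simp; omega),
        (u :: Q.map Prod.fst)[i + 1]'(by simpa using hi)) := by
  induction Q generalizing u i with
  | nil => simp at hi
  | cons x Q ih =>
    cases i with
    | zero => simp [edgesOf]
    | succ i =>
      have := ih x.1 i (by simpa using hi)
      simpa [edgesOf] using this

theorem TemporalGraph.IsWalk.last_mem {G : TemporalGraph V} {z : V} {t : ℕ} {u : V}
    {Q : List (V × ℕ)} (h : G.IsWalk z t u Q) : z ∈ u :: Q.map Prod.fst := by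
  induction Q generalizing t u with
  | nil => simp [show u = z from h]
  | cons x Q ih => exact List.mem_cons_of_mem _ (by simpa using ih h.2.2)

theorem TemporalGraph.IsWalk.getLast {G : TemporalGraph V} {z : V} {t : ℕ} {u : V}
    {Q : List (V × ℕ)} (h : G.IsWalk z t u Q) :
    (u :: Q.map Prod.fst)[Q.length]'(by simp) = z := by
  induction Q generalizing t u with
  | nil => simpa using show u = z from h
  | cons x Q ih => simpa using ih h.2.2

theorem TemporalGraph.IsWalk.edgesOf_mem {G : TemporalGraph V} {z : V} {t : ℕ} {u : V}
    {Q : List (V × ℕ)} (h : G.IsWalk z t u Q) : ∀ e ∈ edgesOf u Q, e ∈ G.timeEdges := by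
  induction Q generalizing t u with
  | nil => simp [edgesOf]
  | cons x Q ih =>
    intro e he
    rcases List.mem_cons.1 he with rfl | he
    · exact h.2.1
    · exact ih h.2.2 e he

theorem TemporalGraph.IsWalk.isChain {G : TemporalGraph V} {z : V} {t : ℕ} {u : V}
    {Q : List (V × ℕ)} (h : G.IsWalk z t u Q) :
    (edgesOf u Q).IsChain (fun e f => e.2 ≤ f.2) := by
  induction Q generalizing t u with
  | nil => simp [edgesOf]
  | cons x Q ih =>
    cases Q with
    | nil => simp [edgesOf]
    | cons y Q => exact List.IsChain.cons_cons h.2.2.1 (ih h.2.2)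

/-- Temporal paths are the temporal walks that do not repeat vertices. -/
theorem TemporalGraph.isTemporalPath_iff (G : TemporalGraph V) (u z : V)
    (P : List (Sym2 V × ℕ)) :
    G.IsTemporalPath u z P ↔
      ∃ Q, edgesOf u Q = P ∧ G.IsWalk z 1 u Q ∧ (u :: Q.map Prod.fst).Nodup := by
  constructor
  · rintro ⟨⟨v, hv, h0, hz, hP⟩, hE, hc⟩
    have key : ∀ (P : List (Sym2 V × ℕ)) (t : ℕ) (v : Fin (P.length + 1) → V),
        v (Fin.last P.length) = z →
        (∀ i : Fin P.length, (P.get i).1 = s(v i.castSucc, v i.succ)) →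
        (∀ e ∈ P, e ∈ G.timeEdges) → P.IsChain (fun e f => e.2 ≤ f.2) →
        (∀ e ∈ P.head?, t ≤ e.2) →
        ∃ Q, edgesOf (v 0) Q = P ∧ G.IsWalk z t (v 0) Q ∧
          v 0 :: Q.map Prod.fst = List.ofFn v := by
      intro P
      induction P with
      | nil => exact fun t v hz _ _ _ _ => ⟨[], rfl, hz, by simp⟩
      | cons e P ih =>
        intro t v hz hP hE hc ht
        obtain ⟨Q, h1, h2, h3⟩ := ih e.2 (fun i => v i.succ) hz (fun i => hP i.succ)
          (fun f hf => hE f (List.mem_cons_of_mem _ hf)) hc.tail (by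
            intro f hf
            cases P with
            | nil => simp at hf
            | cons g P =>
              simp only [List.head?_cons, Option.mem_def, Option.some.injEq] at hf
              subst hf
              exact (List.isChain_cons_cons.1 hc).1)
        have he : e = (s(v 0, v 1), e.2) := Prod.ext (hP 0) rfl
        refine ⟨(v 1, e.2) :: Q, ?_, ⟨ht e (by simp), ?_, h2⟩, ?_⟩
        · rw [edgesOf, ← he]
          exact congrArg _ h1
        · rw [← he]
          exact hE e (by simp)
        · rw [List.ofFn_succ]
          exact congrArg (v 0 :: ·) h3
    obtain ⟨Q, h1, h2, h3⟩ := key P 1 v hz hP hE hc (by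
      intro e he
      exact (Finset.mem_Icc.1 (G.label_mem e (hE e (List.mem_of_mem_head? he)))).1)
    rw [h0] at h1 h2 h3
    exact ⟨Q, h1, h2, by rw [h3]; exact List.nodup_ofFn.2 hv⟩
  · rintro ⟨Q, rfl, hQ, hnd⟩
    refine ⟨⟨fun i => (u :: Q.map Prod.fst)[(i : ℕ)]'(by
      have := i.2; simp at this ⊢; omega), ?_, ?_, ?_, ?_⟩, hQ.edgesOf_mem, hQ.isChain⟩
    · intro i j hij
      exact Fin.ext ((List.Nodup.getElem_inj_iff hnd).1 hij)
    · simp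
    · simpa using hQ.getLast
    · intro i
      have := getElem_edgesOf u Q i (by simpa using i.2)
      simpa using this

/-- In a walk with the steps `Q`, every vertex after the first one is coloured with the number of
steps that remain after it has been reached. -/
def Colored (col : V → ℕ) : List (V × ℕ) → Prop
  | [] => True
  | x :: Q => col x.1 = Q.length ∧ Colored col Q

instance (col : V → ℕ) : DecidablePred (Colored col) := fun Q => by
  induction Q with
  | nil => exact isTrue trivial
  | cons x Q ih =>
    unfold Colored
    infer_instance

theorem Colored.lt {col : V → ℕ} {Q : List (V × ℕ)} (h : Colored col Q) :
    ∀ v ∈ Q.map Prod.fst, col v < Q.length := by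
  induction Q with
  | nil => simp
  | cons x Q ih =>
    intro v hv
    rcases List.mem_cons.1 hv with rfl | hv
    · simp [h.1]
    · have := ih h.2 v hv
      simp only [List.length_cons]
      omega

theorem Colored.nodup {col : V → ℕ} {Q : List (V × ℕ)} (h : Colored col Q) :
    (Q.map Prod.fst).Nodup := by
  induction Q with
  | nil => simp
  | cons x Q ih =>
    refine List.nodup_cons.2 ⟨fun hx => ?_, ih h.2⟩
    have := h.2.lt _ hx
    have := h.1
    omega

/-- The colouring computed from numbers `x v` attached to the vertices: the target has colour `0`,
the source the colour `K + 1`, which is useless, and the others the colour `⌊x v / a⌋ + 1`. -/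
def coloring [DecidableEq V] (s z : V) (K a : ℕ) (x : V → ℕ) (v : V) : ℕ :=
  if v = z then 0 else if v = s then K + 1 else x v / a + 1

/-- That a given path is coloured properly prescribes `⌊x v / a⌋` for its inner vertices. -/
theorem exists_colored_iff [DecidableEq V] {G : TemporalGraph V} {s z : V} {K a t : ℕ} {u : V}
    {Q : List (V × ℕ)} (hQ : G.IsWalk z t u Q) (hne : Q ≠ []) (hnd : (Q.map Prod.fst).Nodup)
    (hs : s ∉ Q.map Prod.fst) :
    ∃ (J : Finset V) (r : V → ℕ), J.card + 1 = Q.length ∧ (∀ v ∈ J, v ∈ Q.map Prod.fst) ∧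
      (∀ v ∈ J, r v + 1 < Q.length) ∧
      ∀ x : V → ℕ, Colored (coloring s z K a x) Q ↔ ∀ v ∈ J, x v / a = r v := by
  induction Q generalizing t u with
  | nil => exact absurd rfl hne
  | cons y Q ih =>
    obtain ⟨hy, hnd'⟩ := List.nodup_cons.1 hnd
    simp only [List.map_cons, List.mem_cons, not_or] at hs
    by_cases hQ0 : Q = []
    · subst hQ0
      have : y.1 = z := hQ.2.2
      exact ⟨∅, fun _ => 0, by simp [Colored, coloring, this]⟩
    · obtain ⟨J, r, h1, h2, h3, h4⟩ := ih hQ.2.2 hQ0 hnd' hs.2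
      have hyJ : y.1 ∉ J := fun h => hy (h2 _ h)
      have hyz : y.1 ≠ z := by
        rintro h
        obtain ⟨w, Q, rfl⟩ := List.exists_cons_of_ne_nil hQ0
        exact hy (by simpa [h] using hQ.2.2.2.2.last_mem)
      refine ⟨insert y.1 J, fun v => if v = y.1 then Q.length - 1 else r v, ?_, ?_, ?_, ?_⟩
      · rw [Finset.card_insert_of_notMem hyJ, h1, List.length_cons]
      · intro v hv
        rcases Finset.mem_insert.1 hv with rfl | hv
        · simp
        · exact List.mem_cons_of_mem _ (h2 v hv)
      · intro v hv
        simp only [List.length_cons]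
        split_ifs with h
        · omega
        · have := h3 v ((Finset.mem_insert.1 hv).resolve_left h)
          omega
      · intro x
        rw [Colored, h4, Finset.forall_mem_insert]
        refine and_congr ?_ (forall₂_congr fun v hv => ?_)
        · rw [coloring, if_neg hyz, if_neg (Ne.symm hs.1)]
          simp only [if_true]
          omega
        · have : v ≠ y.1 := fun h => hyJ (h ▸ hv)
          simp only [this, if_false]

variable [Fintype V] [DecidableEq V]

/-- The temporal walks with `c` steps from `u` to `z` with labels at least `t`. -/
def TemporalGraph.walks (G : TemporalGraph V) (z : V) : ℕ → ℕ → V → Finset (List (V × ℕ))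
  | 0, _, u => if u = z then {[]} else ∅
  | c + 1, t, u =>
    ((Finset.univ ×ˢ Finset.Icc t G.lifetime).filter
      fun x : V × ℕ => (s(u, x.1), x.2) ∈ G.timeEdges).biUnion
        fun x => (G.walks z c x.2 x.1).image (List.cons x)

theorem TemporalGraph.mem_walks (G : TemporalGraph V) (z : V) (c t : ℕ) (u : V)
    (Q : List (V × ℕ)) : Q ∈ G.walks z c t u ↔ Q.length = c ∧ G.IsWalk z t u Q := by
  induction c generalizing t u Q with
  | zero =>
    by_cases h : u = z
    · simp only [walks, h, if_true, Finset.mem_singleton, List.length_eq_zero_iff]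
      exact ⟨fun hQ => ⟨hQ, hQ ▸ rfl⟩, fun hQ => hQ.1⟩
    · simp only [walks, h, if_false, Finset.notMem_empty, List.length_eq_zero_iff, false_iff]
      rintro ⟨rfl, h'⟩
      exact h h'
  | succ c ih =>
    simp only [walks, Finset.mem_biUnion, Finset.mem_filter, Finset.mem_product,
      Finset.mem_univ, true_and, Finset.mem_image, Finset.mem_Icc]
    constructor
    · rintro ⟨x, ⟨⟨h1, -⟩, h2⟩, Q, hQ, rfl⟩
      obtain ⟨h3, h4⟩ := (ih _ _ _).1 hQ
      exact ⟨by simp [h3], h1, h2, h4⟩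
    · rintro ⟨hl, hQ⟩
      cases Q with
      | nil => simp at hl
      | cons x Q =>
        exact ⟨x, ⟨⟨hQ.1, (Finset.mem_Icc.1 (G.label_mem _ hQ.2.1)).2⟩, hQ.2.1⟩, Q,
          (ih _ _ _).2 ⟨by simpa using hl, hQ.2.2⟩, rfl⟩

/-- The temporal paths with `k` edges from `s` to `z`, as lists of steps. -/
def TemporalGraph.pathSet (G : TemporalGraph V) (s z : V) (k : ℕ) : Finset (List (V × ℕ)) :=
  (G.walks z k 1 s).filter fun Q => (s :: Q.map Prod.fst).Nodup

theorem TemporalGraph.mem_pathSet (G : TemporalGraph V) (s z : V) (k : ℕ) (Q : List (V × ℕ)) :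
    Q ∈ G.pathSet s z k ↔
      Q.length = k ∧ G.IsWalk z 1 s Q ∧ (s :: Q.map Prod.fst).Nodup := by
  rw [pathSet, Finset.mem_filter, mem_walks, and_assoc]

theorem TemporalGraph.numPathsOfLength_eq (G : TemporalGraph V) (s z : V) (k : ℕ) :
    G.numPathsOfLength s z k = (G.pathSet s z k).card := by
  have : {P | G.IsTemporalPath s z P ∧ P.length = k} = edgesOf s '' (G.pathSet s z k) := by
    ext P
    simp only [Set.mem_ofPred_eq, G.isTemporalPath_iff, Set.mem_image, Finset.mem_coe,
      mem_pathSet]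
    constructor
    · rintro ⟨⟨Q, rfl, h1, h2⟩, h3⟩
      exact ⟨Q, ⟨by simpa using h3, h1, h2⟩, rfl⟩
    · rintro ⟨Q, ⟨h3, h1, h2⟩, rfl⟩
      exact ⟨⟨Q, rfl, h1, h2⟩, by simpa using h3⟩
  rw [numPathsOfLength, this, Set.ncard_image_of_injective _ (edgesOf_injective s),
    Set.ncard_coe_finset]

theorem TemporalGraph.numPaths_eq (G : TemporalGraph V) (s z : V) (M : ℕ)
    (hM : ∀ k Q, Q ∈ G.pathSet s z k → k < M) :
    G.numPaths s z = ∑ k ∈ Finset.range M, (G.pathSet s z k).card := by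
  have : {P | G.IsTemporalPath s z P} =
      edgesOf s '' ((Finset.range M).biUnion fun k => G.pathSet s z k : Finset _) := by
    ext P
    simp only [Set.mem_ofPred_eq, G.isTemporalPath_iff, Set.mem_image, Finset.mem_coe,
      Finset.mem_biUnion, Finset.mem_range, mem_pathSet]
    constructor
    · rintro ⟨Q, rfl, h1, h2⟩
      exact ⟨Q, ⟨_, hM _ Q ((G.mem_pathSet s z _ Q).2 ⟨rfl, h1, h2⟩), rfl, h1, h2⟩, rfl⟩
    · rintro ⟨Q, ⟨k, -, -, h1, h2⟩, rfl⟩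
      exact ⟨Q, rfl, h1, h2⟩
  rw [numPaths, this, Set.ncard_image_of_injective _ (edgesOf_injective s),
    Set.ncard_coe_finset, Finset.card_biUnion]
  intro i _ j _ hij
  refine Finset.disjoint_left.2 fun Q hi hj => hij ?_
  rw [← ((G.mem_pathSet s z i Q).1 hi).1, ((G.mem_pathSet s z j Q).1 hj).1]

theorem TemporalGraph.card_pathSet_zero (G : TemporalGraph V) (s z : V) :
    (G.pathSet s z 0).card = if s = z then 1 else 0 := by
  by_cases h : s = z
  · simp [pathSet, walks, h, Finset.filter_singleton]
  · simp [pathSet, walks, h]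

theorem TemporalGraph.pathSet_self_succ (G : TemporalGraph V) (z : V) (k : ℕ) :
    G.pathSet z z (k + 1) = ∅ := by
  refine Finset.eq_empty_of_forall_notMem fun Q hQ => ?_
  obtain ⟨h1, h2, h3⟩ := (G.mem_pathSet _ _ _ _).1 hQ
  cases Q with
  | nil => simp at h1
  | cons x Q => exact (List.nodup_cons.1 h3).1 (by simpa using h2.2.2.last_mem)

/-- The number of temporal walks with `c` steps from `u` to `z` with labels at least `t` that are
coloured as `Colored` demands. The colour of `u` is irrelevant. -/
def TemporalGraph.coloredCount (G : TemporalGraph V) (z : V) (col : V → ℕ) : ℕ → ℕ → V → ℕ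
  | 0, _, u => if u = z then 1 else 0
  | c + 1, t, u => ∑ t' ∈ Finset.Icc t G.lifetime, ∑ v,
      if (s(u, v), t') ∈ G.timeEdges ∧ col v = c then G.coloredCount z col c t' v else 0

theorem TemporalGraph.coloredCount_eq (G : TemporalGraph V) (z : V) (col : V → ℕ) (c t : ℕ)
    (u : V) :
    G.coloredCount z col c t u = ((G.walks z c t u).filter (Colored col)).card := by
  induction c generalizing t u with
  | zero =>
    by_cases h : u = z
    · simp [walks, coloredCount, h, Finset.filter_singleton, Colored]
    · simp [walks, coloredCount, h]
  | succ c ih =>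
    have hdisj : ∀ (A : Finset (V × ℕ)), (A : Set (V × ℕ)).PairwiseDisjoint
        (fun x => ((G.walks z c x.2 x.1).image (List.cons x)).filter (Colored col)) := by
      intro A x _ y _ hxy
      refine Finset.disjoint_left.2 fun Q hx hy => hxy ?_
      obtain ⟨Q1, -, rfl⟩ := Finset.mem_image.1 (Finset.mem_filter.1 hx).1
      obtain ⟨Q2, -, h⟩ := Finset.mem_image.1 (Finset.mem_filter.1 hy).1
      exact (List.cons.inj h).1.symm
    rw [walks, Finset.filter_biUnion, Finset.card_biUnion (hdisj _), Finset.sum_filter,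
      Finset.sum_product, coloredCount, Finset.sum_comm]
    refine Finset.sum_congr rfl fun v _ => Finset.sum_congr rfl fun t' _ => ?_
    by_cases hE : (s(u, v), t') ∈ G.timeEdges
    · simp only [hE, true_and, if_true]
      rw [Finset.filter_image, Finset.card_image_of_injective _ List.cons_injective]
      by_cases hc : col v = c
      · rw [if_pos hc, ih]
        congr 1
        refine Finset.filter_congr fun Q hQ => ?_
        simp [Colored, hc, ((G.mem_walks _ _ _ _ _).1 hQ).1]
      · rw [if_neg hc, eq_comm, Finset.card_eq_zero, Finset.filter_eq_empty_iff]
        intro Q hQ h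
        exact hc (h.1.trans ((G.mem_walks _ _ _ _ _).1 hQ).1)
    · simp [hE]

theorem TemporalGraph.coloredCount_succ_of_lt (G : TemporalGraph V) (z : V) (col : V → ℕ)
    (c t : ℕ) (u : V) (ht : G.lifetime < t) : G.coloredCount z col (c + 1) t u = 0 := by
  simp [coloredCount, Finset.Icc_eq_empty_of_lt ht]

/-- The recursion behind the dynamic program: the first step has the label `t`, or all labels are at
least `t + 1`. After a first step with the label `t`, the next one may have this label as well. -/
theorem TemporalGraph.coloredCount_step (G : TemporalGraph V) (z : V) (col : V → ℕ)
    (c t : ℕ) (u : V) (ht : t ≤ G.lifetime) :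
    G.coloredCount z col (c + 1) t u = G.coloredCount z col (c + 1) (t + 1) u +
      ∑ v, if (s(u, v), t) ∈ G.timeEdges ∧ col v = c then G.coloredCount z col c t v else 0 := by
  rw [coloredCount, coloredCount, ← Finset.insert_Icc_add_one_left_eq_Icc ht,
    Finset.sum_insert (by simp), add_comm]

/-- A walk that is coloured properly is a path, since the colours along it decrease. -/
theorem TemporalGraph.coloredCount_eq_pathSet (G : TemporalGraph V) (s z : V) (col : V → ℕ)
    (k : ℕ) (hs : k ≤ col s) :
    G.coloredCount z col k 1 s = ((G.pathSet s z k).filter (Colored col)).card := by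
  rw [coloredCount_eq, pathSet, Finset.filter_filter]
  congr 1
  refine Finset.filter_congr fun Q hQ => ⟨fun h => ⟨?_, h⟩, fun h => h.2⟩
  refine List.nodup_cons.2 ⟨fun hx => ?_, h.nodup⟩
  have := h.lt _ hx
  have := ((G.mem_walks _ _ _ _ _).1 hQ).1
  omega

end Walks

/-- What the triple `e` of an instance contributes to the number of coloured walks from `u` whose
first step has label `t` and leads to a vertex `v` of colour `c`, from which there are `f v` ways
to go on. -/
def contribution {n : ℕ} (col : Fin n → ℕ) (f : Fin n → ℕ) (c t : ℕ) (u : Fin n)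
    (e : Fin n × Fin n × ℕ) : ℕ :=
  if e.2.2 = t then
    (if e.1 = u ∧ col e.2.1 = c then f e.2.1 else 0) +
      (if e.2.1 = u ∧ col e.1 = c then f e.1 else 0)
  else 0

theorem PathInstance.mem_timeEdges (I : PathInstance) {e : Fin I.n × Fin I.n × ℕ}
    (he : e ∈ I.triples) : (s(e.1, e.2.1), e.2.2) ∈ I.graph.timeEdges := by
  rw [← Finset.mem_val, ← I.triples_eq]
  exact List.mem_map.2 ⟨e, he, rfl⟩

/-- A sum over neighbours as a sum over the list of triples, in which every time-edge occurs once.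
-/
theorem PathInstance.sum_contribution (I : PathInstance) (col : Fin I.n → ℕ) (f : Fin I.n → ℕ)
    (c t : ℕ) (u : Fin I.n) :
    (∑ v, if (s(u, v), t) ∈ I.graph.timeEdges ∧ col v = c then f v else 0) =
      (I.triples.map (contribution col f c t u)).sum := by
  have h1 : (∑ v, if (s(u, v), t) ∈ I.graph.timeEdges ∧ col v = c then f v else 0) =
      ∑ e ∈ I.graph.timeEdges, ∑ v, if e = (s(u, v), t) then (if col v = c then f v else 0)
        else 0 := by
    rw [Finset.sum_comm]
    refine Finset.sum_congr rfl fun v _ => ?_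
    rw [Finset.sum_ite_eq' I.graph.timeEdges, ite_and]
  rw [h1, Finset.sum, ← I.triples_eq, Multiset.map_coe, Multiset.sum_coe, List.map_map]
  congr 1
  refine List.map_congr_left fun e he => ?_
  have hne : e.1 ≠ e.2.1 := by
    have := I.graph.not_isDiag _ (I.mem_timeEdges he)
    simpa using this
  simp only [Function.comp, contribution, Prod.mk.injEq]
  by_cases ht : e.2.2 = t
  · simp only [ht, and_true, if_true, Sym2.eq_iff]
    have : ∀ v, (if e.1 = u ∧ e.2.1 = v ∨ e.1 = v ∧ e.2.1 = u then
        (if col v = c then f v else 0) else 0) =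
        (if e.2.1 = v then (if e.1 = u ∧ col v = c then f v else 0) else 0) +
        (if e.1 = v then (if e.2.1 = u ∧ col v = c then f v else 0) else 0) := by
      intro v
      -- the two endpoints of `e` differ, so that only one of the orientations leads from `u` to `v`
      grind
    simp only [this, Finset.sum_add_distrib, Finset.sum_ite_eq, Finset.mem_univ, if_true]
  · simp [ht]

/-! ### The dynamic program -/

/-- The state contains the instance `I`, and the variable `14` holds `1`. -/
structure HasInput (I : PathInstance) (σ : State) : Prop where
  n : σ.var 4 = I.n
  T : σ.var 5 = I.graph.lifetime
  m : σ.var 6 = I.triples.length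
  s : σ.var 7 = I.s
  z : σ.var 8 = I.z
  one : σ.var 14 = 1
  zero : σ.var 15 = 0
  fst : ∀ (j : ℕ) (hj : j < I.triples.length), σ.arr 0 j = (I.triples[j]).1
  snd : ∀ (j : ℕ) (hj : j < I.triples.length), σ.arr 1 j = (I.triples[j]).2.1
  lab : ∀ (j : ℕ) (hj : j < I.triples.length), σ.arr 2 j = (I.triples[j]).2.2

theorem HasInput.frame {I : PathInstance} {σ τ : State} {p : Program} (h : HasInput I σ)
    (hF : Frame p σ τ) (hv : [4, 5, 6, 7, 8, 14, 15].all (fun x => !p.writesVar x) = true)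
    (ha : [0, 1, 2].all (fun x => !p.writesArr x) = true) : HasInput I τ := by
  simp only [List.all_cons, List.all_nil, Bool.and_true, Bool.and_eq_true,
    Bool.not_eq_true'] at hv ha
  obtain ⟨h4, h5, h6, h7, h8, h14, h15⟩ := hv
  obtain ⟨h0, h1, h2⟩ := ha
  constructor
  · rw [hF.var _ h4, h.n]
  · rw [hF.var _ h5, h.T]
  · rw [hF.var _ h6, h.m]
  · rw [hF.var _ h7, h.s]
  · rw [hF.var _ h8, h.z]
  · rw [hF.var _ h14, h.one]
  · rw [hF.var _ h15, h.zero]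
  · rw [hF.arr _ h0]; exact h.fst
  · rw [hF.arr _ h1]; exact h.snd
  · rw [hF.arr _ h2]; exact h.lab

/-- Treat the edge from the vertex in the variable `u` to the vertex in the variable `v` as a first
step to a vertex of the colour in variable `21`. The arrays `31, 32, 33` hold the numbers of walks
from each vertex, the colours, and the numbers of walks from the source by the colour of the second
vertex. -/
def arcProg (u v : ℕ) : Program :=
  .load 30 32 v ;;
  ifEq 30 21 (.load 36 31 v ;; .load 34 32 u ;;
    ifEq 34 22 (.load 35 31 u ;; .add 35 35 36 ;; .store 31 u 35) ;;
    ifEq u 7 (.load 35 33 21 ;; .add 35 35 36 ;; .store 33 21 35))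

theorem runs_arcProg {ω : ℕ → Bool} {τ : State} {u v : ℕ} (hu : 24 ≤ u ∧ u ≤ 25)
    (hv : 24 ≤ v ∧ v ≤ 25) (h22 : τ.var 22 = τ.var 21 + 1) :
    Runs ω (arcProg u v) 16 τ (fun τ' =>
      (∀ w, τ'.arr 31 w = τ.arr 31 w + if τ.arr 32 w = τ.var 21 + 1 then
        (if τ.var u = w ∧ τ.arr 32 (τ.var v) = τ.var 21 then τ.arr 31 (τ.var v) else 0) else 0) ∧
      (∀ i, τ'.arr 33 i = τ.arr 33 i + if i = τ.var 21 then
        (if τ.var u = τ.var 7 ∧ τ.arr 32 (τ.var v) = τ.var 21 then τ.arr 31 (τ.var v) else 0)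
        else 0)) := by
  have e1 : u ≠ 30 := by omega
  have e2 : u ≠ 34 := by omega
  have e3 : u ≠ 35 := by omega
  have e4 : u ≠ 36 := by omega
  have f1 : v ≠ 30 := by omega
  refine Runs.of_result rfl (by simp [arcProg, ifEq, Program.cost]) ?_
  constructor <;> intro w
  · by_cases hc : τ.arr 32 (τ.var v) = τ.var 21 <;> by_cases hw : τ.var u = w <;>
      simp [arcProg, Program.result, Program.result_ifEq, e1, e2, e3, e4, f1, h22, hc, hw]
    all_goals grind
  · by_cases hc : τ.arr 32 (τ.var v) = τ.var 21 <;> by_cases hw : w = τ.var 21 <;>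
      simp [arcProg, Program.result, Program.result_ifEq, e1, e2, e3, e4, f1, h22, hc, hw]
    all_goals grind

/-- Process the time-edge in variable `23` if it has the label in variable `20`. -/
def edgeProg : Program :=
  .load 24 0 23 ;; .load 25 1 23 ;; .load 26 2 23 ;;
    ifEq 26 20 (arcProg 24 25 ;; arcProg 25 24)

/-- Only the values at vertices of colour `c` matter. -/
theorem contribution_congr {n : ℕ} {col : Fin n → ℕ} {f g : Fin n → ℕ} {c : ℕ}
    (h : ∀ v, col v = c → f v = g v) (t : ℕ) (u : Fin n) (e : Fin n × Fin n × ℕ) :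
    contribution col f c t u e = contribution col g c t u e := by
  unfold contribution
  have h1 := h e.1
  have h2 := h e.2.1
  grind

theorem runs_edgeProg {ω : ℕ → Bool} {I : PathInstance} {τ : State} (hI : HasInput I τ)
    {col : Fin I.n → ℕ} (hcol : ∀ v : Fin I.n, τ.arr 32 v = col v) {c t j : ℕ}
    (h20 : τ.var 20 = t) (h21 : τ.var 21 = c) (h22 : τ.var 22 = c + 1) (h23 : τ.var 23 = j)
    (hj : j < I.triples.length) :
    Runs ω edgeProg 38 τ (fun τ' =>
      (∀ w : Fin I.n, τ'.arr 31 w = τ.arr 31 w + if col w = c + 1 then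
        contribution col (fun v => τ.arr 31 v) c t w I.triples[j] else 0) ∧
      (∀ i, τ'.arr 33 i = τ.arr 33 i + if i = c then
        contribution col (fun v => τ.arr 31 v) c t I.s I.triples[j] else 0)) := by
  set e := I.triples[j] with he
  refine Runs.seq (B := 1) (B' := 37) (Q := fun υ => υ = τ.setVar 24 e.1)
    (Runs.of_result rfl le_rfl (by simp [Program.result, h23, hI.fst j hj, he])) ?_
  rintro _ - rfl
  refine Runs.seq (B := 1) (B' := 36) (Q := fun υ => υ = (τ.setVar 24 e.1).setVar 25 e.2.1)
    (Runs.of_result rfl le_rfl (by simp [Program.result, h23, hI.snd j hj, he])) ?_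
  rintro _ - rfl
  refine Runs.seq (B := 1) (B' := 35)
    (Q := fun υ => υ = ((τ.setVar 24 e.1).setVar 25 e.2.1).setVar 26 e.2.2)
    (Runs.of_result rfl le_rfl (by simp [Program.result, h23, hI.lab j hj, he])) ?_
  rintro _ - rfl
  refine Runs.ifEq (B := 32) (fun heq => ?_) (fun hne => ?_)
  · have ht : e.2.2 = t := by simpa [h20] using heq
    refine Runs.seq (B := 16) (B' := 16) (runs_arcProg (by omega) (by omega) (by simp [h22, h21]))
      ?_
    rintro σ hF ⟨h1, h2⟩
    have s21 : σ.var 21 = c := by rw [hF.var 21 rfl]; simp [h21]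
    have s22 : σ.var 22 = c + 1 := by rw [hF.var 22 rfl]; simp [h22]
    have s24 : σ.var 24 = e.1 := by rw [hF.var 24 rfl]; simp
    have s25 : σ.var 25 = e.2.1 := by rw [hF.var 25 rfl]; simp
    have s7 : σ.var 7 = I.s := by rw [hF.var 7 rfl]; simp [hI.s]
    have s32 : σ.arr 32 = τ.arr 32 := by rw [hF.arr 32 rfl]; simp
    refine (runs_arcProg (by omega) (by omega) (by rw [s21, s22])).mono le_rfl ?_
    rintro σ' - ⟨h3, h4⟩
    simp only [State.setVar_var, State.setVar_arr, s21, s24, s25, s7, s32, h21, hcol, hI.s]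
      at h1 h2 h3 h4
    norm_num [h21, hI.s, hcol, Fin.val_inj] at h1 h2 h3 h4
    refine ⟨fun w => ?_, fun i => ?_⟩
    · rw [h3, h1, h1]
      simp only [contribution, ht, hcol, Fin.val_inj]
      grind
    · rw [h4, h2, h1]
      simp only [contribution, ht, hcol]
      grind
  · have ht : e.2.2 ≠ t := by simpa [h20] using hne
    simp [contribution, ht]

/-- Process all time-edges whose second vertex has the colour in variable `21`. -/
def passProg : Program := .add 22 21 14 ;; forLoop 23 6 edgeProg

theorem runs_passProg {ω : ℕ → Bool} {I : PathInstance} {σ : State} (hI : HasInput I σ)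
    {col : Fin I.n → ℕ} (hcol : ∀ v : Fin I.n, σ.arr 32 v = col v) {c t : ℕ}
    (h20 : σ.var 20 = t) (h21 : σ.var 21 = c) :
    Runs ω passProg (I.triples.length * 40 + 3) σ (fun τ =>
      (∀ w : Fin I.n, τ.arr 31 w = σ.arr 31 w + if col w = c + 1 then
        (I.triples.map (contribution col (fun v => σ.arr 31 v) c t w)).sum else 0) ∧
      (∀ i, τ.arr 33 i = σ.arr 33 i + if i = c then
        (I.triples.map (contribution col (fun v => σ.arr 31 v) c t I.s)).sum else 0)) := by
  refine (Runs.seq (B := 1) (B' := I.triples.length * (38 + 2) + 2)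
    (Q := fun υ => υ = σ.setVar 22 (c + 1))
    (Runs.of_result rfl le_rfl (by simp [Program.result, h21, hI.one])) ?_).mono (by omega)
    fun _ _ h => h
  rintro _ hF rfl
  have hI' := hI.frame hF rfl rfl
  refine (Runs.forLoop I.triples.length (fun j τ =>
      (∀ w : Fin I.n, τ.arr 31 w = σ.arr 31 w + if col w = c + 1 then
        ((I.triples.take j).map (contribution col (fun v => σ.arr 31 v) c t w)).sum else 0) ∧
      (∀ i, τ.arr 33 i = σ.arr 33 i + if i = c then
        ((I.triples.take j).map (contribution col (fun v => σ.arr 31 v) c t I.s)).sum else 0))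
      hI'.one hI'.m (by decide) (by simp) ?_).mono le_rfl (by simp)
  rintro j hj τ hF' hτj ⟨h31, h33⟩
  have k20 : τ.var 20 = t := by rw [hF'.var 20 rfl]; simp [h20]
  have k21 : τ.var 21 = c := by rw [hF'.var 21 rfl]; simp [h21]
  have k22 : τ.var 22 = c + 1 := by rw [hF'.var 22 rfl]; simp
  have k32 : τ.arr 32 = σ.arr 32 := by rw [hF'.arr 32 rfl]; simp
  refine (runs_edgeProg (hI'.frame hF' rfl rfl) (fun v => by rw [k32, hcol]) k20 k21 k22 hτj
    hj).mono le_rfl ?_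
  rintro τ' - ⟨h1, h2⟩
  -- the pass only writes to vertices of colour `c + 1`, and only reads from those of colour `c`
  have hf : ∀ v, col v = c → τ.arr 31 v = σ.arr 31 v := by
    intro v hv
    rw [h31]
    simp [hv]
  refine ⟨fun w => ?_, fun i => ?_⟩
  · rw [State.setVar_arr, h1, h31, contribution_congr hf, List.take_add_one]
    simp only [List.getElem?_eq_getElem hj, Option.toList_some, List.map_append, List.map_cons,
      List.map_nil, List.sum_append, List.sum_cons, List.sum_nil]
    split_ifs <;> omega
  · rw [State.setVar_arr, h2, h33, contribution_congr hf, List.take_add_one]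
    simp only [List.getElem?_eq_getElem hj, Option.toList_some, List.map_append, List.map_cons,
      List.map_nil, List.sum_append, List.sum_cons, List.sum_nil]
    split_ifs <;> omega

/-- Process all time-edges with the label `t = T - i`, where `i` is the variable `19`, in the order
of the colours of their second vertices. The variable `16` holds `K + 1`. -/
def labelProg : Program := .sub 20 5 19 ;; forLoop 21 16 passProg

/-- Compute the numbers of coloured walks, in the order of decreasing first labels. -/
def walkProg : Program := forLoop 19 5 labelProg

/-- If the array `31` takes walks with labels at least `t + 1` into account, then it takes those
with labels at least `t` into account afterwards. The array `33` increases by the difference. -/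
theorem runs_labelProg {ω : ℕ → Bool} {I : PathInstance} {σ : State} (hI : HasInput I σ)
    {col : Fin I.n → ℕ} (hcol : ∀ v : Fin I.n, σ.arr 32 v = col v) {K t i : ℕ}
    (h16 : σ.var 16 = K + 1) (h19 : σ.var 19 = i) (ht : I.graph.lifetime - i = t)
    (h31 : ∀ v : Fin I.n, col v ≤ K →
      σ.arr 31 v = I.graph.coloredCount I.z col (col v) (t + 1) v) :
    Runs ω labelProg ((K + 1) * (I.triples.length * 40 + 5) + 3) σ (fun τ =>
      (∀ v : Fin I.n, col v ≤ K → τ.arr 31 v = I.graph.coloredCount I.z col (col v) t v) ∧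
      (∀ c ≤ K, τ.arr 33 c + I.graph.coloredCount I.z col (c + 1) (t + 1) I.s =
        σ.arr 33 c + I.graph.coloredCount I.z col (c + 1) t I.s)) := by
  have htT : t ≤ I.graph.lifetime := by omega
  refine (Runs.seq (B := 1) (B' := (K + 1) * ((I.triples.length * 40 + 3) + 2) + 2)
    (Q := fun υ => υ = σ.setVar 20 t)
    (Runs.of_result rfl le_rfl (by simp [Program.result, hI.T, h19, ht])) ?_).mono
    (le_of_eq (by ring)) fun _ _ h => h
  rintro _ hF rfl
  have hI' := hI.frame hF rfl rfl
  refine (Runs.forLoop (K + 1) (fun c τ =>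
      (∀ v : Fin I.n, col v ≤ K → τ.arr 31 v = if col v ≤ c then
        I.graph.coloredCount I.z col (col v) t v
        else I.graph.coloredCount I.z col (col v) (t + 1) v) ∧
      (∀ d ≤ K, τ.arr 33 d + (if d < c then I.graph.coloredCount I.z col (d + 1) (t + 1) I.s
        else 0) = σ.arr 33 d + if d < c then I.graph.coloredCount I.z col (d + 1) t I.s else 0))
      hI'.one (by simp [h16]) (by decide) ⟨?_, by simp⟩ ?_).mono le_rfl ?_
  · intro v hv
    rw [State.setVar_arr, State.setVar_arr, h31 v hv]
    by_cases h0 : col v = 0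
    · simp [h0, TemporalGraph.coloredCount]
    · simp [h0]
  · rintro c hc τ hF' hτc ⟨k31, k33⟩
    have k20 : τ.var 20 = t := by rw [hF'.var 20 rfl]; simp
    have k32 : τ.arr 32 = σ.arr 32 := by rw [hF'.arr 32 rfl]; simp
    refine (runs_passProg (hI'.frame hF' rfl rfl) (fun v => by rw [k32, hcol]) k20 hτc).mono
      le_rfl ?_
    rintro τ' - ⟨h1, h2⟩
    -- the colours up to `c` have been updated already, as consecutive steps may have equal labels
    have hf : ∀ v, col v = c → τ.arr 31 v = I.graph.coloredCount I.z col c t v := by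
      intro v hv
      rw [k31 v (by omega), if_pos (by omega), hv]
    have hsum : ∀ u : Fin I.n,
        I.graph.coloredCount I.z col (c + 1) t u = I.graph.coloredCount I.z col (c + 1) (t + 1) u +
          (I.triples.map (contribution col (fun v => τ.arr 31 v) c t u)).sum := by
      intro u
      rw [I.graph.coloredCount_step _ _ _ _ _ htT, I.sum_contribution]
      congr 2
      exact List.map_congr_left fun e _ => (contribution_congr hf t u e).symm
    refine ⟨fun w hw => ?_, fun d hd => ?_⟩
    · rw [State.setVar_arr, h1, k31 w hw]
      by_cases h3 : col w = c + 1
      · rw [if_neg (by omega), if_pos h3, if_pos (by omega), h3, hsum]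
      · rw [if_neg h3, add_zero]
        by_cases h4 : col w ≤ c
        · rw [if_pos h4, if_pos (by omega)]
        · rw [if_neg h4, if_neg (by omega)]
    · have := k33 d hd
      rw [State.setVar_arr, h2]
      by_cases h3 : d = c
      · subst h3
        have := hsum I.s
        simp at *
        omega
      · have h4 : d < c + 1 ↔ d < c := by omega
        simp only [h3, h4, if_false]
        omega
  · rintro τ - ⟨h1, h2⟩
    refine ⟨fun v hv => ?_, fun c hc => ?_⟩
    · rw [h1 v hv, if_pos (by omega)]
    · have := h2 c hc
      simpa [show c < K + 1 by omega] using this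

/-- The dynamic program adds to the cell `c` of the array `33`, for `c ≤ K`, the number of coloured
walks from the source with `c` inner vertices. -/
theorem runs_walkProg {ω : ℕ → Bool} {I : PathInstance} {σ : State} (hI : HasInput I σ)
    {col : Fin I.n → ℕ} (hcol : ∀ v : Fin I.n, σ.arr 32 v = col v) {K : ℕ}
    (h16 : σ.var 16 = K + 1) (hz : ∀ v, col v = 0 → v = I.z)
    (h31 : ∀ v : Fin I.n, σ.arr 31 v = if v = I.z then 1 else 0) (hz0 : col I.z = 0) :
    Runs ω walkProg (I.graph.lifetime * ((K + 1) * (I.triples.length * 40 + 5) + 5) + 2) σ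
      (fun τ => ∀ c ≤ K,
        τ.arr 33 c = σ.arr 33 c + I.graph.coloredCount I.z col (c + 1) 1 I.s) := by
  refine (Runs.forLoop I.graph.lifetime (fun i τ =>
    (∀ v : Fin I.n, col v ≤ K →
      τ.arr 31 v = I.graph.coloredCount I.z col (col v) (I.graph.lifetime - i + 1) v) ∧
    (∀ c ≤ K, τ.arr 33 c = σ.arr 33 c +
      I.graph.coloredCount I.z col (c + 1) (I.graph.lifetime - i + 1) I.s))
    hI.one hI.T (by decide) ⟨?_, ?_⟩ ?_).mono le_rfl ?_
  · intro v hv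
    rw [State.setVar_arr, h31]
    by_cases h0 : v = I.z
    · subst h0
      simp [hz0, TemporalGraph.coloredCount]
    · obtain ⟨c, hc⟩ := Nat.exists_eq_succ_of_ne_zero (fun h => h0 (hz v h))
      rw [hc, Nat.succ_eq_add_one, TemporalGraph.coloredCount_succ_of_lt _ _ _ _ _ _ (by omega),
        if_neg h0]
  · intro c hc
    rw [TemporalGraph.coloredCount_succ_of_lt _ _ _ _ _ _ (by omega)]
    simp
  · rintro i hi τ hF hτi ⟨h1, h2⟩
    have k16 : τ.var 16 = K + 1 := by rw [hF.var 16 rfl, h16]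
    have k32 : τ.arr 32 = σ.arr 32 := by rw [hF.arr 32 rfl]
    have e : I.graph.lifetime - (i + 1) + 1 = I.graph.lifetime - i := by omega
    refine (runs_labelProg (hI.frame hF rfl rfl) (fun v => by rw [k32, hcol]) k16 hτi rfl
      h1).mono le_rfl ?_
    rintro τ' - ⟨h3, h4⟩
    rw [e]
    refine ⟨h3, fun c hc => ?_⟩
    have := h4 c hc
    have := h2 c hc
    simp only [State.setVar_arr]
    omega
  · rintro τ - ⟨-, h⟩ c hc
    rw [h c hc]
    simp

/-! ### Sampling colourings -/

/-- The number with the `b` binary digits `ω o, …, ω (o + b - 1)`. -/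
def bitsVal (ω : ℕ → Bool) (o : ℕ) : ℕ → ℕ
  | 0 => 0
  | b + 1 => 2 * bitsVal ω o b + (ω (o + b)).toNat

theorem bitsVal_lt (ω : ℕ → Bool) (o b : ℕ) : bitsVal ω o b < 2 ^ b := by
  induction b with
  | zero => simp [bitsVal]
  | succ b ih =>
    have := Bool.toNat_le (ω (o + b))
    rw [bitsVal, pow_succ]
    omega

/-- Put `b` random bits into the variable `41`; the variable `12` holds `b`. -/
def bitsProg : Program :=
  .const 41 0 ;; forLoop 42 12 (.flip 43 ;; .add 41 41 41 ;; .add 41 41 43)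

theorem runs_bitsProg {ω : ℕ → Bool} {σ : State} {b : ℕ} (h1 : σ.var 14 = 1)
    (hb : σ.var 12 = b) :
    Runs ω bitsProg (b * 5 + 3) σ
      (fun τ => τ.var 41 = bitsVal ω σ.coins b ∧ τ.coins = σ.coins + b) := by
  refine (Runs.seq (B := 1) (B' := b * (3 + 2) + 2) (Q := fun υ => υ = σ.setVar 41 0)
    (Runs.of_result rfl le_rfl rfl) ?_).mono (by omega) fun _ _ h => h
  rintro _ - rfl
  refine Runs.forLoop b (fun j τ => τ.var 41 = bitsVal ω σ.coins j ∧ τ.coins = σ.coins + j)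
    (by simp [h1]) (by simp [hb]) (by decide) (by simp [bitsVal]) ?_
  rintro j hj τ hF hτj ⟨h2, h3⟩
  refine Runs.of_result rfl le_rfl ?_
  simp [Program.result, bitsVal, h2, h3, add_assoc, two_mul]

/-- Put `⌊R / a⌋` into the variable `44`, where `R, a, a - 1` are the variables `41, 13, 17`.
The variable `17` is there because `a ≤ R` has to be tested as `a - 1 < R`. -/
def divProg : Program := .const 44 0 ;; .whileLT 17 41 (.sub 41 41 13 ;; .add 44 44 14)

theorem runs_divProg {ω : ℕ → Bool} {σ : State} {a : ℕ} (h1 : σ.var 14 = 1)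
    (ha : 0 < a) (h13 : σ.var 13 = a) (h17 : σ.var 17 = a - 1) :
    Runs ω divProg (σ.var 41 / a * 3 + 2) σ (fun τ => τ.var 44 = σ.var 41 / a) := by
  refine (Runs.seq (B := 1) (B' := (σ.var 41 / a) * (2 + 1) + 1)
    (Q := fun υ => υ = σ.setVar 44 0)
    (Runs.of_result rfl le_rfl rfl) ?_).mono (by omega) fun _ _ h => h
  rintro _ - rfl
  refine (Runs.whileLT (B := 2) (fun τ => τ.var 44 + τ.var 41 / a = σ.var 41 / a)
    (fun τ => τ.var 41 / a) (by simp) ?_).mono (by simp) ?_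
  · intro τ hF hI hlt
    have k13 : τ.var 13 = a := by rw [hF.var 13 rfl]; simp [h13]
    have k14 : τ.var 14 = 1 := by rw [hF.var 14 rfl]; simp [h1]
    have k17 : τ.var 17 = a - 1 := by rw [hF.var 17 rfl]; simp [h17]
    have hle : a ≤ τ.var 41 := by omega
    refine Runs.of_result rfl le_rfl ?_
    have := Nat.div_eq_sub_div ha hle
    simp [Program.result, k13, k14]
    omega
  · intro τ hF ⟨hI, hlt⟩
    have k17 : τ.var 17 = a - 1 := by rw [hF.var 17 rfl]; simp [h17]
    rw [Nat.div_eq_of_lt (by omega)] at hI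
    omega

/-- Draw the colour of the vertex in variable `40`, and reset its entry in the array `31`. -/
def vertexProg : Program :=
  bitsProg ;; divProg ;; .add 44 44 14 ;; .store 32 40 44 ;; .store 31 40 15

theorem runs_vertexProg {ω : ℕ → Bool} {σ : State} {a b v : ℕ} (h1 : σ.var 14 = 1)
    (h0 : σ.var 15 = 0) (ha : 0 < a) (hb : σ.var 12 = b) (h13 : σ.var 13 = a)
    (h17 : σ.var 17 = a - 1) (hv : σ.var 40 = v) :
    Runs ω vertexProg (b * 5 + 2 ^ b / a * 3 + 8) σ (fun τ =>
      τ.arr 31 = Function.update (σ.arr 31) v 0 ∧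
      τ.arr 32 = Function.update (σ.arr 32) v (bitsVal ω σ.coins b / a + 1) ∧
      τ.coins = σ.coins + b) := by
  refine (Runs.seq (B' := 2 ^ b / a * 3 + 2 + 3) (runs_bitsProg h1 hb) ?_).mono (by omega)
    fun _ _ h => h
  rintro τ hF ⟨h41, hc⟩
  have hle : τ.var 41 / a ≤ 2 ^ b / a := Nat.div_le_div_right (by
    rw [h41]; exact (bitsVal_lt _ _ _).le)
  refine Runs.seq ((runs_divProg (a := a) (by rw [hF.var 14 rfl, h1]) ha
    (by rw [hF.var 13 rfl, h13]) (by rw [hF.var 17 rfl, h17])).mono (by omega)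
    fun _ _ h => h) ?_
  intro τ' hF' h44
  refine Runs.of_result rfl le_rfl ?_
  have k14 : τ'.var 14 = 1 := by rw [hF'.var 14 rfl, hF.var 14 rfl, h1]
  have k15 : τ'.var 15 = 0 := by rw [hF'.var 15 rfl, hF.var 15 rfl, h0]
  have k40 : τ'.var 40 = v := by rw [hF'.var 40 rfl, hF.var 40 rfl, hv]
  have k31 : τ'.arr 31 = σ.arr 31 := by rw [hF'.arr 31 rfl, hF.arr 31 rfl]
  have k32 : τ'.arr 32 = σ.arr 32 := by rw [hF'.arr 32 rfl, hF.arr 32 rfl]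
  have kc : τ'.coins = σ.coins + b := by rw [hF'.coins rfl, hc]
  simp [Program.result, k14, k15, k31, k32, k40, kc, h44, h41]

/-- The random number that determines the colour of the vertex `v` in the sample `j`. -/
def vertexBits (ω : ℕ → Bool) (n b j v : ℕ) : ℕ := bitsVal ω ((j * n + v) * b) b

/-- The random colouring in the sample `j`. -/
def randomColoring (ω : ℕ → Bool) (I : PathInstance) (K b a j : ℕ) : Fin I.n → ℕ :=
  coloring I.s I.z K a fun v => vertexBits ω I.n b j v

/-- Draw a colouring and count the coloured walks. -/
def sampleProg : Program :=
  forLoop 40 4 vertexProg ;; (.store 32 7 16 ;; .store 32 8 15 ;; .store 31 8 14) ;; walkProg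

/-- The parameters of the algorithm are in place: `K` is the largest number of inner vertices, a
colour is drawn with `b` coins, and each of the colours `1, …, K` corresponds to `a` of the `2 ^ b`
outcomes. -/
structure HasParams (K b a : ℕ) (σ : State) : Prop where
  colors : σ.var 10 = K
  bits : σ.var 12 = b
  share : σ.var 13 = a
  succ : σ.var 16 = K + 1
  pred : σ.var 17 = a - 1

theorem HasParams.frame {K b a : ℕ} {σ τ : State} {p : Program} (h : HasParams K b a σ)
    (hF : Frame p σ τ) (hv : [10, 12, 13, 16, 17].all (fun x => !p.writesVar x) = true) :
    HasParams K b a τ := by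
  simp only [List.all_cons, List.all_nil, Bool.and_true, Bool.and_eq_true,
    Bool.not_eq_true'] at hv
  obtain ⟨h10, h12, h13, h16, h17⟩ := hv
  exact ⟨by rw [hF.var _ h10, h.colors], by rw [hF.var _ h12, h.bits],
    by rw [hF.var _ h13, h.share], by rw [hF.var _ h16, h.succ], by rw [hF.var _ h17, h.pred]⟩

/-- A bound for the cost of a sample. -/
def sampleCost (I : PathInstance) (K b a : ℕ) : ℕ :=
  I.n * (b * 5 + 2 ^ b / a * 3 + 10) +
    I.graph.lifetime * ((K + 1) * (I.triples.length * 40 + 5) + 5) + 7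

theorem runs_sampleProg {ω : ℕ → Bool} {I : PathInstance} {σ : State} (hI : HasInput I σ)
    {K b a j : ℕ} (ha : 0 < a) (hP : HasParams K b a σ) (hsz : I.s ≠ I.z)
    (hc : σ.coins = j * I.n * b) :
    Runs ω sampleProg (sampleCost I K b a) σ (fun τ =>
      τ.coins = (j + 1) * I.n * b ∧ ∀ c ≤ K, τ.arr 33 c = σ.arr 33 c +
        I.graph.coloredCount I.z (randomColoring ω I K b a j) (c + 1) 1 I.s) := by
  refine (Runs.seq (B := I.n * ((b * 5 + 2 ^ b / a * 3 + 8) + 2) + 2)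
    (B' := 3 + (I.graph.lifetime * ((K + 1) * (I.triples.length * 40 + 5) + 5) + 2))
    (Q := fun τ => τ.coins = (j * I.n + I.n) * b ∧ ∀ v < I.n, τ.arr 31 v = 0 ∧
      τ.arr 32 v = vertexBits ω I.n b j v / a + 1) ?_ ?_).mono
    (le_of_eq (by unfold sampleCost; ring)) fun _ _ h => h
  · refine Runs.forLoop I.n (fun i τ => τ.coins = (j * I.n + i) * b ∧ ∀ v < i, τ.arr 31 v = 0 ∧
      τ.arr 32 v = vertexBits ω I.n b j v / a + 1) hI.one hI.n (by decide) (by simp [hc]) ?_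
    rintro i hi τ hF hτi ⟨h1, h2⟩
    have hP' := hP.frame hF rfl
    have hI' := hI.frame hF rfl rfl
    refine (runs_vertexProg hI'.one hI'.zero ha hP'.bits hP'.share hP'.pred hτi).mono le_rfl ?_
    rintro τ' - ⟨h3, h4, h5⟩
    refine ⟨by rw [State.setVar_coins, h5, h1]; ring, fun v hv => ?_⟩
    rw [State.setVar_arr, h3, h4, Function.update_apply, Function.update_apply]
    by_cases hvi : v = i
    · rw [if_pos hvi, if_pos hvi, h1, hvi, vertexBits]
      exact ⟨rfl, rfl⟩
    · rw [if_neg hvi, if_neg hvi]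
      exact h2 v (by omega)
  · rintro τ hF ⟨h1, h2⟩
    have hP' := hP.frame hF rfl
    have hI' := hI.frame hF rfl rfl
    have hk33 : τ.arr 33 = σ.arr 33 := hF.arr 33 rfl
    have hne : (I.s : ℕ) ≠ I.z := fun h => hsz (Fin.ext h)
    refine Runs.seq (Q := fun υ => υ = ((τ.setArr 32 I.s (K + 1)).setArr 32 I.z 0).setArr 31 I.z 1)
      (Runs.of_result rfl le_rfl
        (by simp [Program.result, hI'.s, hI'.z, hI'.zero, hI'.one, hP'.succ])) ?_
    rintro _ hF' rfl
    have hcol : ∀ v : Fin I.n, (((τ.setArr 32 I.s (K + 1)).setArr 32 I.z 0).setArr 31 I.z 1).arr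
        32 v = randomColoring ω I K b a j v := by
      intro v
      norm_num [randomColoring, coloring]
      simp only [Function.update_apply, Fin.val_inj, (h2 v v.2).2]
    refine (runs_walkProg (hI'.frame hF' rfl rfl) hcol (K := K) (hP'.frame hF' rfl).succ ?_ ?_
      ?_).mono le_rfl ?_
    · intro v hv
      by_contra h
      simp only [randomColoring, coloring, h, if_false] at hv
      split_ifs at hv
    · intro v
      norm_num
      simp only [Function.update_apply, Fin.val_inj, (h2 v v.2).1]
    · simp [randomColoring, coloring]
    · intro τ' hF'' h3
      refine ⟨?_, fun c hc => ?_⟩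
      · rw [hF''.coins rfl]
        simp only [State.setArr_coins, h1]
        ring
      · rw [h3 c hc]
        simp [hk33]

/-- Draw as many samples as the variable `18` says. -/
def samplesProg : Program := forLoop 45 18 sampleProg

theorem runs_samplesProg {ω : ℕ → Bool} {I : PathInstance} {σ : State} (hI : HasInput I σ)
    {K b a S : ℕ} (ha : 0 < a) (hP : HasParams K b a σ) (hsz : I.s ≠ I.z)
    (hc : σ.coins = 0) (h18 : σ.var 18 = S) (h33 : ∀ c ≤ K, σ.arr 33 c = 0) :
    Runs ω samplesProg (S * (sampleCost I K b a + 2) + 2) σ (fun τ =>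
      ∀ c ≤ K, τ.arr 33 c = ∑ j ∈ Finset.range S,
        I.graph.coloredCount I.z (randomColoring ω I K b a j) (c + 1) 1 I.s) := by
  refine (Runs.forLoop S (fun j τ => τ.coins = j * I.n * b ∧ ∀ c ≤ K, τ.arr 33 c =
    ∑ j ∈ Finset.range j,
      I.graph.coloredCount I.z (randomColoring ω I K b a j) (c + 1) 1 I.s)
    hI.one h18 (by decide) (by simpa [hc] using h33) ?_).mono le_rfl fun _ _ h => h.2
  rintro j hj τ hF hτj ⟨h1, h2⟩
  refine (runs_sampleProg (hI.frame hF rfl rfl) ha (hP.frame hF rfl) hsz h1).mono le_rfl ?_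
  rintro τ' - ⟨h3, h4⟩
  refine ⟨h3, fun c hc => ?_⟩
  rw [State.setVar_arr, h4 c hc, h2 c hc, Finset.sum_range_succ]

/-! ### The number of samples and the output -/

/-- Put the least `E` with `ε⁻¹ ≤ E` into the variable `48`. -/
def ceilProg : Program :=
  .const 47 0 ;; .const 48 0 ;; .whileLT 47 1 (.add 47 47 0 ;; .add 48 48 14)

theorem runs_ceilProg {ω : ℕ → Bool} {σ : State} {E : ℕ} (h1 : σ.var 14 = 1)
    (hlt : ∀ q < E, q * σ.var 0 < σ.var 1) (hle : σ.var 1 ≤ E * σ.var 0) :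
    Runs ω ceilProg (E * 3 + 3) σ (fun τ => τ.var 48 = E) := by
  refine (Runs.seq (B := 1) (B' := 1 + (E * (2 + 1) + 1)) (Q := fun υ => υ = σ.setVar 47 0)
    (Runs.of_result rfl le_rfl rfl) ?_).mono (by omega) fun _ _ h => h
  rintro _ - rfl
  refine Runs.seq (Q := fun υ => υ = (σ.setVar 47 0).setVar 48 0)
    (Runs.of_result rfl le_rfl rfl) ?_
  rintro _ - rfl
  refine (Runs.whileLT (B := 2) (fun τ => τ.var 48 ≤ E ∧ τ.var 47 = τ.var 48 * σ.var 0)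
    (fun τ => E - τ.var 48) (by simp) ?_).mono (by simp) ?_
  · rintro τ hF ⟨hI, hI'⟩ hlt'
    have k0 : τ.var 0 = σ.var 0 := by rw [hF.var 0 rfl]; simp
    have k1 : τ.var 1 = σ.var 1 := by rw [hF.var 1 rfl]; simp
    have k14 : τ.var 14 = 1 := by rw [hF.var 14 rfl]; simp [h1]
    have hne : τ.var 48 ≠ E := fun h => by
      rw [hI', k1, h] at hlt'
      omega
    refine Runs.of_result rfl le_rfl ?_
    simp [Program.result, k14, k0, hI', add_mul]
    omega
  · rintro τ hF ⟨⟨hI, hI'⟩, hlt'⟩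
    have k1 : τ.var 1 = σ.var 1 := by rw [hF.var 1 rfl]; simp
    by_contra hne
    have := hlt (τ.var 48) (by omega)
    omega

/-- Put the least `L` with `δ⁻¹ ≤ 2 ^ L` into the variable `49`. -/
def logProg : Program :=
  .const 49 0 ;; .add 50 2 15 ;; .whileLT 50 3 (.add 50 50 50 ;; .add 49 49 14)

theorem runs_logProg {ω : ℕ → Bool} {σ : State} {L : ℕ} (h1 : σ.var 14 = 1) (h0 : σ.var 15 = 0)
    (hlt : ∀ q < L, 2 ^ q * σ.var 2 < σ.var 3) (hle : σ.var 3 ≤ 2 ^ L * σ.var 2) :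
    Runs ω logProg (L * 3 + 3) σ (fun τ => τ.var 49 = L) := by
  refine (Runs.seq (B := 1) (B' := 1 + (L * (2 + 1) + 1)) (Q := fun υ => υ = σ.setVar 49 0)
    (Runs.of_result rfl le_rfl rfl) ?_).mono (by omega) fun _ _ h => h
  rintro _ - rfl
  refine Runs.seq (Q := fun υ => υ = (σ.setVar 49 0).setVar 50 (σ.var 2))
    (Runs.of_result rfl le_rfl (by simp [Program.result, h0])) ?_
  rintro _ - rfl
  refine (Runs.whileLT (B := 2) (fun τ => τ.var 49 ≤ L ∧ τ.var 50 = 2 ^ τ.var 49 * σ.var 2)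
    (fun τ => L - τ.var 49) (by simp) ?_).mono (by simp) ?_
  · rintro τ hF ⟨hI, hI'⟩ hlt'
    have k3 : τ.var 3 = σ.var 3 := by rw [hF.var 3 rfl]; simp
    have k14 : τ.var 14 = 1 := by rw [hF.var 14 rfl]; simp [h1]
    have hne : τ.var 49 ≠ L := fun h => by
      rw [hI', k3, h] at hlt'
      omega
    refine Runs.of_result rfl le_rfl ?_
    simp [Program.result, k14, hI', pow_succ]
    refine ⟨⟨by omega, by ring⟩, by omega⟩
  · rintro τ hF ⟨⟨hI, hI'⟩, hlt'⟩
    have k3 : τ.var 3 = σ.var 3 := by rw [hF.var 3 rfl]; simp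
    by_contra hne
    have := hlt (τ.var 49) (by omega)
    omega

/-- Replace the value `L` of the variable `49` by `8 * (L + 1)`. -/
def octupleProg : Program :=
  .add 49 49 14 ;; .add 49 49 49 ;; .add 49 49 49 ;; .add 49 49 49

/-- Put the number of samples into the variable `18`. -/
def sampleSizeProg : Program :=
  ceilProg ;; logProg ;; powProg 51 10 10 52 53 54 ;; mulProg 55 48 51 52 ;;
    mulProg 56 48 55 52 ;; octupleProg ;; mulProg 18 49 56 52

/-- The number of samples, where `ε⁻¹ ≤ E`, `δ⁻¹ ≤ 2 ^ L`, and `2 * K ^ K` is a bound for the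
inverse of the probability that a given path is coloured properly. -/
def sampleSize (K E L : ℕ) : ℕ := 8 * (L + 1) * (E * (E * K ^ K))

theorem runs_sampleSizeProg {ω : ℕ → Bool} {σ : State} {E L K : ℕ} (h1 : σ.var 14 = 1)
    (h0 : σ.var 15 = 0) (hK : σ.var 10 = K)
    (hElt : ∀ q < E, q * σ.var 0 < σ.var 1) (hEle : σ.var 1 ≤ E * σ.var 0)
    (hLlt : ∀ q < L, 2 ^ q * σ.var 2 < σ.var 3) (hLle : σ.var 3 ≤ 2 ^ L * σ.var 2) :
    Runs ω sampleSizeProg (9 * E + 27 * L + K * (3 * K + 7) + 50) σ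
      (fun τ => τ.var 18 = sampleSize K E L) := by
  refine (Runs.seq (B' := (L * 3 + 3) + ((K * (3 * K + 7) + 3) + ((3 * E + 3) + ((3 * E + 3) +
    (4 + (3 * (8 * (L + 1)) + 3)))))) (runs_ceilProg h1 hElt hEle) ?_).mono (by omega)
    fun _ _ h => h
  intro τ₁ hF₁ hE
  have a10 : τ₁.var 10 = K := by rw [hF₁.var 10 rfl, hK]
  have a14 : τ₁.var 14 = 1 := by rw [hF₁.var 14 rfl, h1]
  refine Runs.seq (runs_logProg a14 (by rw [hF₁.var 15 rfl, h0])
    (by rwa [hF₁.var 2 rfl, hF₁.var 3 rfl]) (by rwa [hF₁.var 2 rfl, hF₁.var 3 rfl])) ?_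
  intro τ₂ hF₂ hL
  have b10 : τ₂.var 10 = K := by rw [hF₂.var 10 rfl, a10]
  have b14 : τ₂.var 14 = 1 := by rw [hF₂.var 14 rfl, a14]
  have b48 : τ₂.var 48 = E := by rw [hF₂.var 48 rfl, hE]
  refine Runs.seq ((runs_powProg b14 rfl rfl rfl rfl).mono (by rw [b10]) fun _ _ h => h) ?_
  intro τ₃ hF₃ h51
  rw [b10] at h51
  have c14 : τ₃.var 14 = 1 := by rw [hF₃.var 14 rfl, b14]
  have c48 : τ₃.var 48 = E := by rw [hF₃.var 48 rfl, b48]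
  have c49 : τ₃.var 49 = L := by rw [hF₃.var 49 rfl, hL]
  refine Runs.seq ((runs_mulProg c14 rfl rfl).mono (by rw [c48]) fun _ _ h => h) ?_
  intro τ₄ hF₄ h55
  rw [c48, h51] at h55
  have d14 : τ₄.var 14 = 1 := by rw [hF₄.var 14 rfl, c14]
  have d48 : τ₄.var 48 = E := by rw [hF₄.var 48 rfl, c48]
  have d49 : τ₄.var 49 = L := by rw [hF₄.var 49 rfl, c49]
  refine Runs.seq ((runs_mulProg d14 rfl rfl).mono (by rw [d48]) fun _ _ h => h) ?_
  intro τ₅ hF₅ h56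
  rw [d48, h55] at h56
  have e14 : τ₅.var 14 = 1 := by rw [hF₅.var 14 rfl, d14]
  have e49 : τ₅.var 49 = L := by rw [hF₅.var 49 rfl, d49]
  refine Runs.seq (Q := fun τ => τ.var 49 = 8 * (L + 1)) (Runs.of_result rfl le_rfl
    (by simp [octupleProg, Program.result, e14, e49]; omega)) ?_
  intro τ₆ hF₆ h49
  have f14 : τ₆.var 14 = 1 := by rw [hF₆.var 14 rfl, e14]
  refine (runs_mulProg f14 rfl rfl).mono (by rw [h49]) fun τ _ h => ?_
  rw [h, h49, hF₆.var 56 rfl, h56, sampleSize]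

/-- In the variable `0`, replace the current value `x` by `2 ^ b * x` plus the count for the colour
`c = K - i`, where `i` is the variable `60`; counts for the colours below `lo`, the variable `11`,
are left out. -/
def hornerProg : Program :=
  .sub 61 10 60 ;; forLoop 62 12 (.add 0 0 0) ;; .ifLT 61 11 .skip (.load 63 33 61 ;; .add 0 0 63)

/-- Compute the numerator and the denominator of the output. -/
def outputProg : Program :=
  powProg 54 13 10 52 53 55 ;; mulProg 1 18 54 52 ;; .const 0 0 ;; forLoop 60 16 hornerProg

theorem runs_hornerProg {ω : ℕ → Bool} {σ : State} {K b lo i : ℕ} (h1 : σ.var 14 = 1)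
    (hK : σ.var 10 = K) (hb : σ.var 12 = b) (hlo : σ.var 11 = lo) (hi : σ.var 60 = i) :
    Runs ω hornerProg (b * 3 + 6) σ (fun τ => τ.var 0 = 2 ^ b * σ.var 0 +
      if lo ≤ K - i then σ.arr 33 (K - i) else 0) := by
  refine (Runs.seq (B := 1) (B' := (b * (1 + 2) + 2) + 3)
    (Q := fun υ => υ = σ.setVar 61 (K - i))
    (Runs.of_result rfl le_rfl (by simp [Program.result, hK, hi])) ?_).mono (by omega)
    fun _ _ h => h
  rintro _ - rfl
  refine Runs.seq (Runs.forLoop b (fun j τ => τ.var 0 = 2 ^ j * σ.var 0)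
    (by simp [h1]) (by simp [hb]) (by decide) (by simp) ?_) ?_
  · rintro j hj τ hF hτj hI
    refine Runs.of_result rfl le_rfl ?_
    simp [Program.result, hI, pow_succ]
    ring
  · intro τ hF hI
    have k11 : τ.var 11 = lo := by rw [hF.var 11 rfl]; simp [hlo]
    have k61 : τ.var 61 = K - i := by rw [hF.var 61 rfl]; simp
    have k33 : τ.arr 33 = σ.arr 33 := by rw [hF.arr 33 rfl]; simp
    refine Runs.of_result rfl le_rfl ?_
    by_cases h : K - i < lo
    · simp [Program.result, k11, k61, h, hI, Nat.not_le.2 h]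
    · simp [Program.result, k11, k61, k33, h, hI, Nat.not_lt.1 h]

theorem runs_outputProg {ω : ℕ → Bool} {σ : State} {K b a lo S : ℕ} (h1 : σ.var 14 = 1)
    (hP : HasParams K b a σ) (hlo : σ.var 11 = lo) (hS : σ.var 18 = S) :
    Runs ω outputProg (K * (3 * a + 7) + 3 * S + (K + 1) * (b * 3 + 8) + 9) σ (fun τ =>
      τ.var 1 = S * a ^ K ∧
      τ.var 0 = ∑ c ∈ Finset.range (K + 1), if lo ≤ c then 2 ^ (b * c) * σ.arr 33 c else 0) := by
  refine (Runs.seq (B' := (3 * S + 3) + (1 + ((K + 1) * (b * 3 + 6 + 2) + 2)))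
    ((runs_powProg h1 rfl rfl rfl rfl).mono (by rw [hP.share, hP.colors]) fun _ _ h => h)
    ?_).mono (le_of_eq (by ring)) fun _ _ h => h
  intro τ₁ hF₁ h54
  rw [hP.share, hP.colors] at h54
  have a14 : τ₁.var 14 = 1 := by rw [hF₁.var 14 rfl, h1]
  have a18 : τ₁.var 18 = S := by rw [hF₁.var 18 rfl, hS]
  have aP := hP.frame hF₁ rfl
  refine Runs.seq ((runs_mulProg a14 rfl rfl).mono (by rw [a18]) fun _ _ h => h) ?_
  intro τ₂ hF₂ hv1
  rw [a18, h54] at hv1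
  have b14 : τ₂.var 14 = 1 := by rw [hF₂.var 14 rfl, a14]
  have bP := aP.frame hF₂ rfl
  refine Runs.seq (Q := fun υ => υ = τ₂.setVar 0 0) (Runs.of_result rfl le_rfl rfl) ?_
  rintro _ hF₃ rfl
  have cP := bP.frame hF₃ rfl
  have c33 : (τ₂.setVar 0 0).arr 33 = σ.arr 33 := by
    rw [State.setVar_arr, hF₂.arr 33 rfl, hF₁.arr 33 rfl]
  have c11 : (τ₂.setVar 0 0).var 11 = lo := by
    rw [hF₃.var 11 rfl, hF₂.var 11 rfl, hF₁.var 11 rfl, hlo]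
  -- Horner's scheme: after `i` rounds, the `i` largest numbers of inner vertices have been included
  refine (Runs.forLoop (K + 1) (fun i τ => τ.var 0 = ∑ c ∈ Finset.range i,
      2 ^ (b * (i - 1 - c)) * if lo ≤ K - c then σ.arr 33 (K - c) else 0) (by simp [b14])
    cP.succ (by decide) (by simp) ?_).mono le_rfl ?_
  · rintro i hi τ hF hτi hI
    refine (runs_hornerProg (K := K) (b := b) (by rw [hF.var 14 rfl]; simp [b14])
      (by rw [hF.var 10 rfl, cP.colors]) (by rw [hF.var 12 rfl, cP.bits])
      (by rw [hF.var 11 rfl, c11]) hτi).mono le_rfl ?_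
    intro τ' _ h
    rw [State.setVar_var, if_neg (by norm_num), h, hI, Finset.sum_range_succ, Finset.mul_sum,
      hF.arr 33 rfl, c33]
    simp only [Nat.add_sub_cancel, Nat.sub_self, mul_zero, pow_zero, one_mul, add_left_inj]
    refine Finset.sum_congr rfl fun c hc => ?_
    have := Finset.mem_range.1 hc
    rw [← mul_assoc, ← pow_add]
    congr 2
    rw [show i - c = i - 1 - c + 1 by omega]
    ring
  · intro τ hF h
    refine ⟨by rw [hF.var 1 rfl]; simp [hv1], ?_⟩
    rw [h, ← Finset.sum_range_reflect]
    refine Finset.sum_congr rfl fun c hc => ?_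
    have := Finset.mem_range.1 hc
    rw [show K + 1 - 1 - (K + 1 - 1 - c) = c by omega, show K - (K + 1 - 1 - c) = c by omega]
    split_ifs <;> simp

/-- The approximation algorithm, for parameters in the variables `10` to `13`. -/
def coreProg : Program :=
  (.add 16 10 14 ;; .sub 17 13 14) ;; sampleSizeProg ;; samplesProg ;; outputProg

/-- A bound for the running time of the approximation algorithm. -/
def coreCost (I : PathInstance) (K b a E L : ℕ) : ℕ :=
  9 * E + 27 * L + K * (3 * K + 7) + 63 + sampleSize K E L * (sampleCost I K b a + 5) +
    K * (3 * a + 7) + (K + 1) * (b * 3 + 8)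

/-- The output of the core program. Here `K` is the number of random colours, each of which is drawn
with probability `a / 2 ^ b`, and only paths with at least `lo` inner vertices are taken into
account. -/
theorem runs_coreProg {ω : ℕ → Bool} {I : PathInstance} {σ : State} (hI : HasInput I σ)
    {K b a lo E L : ℕ} (ha : 0 < a) (hsz : I.s ≠ I.z) (hc : σ.coins = 0)
    (h10 : σ.var 10 = K) (h11 : σ.var 11 = lo) (h12 : σ.var 12 = b) (h13 : σ.var 13 = a)
    (hElt : ∀ q < E, q * σ.var 0 < σ.var 1) (hEle : σ.var 1 ≤ E * σ.var 0)
    (hLlt : ∀ q < L, 2 ^ q * σ.var 2 < σ.var 3) (hLle : σ.var 3 ≤ 2 ^ L * σ.var 2)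
    (h33 : ∀ c, σ.arr 33 c = 0) :
    Runs ω coreProg (coreCost I K b a E L) σ (fun τ =>
      τ.var 1 = sampleSize K E L * a ^ K ∧
      τ.var 0 = ∑ c ∈ Finset.range (K + 1), if lo ≤ c then 2 ^ (b * c) *
        ∑ j ∈ Finset.range (sampleSize K E L),
          I.graph.coloredCount I.z (randomColoring ω I K b a j) (c + 1) 1 I.s else 0) := by
  refine (Runs.seq (B := 2) (B' := (9 * E + 27 * L + K * (3 * K + 7) + 50) +
    ((sampleSize K E L * (sampleCost I K b a + 2) + 2) +
      (K * (3 * a + 7) + 3 * sampleSize K E L + (K + 1) * (b * 3 + 8) + 9)))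
    (Q := fun υ => υ = (σ.setVar 16 (K + 1)).setVar 17 (a - 1))
    (Runs.of_result rfl le_rfl (by simp [Program.result, h10, h13, hI.one])) ?_).mono
    (le_of_eq (by unfold coreCost; ring)) fun _ _ h => h
  rintro _ hF₁ rfl
  have aI := hI.frame hF₁ rfl rfl
  have aP : HasParams K b a ((σ.setVar 16 (K + 1)).setVar 17 (a - 1)) := by
    constructor <;> simp [h10, h12, h13]
  refine Runs.seq (runs_sampleSizeProg aI.one aI.zero aP.colors (by simpa using hElt)
    (by simpa using hEle) (by simpa using hLlt) (by simpa using hLle)) ?_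
  intro τ₂ hF₂ h18
  have bI := aI.frame hF₂ rfl rfl
  have bP := aP.frame hF₂ rfl
  refine Runs.seq (runs_samplesProg bI ha bP hsz (by rw [hF₂.coins rfl]; simp [hc]) h18
    (fun c _ => by rw [hF₂.arr 33 rfl]; simp [h33])) ?_
  intro τ₃ hF₃ h
  have cI := bI.frame hF₃ rfl rfl
  have cP := bP.frame hF₃ rfl
  refine (runs_outputProg cI.one cP (lo := lo) (S := sampleSize K E L)
    (by rw [hF₃.var 11 rfl, hF₂.var 11 rfl]; simp [h11])
    (by rw [hF₃.var 18 rfl, h18])).mono le_rfl ?_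
  rintro τ₄ - ⟨h4, h5⟩
  refine ⟨h4, h5.trans (Finset.sum_congr rfl fun c hc => ?_)⟩
  rw [h c (by have := Finset.mem_range.1 hc; omega)]

open MeasureTheory ProbabilityTheory

/-! ### Fair coins -/

instance : IsProbabilityMeasure fairCoins := by
  unfold fairCoins
  infer_instance

theorem block_injective (b : ℕ) :
    Function.Injective fun p : (_ : ℕ) × Fin b => p.1 * b + (p.2 : ℕ) := by
  rintro ⟨m, i⟩ ⟨m', i'⟩ h
  have hb : 0 < b := i.pos
  have h1 : m = m' := by
    have := congrArg (· / b) h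
    simpa [Nat.add_div_of_dvd_right, Nat.mul_div_cancel _ hb, Nat.div_eq_of_lt] using this
  subst h1
  have h2 : i = i' := Fin.ext (by simpa using h)
  rw [h2]

/-- The coin tosses in disjoint blocks of equal lengths are independent. -/
theorem iIndepFun_blocks (b : ℕ) :
    iIndepFun (fun (m : ℕ) (ω : ℕ → Bool) (i : Fin b) => ω (m * b + i)) fairCoins := by
  rw [iIndepFun_iff_map_fun_eq_infinitePi_map (by fun_prop)]
  have h1 := Measure.map_infinitePi_infinitePi_of_inj
    (P := fun _ : ℕ => (PMF.uniformOfFintype Bool).toMeasure) (block_injective b)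
  have h2 := Measure.infinitePi_map_piCurry
    (fun (_ : ℕ) (_ : Fin b) => (PMF.uniformOfFintype Bool).toMeasure)
  have h3 : ∀ m, fairCoins.map (fun ω (i : Fin b) => ω (m * b + i)) =
      Measure.infinitePi fun _ : Fin b => (PMF.uniformOfFintype Bool).toMeasure := fun m =>
    Measure.map_infinitePi_infinitePi_of_inj
      (P := fun _ : ℕ => (PMF.uniformOfFintype Bool).toMeasure)
      (f := fun i : Fin b => m * b + (i : ℕ)) (fun i j h => Fin.ext (by simpa using h))
  simp_rw [h3]
  rw [← h2, ← h1, Measure.map_map (by fun_prop) (by fun_prop)]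
  rfl

theorem bitsVal_congr {ω ω' : ℕ → Bool} {o o' b : ℕ} (h : ∀ i < b, ω (o + i) = ω' (o' + i)) :
    bitsVal ω o b = bitsVal ω' o' b := by
  induction b with
  | zero => rfl
  | succ b ih => rw [bitsVal, bitsVal, ih fun i hi => h i (by omega), h b (by omega)]

/-- Every number is the value of exactly one pattern of bits. -/
theorem exists_bitsVal_eq_iff (o b x : ℕ) (hx : x < 2 ^ b) :
    ∃ y : ℕ → Bool, ∀ ω, bitsVal ω o b = x ↔ ∀ i ∈ Finset.Ico o (o + b), ω i = y i := by
  induction b generalizing x with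
  | zero =>
    have : x = 0 := by simpa using hx
    exact ⟨fun _ => false, by simp [bitsVal, this]⟩
  | succ b ih =>
    obtain ⟨y, hy⟩ := ih (x / 2) (by rw [pow_succ] at hx; omega)
    refine ⟨Function.update y (o + b) (decide (x % 2 = 1)), fun ω => ?_⟩
    have h1 : bitsVal ω o (b + 1) = x ↔ bitsVal ω o b = x / 2 ∧
        ω (o + b) = decide (x % 2 = 1) := by
      rw [bitsVal]
      cases hω : ω (o + b)
      · simp
        omega
      · simp
        omega
    rw [h1, hy]
    constructor
    · rintro ⟨h2, h3⟩ i hi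
      by_cases hib : i = o + b
      · subst hib
        simpa using h3
      · rw [Function.update_of_ne hib]
        exact h2 i (by simp only [Finset.mem_Ico] at hi ⊢; omega)
    · intro h
      refine ⟨fun i hi => ?_, ?_⟩
      · have hi' := Finset.mem_Ico.1 hi
        have := h i (by simp only [Finset.mem_Ico]; omega)
        rwa [Function.update_of_ne (by omega)] at this
      · simpa using h (o + b) (by simp)

theorem measurable_bitsVal (o b : ℕ) : Measurable fun ω => bitsVal ω o b := by
  induction b with
  | zero => exact measurable_const
  | succ b ih =>
    have : Measurable fun ω : ℕ → Bool => (ω (o + b)).toNat :=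
      (measurable_of_countable Bool.toNat).comp (measurable_pi_apply _)
    simp only [bitsVal]
    fun_prop

theorem fairCoins_bitsVal_eq (o b x : ℕ) (hx : x < 2 ^ b) :
    fairCoins {ω | bitsVal ω o b = x} = 2⁻¹ ^ b := by
  obtain ⟨y, hy⟩ := exists_bitsVal_eq_iff o b x hx
  have : {ω | bitsVal ω o b = x} =
      Set.pi (Finset.Ico o (o + b) : Finset ℕ) fun i => {y i} := by
    ext ω
    simp [hy, Set.mem_pi]
  have h := Measure.infinitePi_pi (μ := fun _ : ℕ => (PMF.uniformOfFintype Bool).toMeasure)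
    (s := Finset.Ico o (o + b)) (t := fun i => {y i}) (fun _ _ => measurableSet_singleton _)
  rw [this, fairCoins, h]
  simp

/-- Each of the colours `1, 2, …` that correspond to `a` outcomes is drawn with probability
`a / 2 ^ b`. -/
theorem fairCoins_bitsVal_div (o b a c : ℕ) (ha : 0 < a) (hc : (c + 1) * a ≤ 2 ^ b) :
    fairCoins {ω | bitsVal ω o b / a = c} = a * 2⁻¹ ^ b := by
  have : {ω | bitsVal ω o b / a = c} =
      ⋃ x ∈ Finset.Ico (c * a) ((c + 1) * a), {ω | bitsVal ω o b = x} := by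
    ext ω
    simp only [Set.mem_ofPred_eq, Set.mem_iUnion, exists_prop, exists_eq_right', Finset.mem_Ico,
      Nat.div_eq_iff ha]
    constructor
    · rintro ⟨h1, h2⟩
      exact ⟨h1, by rw [add_mul]; omega⟩
    · rintro ⟨h1, h2⟩
      exact ⟨h1, by rw [add_mul] at h2; omega⟩
  rw [this, measure_biUnion_finset]
  · rw [Finset.sum_congr rfl fun x hx =>
      fairCoins_bitsVal_eq o b x ((Finset.mem_Ico.1 hx).2.trans_le hc)]
    simp [add_mul]
  · intro x _ y _ hxy
    exact Set.disjoint_left.2 fun ω hx hy => hxy (hx.symm.trans hy)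
  · intro x _
    exact measurable_bitsVal o b (measurableSet_singleton x)

/-- A block of coin tosses, continued arbitrarily. -/
def extendBlock {b : ℕ} (g : Fin b → Bool) (i : ℕ) : Bool :=
  if h : i < b then g ⟨i, h⟩ else false

/-- The numbers drawn for distinct vertices are independent, as they come from disjoint blocks of
coin tosses. -/
theorem fairCoins_forall_vertexBits {n : ℕ} (b a j : ℕ) (ha : 0 < a) (J : Finset (Fin n))
    (r : Fin n → ℕ) (hr : ∀ v ∈ J, (r v + 1) * a ≤ 2 ^ b) :
    fairCoins {ω | ∀ v ∈ J, vertexBits ω n b j v / a = r v} = (a * 2⁻¹ ^ b) ^ J.card := by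
  have hinj : Function.Injective fun v : Fin n => j * n + (v : ℕ) :=
    fun v w h => Fin.ext (by simpa using h)
  have hind := ((iIndepFun_blocks b).precomp hinj).comp
    (fun _ g => bitsVal (extendBlock g) 0 b / a) (fun _ => measurable_of_countable _)
  have heq : ∀ (v : Fin n) (ω : ℕ → Bool),
      bitsVal (extendBlock fun i : Fin b => ω ((j * n + v) * b + i)) 0 b =
        vertexBits ω n b j v := by
    intro v ω
    refine bitsVal_congr fun i hi => ?_
    simp [extendBlock, hi]
  have h := hind.measure_inter_preimage_eq_mul J (sets := fun v => {r v})
    (fun v _ => measurableSet_singleton _)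
  have h1 : {ω | ∀ v ∈ J, vertexBits ω n b j v / a = r v} = ⋂ v ∈ J,
      ((fun g => bitsVal (extendBlock g) 0 b / a) ∘
        fun (ω : ℕ → Bool) (i : Fin b) => ω ((j * n + v) * b + i)) ⁻¹' {r v} := by
    ext ω
    simp [heq]
  rw [h1, h, Finset.prod_congr rfl (g := fun _ => (a * 2⁻¹ ^ b : ENNReal)), Finset.prod_const]
  intro v hv
  rw [← fairCoins_bitsVal_div ((j * n + v) * b) b a (r v) ha (hr v hv)]
  congr 1
  ext ω
  simp [heq, vertexBits]

/-! ### A multiplicative Chernoff bound -/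

/-- By `exp x ≤ 1 + x + x ^ 2` for `|x| ≤ 1`. -/
theorem mgf_le_of_mem_Icc {Ω : Type*} [MeasurableSpace Ω] {P : Measure Ω}
    [IsProbabilityMeasure P] {Y : Ω → ℝ} (hm : Measurable Y) (h0 : ∀ ω, 0 ≤ Y ω)
    (h1 : ∀ ω, Y ω ≤ 1) {μ t : ℝ} (hμ : ∫ ω, Y ω ∂P = μ) (ht : |t| ≤ 1) :
    Integrable (fun ω => Real.exp (t * Y ω)) P ∧
      mgf Y P t ≤ Real.exp ((t + t ^ 2) * μ) := by
  have hint : Integrable Y P := Integrable.of_bound hm.aestronglyMeasurable 1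
    (Filter.Eventually.of_forall fun ω => by
      rw [Real.norm_eq_abs, abs_of_nonneg (h0 ω)]; exact h1 ω)
  have hpt : ∀ ω, Real.exp (t * Y ω) ≤ 1 + (t + t ^ 2) * Y ω := by
    intro ω
    have hY : |t * Y ω| ≤ 1 := by
      rw [abs_mul, abs_of_nonneg (h0 ω)]
      exact mul_le_one₀ ht (h0 ω) (h1 ω)
    have h2 := (abs_le.1 (Real.abs_exp_sub_one_sub_id_le hY)).2
    have h3 : (t * Y ω) ^ 2 ≤ t ^ 2 * Y ω := by
      rw [mul_pow]
      refine mul_le_mul_of_nonneg_left ?_ (sq_nonneg t)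
      nlinarith [h0 ω, h1 ω]
    linarith
  have hexp : Integrable (fun ω => Real.exp (t * Y ω)) P := by
    refine Integrable.of_bound (by fun_prop) (Real.exp 1)
      (Filter.Eventually.of_forall fun ω => ?_)
    rw [Real.norm_eq_abs, Real.abs_exp]
    refine Real.exp_le_exp.2 ((le_abs_self _).trans ?_)
    rw [abs_mul, abs_of_nonneg (h0 ω)]
    exact mul_le_one₀ ht (h0 ω) (h1 ω)
  refine ⟨hexp, ?_⟩
  calc mgf Y P t = ∫ ω, Real.exp (t * Y ω) ∂P := rfl
    _ ≤ ∫ ω, (1 + (t + t ^ 2) * Y ω) ∂P :=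
      integral_mono hexp ((integrable_const _).add (hint.const_mul _)) hpt
    _ = (t + t ^ 2) * μ + 1 := by
      rw [integral_add (integrable_const _) (hint.const_mul _), integral_const_mul, hμ]
      simp [add_comm]
    _ ≤ _ := Real.add_one_le_exp _

/-- The sum of `S` independent variables with values in `[0, 1]` and mean `μ` is within a factor
`1 ± ε` of its mean, except with probability `2 exp (- S μ ε² / 4)`. -/
theorem chernoff {Ω : Type*} [MeasurableSpace Ω] {P : Measure Ω} [IsProbabilityMeasure P]
    {Y : ℕ → Ω → ℝ} (hind : iIndepFun Y P) (hm : ∀ j, Measurable (Y j)) (h0 : ∀ j ω, 0 ≤ Y j ω)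
    (h1 : ∀ j ω, Y j ω ≤ 1) {μ : ℝ} (hμ : ∀ j, ∫ ω, Y j ω ∂P = μ) (S : ℕ) {ε : ℝ} (hε : 0 < ε)
    (hε1 : ε ≤ 1) :
    1 - 2 * Real.exp (-(S * μ * ε ^ 2 / 4)) ≤
      P.real {ω | (1 - ε) * (S * μ) ≤ ∑ j ∈ Finset.range S, Y j ω ∧
        ∑ j ∈ Finset.range S, Y j ω ≤ (1 + ε) * (S * μ)} := by
  set X : Ω → ℝ := ∑ j ∈ Finset.range S, Y j with hX
  have hXa : ∀ ω, X ω = ∑ j ∈ Finset.range S, Y j ω := fun ω => by simp [hX]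
  have hXm : Measurable X := by
    rw [funext hXa]
    fun_prop
  have hbound : ∀ ω, |X ω| ≤ S := by
    intro ω
    rw [hXa, abs_of_nonneg (Finset.sum_nonneg fun j _ => h0 j ω)]
    calc ∑ j ∈ Finset.range S, Y j ω ≤ ∑ j ∈ Finset.range S, (1 : ℝ) :=
          Finset.sum_le_sum fun j _ => h1 j ω
      _ = S := by simp
  have hint : ∀ t : ℝ, Integrable (fun ω => Real.exp (t * X ω)) P := by
    intro t
    refine Integrable.of_bound (by fun_prop) (Real.exp (|t| * S))
      (Filter.Eventually.of_forall fun ω => ?_)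
    rw [Real.norm_eq_abs, Real.abs_exp]
    refine Real.exp_le_exp.2 ((le_abs_self _).trans ?_)
    rw [abs_mul]
    exact mul_le_mul_of_nonneg_left (hbound ω) (abs_nonneg t)
  have hmgf : ∀ t : ℝ, |t| ≤ 1 → mgf X P t ≤ Real.exp (S * ((t + t ^ 2) * μ)) := by
    intro t ht
    rw [hX, hind.mgf_sum hm]
    calc ∏ j ∈ Finset.range S, mgf (Y j) P t
        ≤ ∏ j ∈ Finset.range S, Real.exp ((t + t ^ 2) * μ) :=
          Finset.prod_le_prod (fun j _ => mgf_nonneg)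
            fun j _ => (mgf_le_of_mem_Icc (hm j) (h0 j) (h1 j) (hμ j) ht).2
      _ = _ := by rw [Finset.prod_const, Finset.card_range, ← Real.exp_nat_mul]
  -- the parameters `t = ± ε / 2` of the moment generating function minimise the exponents
  -- `∓ ε * t + t ^ 2`, which become `- ε ^ 2 / 4`
  have habs : |ε / 2| ≤ 1 := by
    rw [abs_of_pos (by positivity)]
    linarith
  have hup : P.real {ω | (1 + ε) * (S * μ) ≤ X ω} ≤ Real.exp (-(S * μ * ε ^ 2 / 4)) := by
    refine (measure_ge_le_exp_mul_mgf _ (by positivity : (0 : ℝ) ≤ ε / 2) (hint _)).trans ?_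
    refine (mul_le_mul_of_nonneg_left (hmgf _ habs) (Real.exp_pos _).le).trans ?_
    rw [← Real.exp_add]
    refine Real.exp_le_exp.2 (le_of_eq ?_)
    ring
  have hlo : P.real {ω | X ω ≤ (1 - ε) * (S * μ)} ≤ Real.exp (-(S * μ * ε ^ 2 / 4)) := by
    refine (measure_le_le_exp_mul_mgf _ (by linarith : -(ε / 2) ≤ (0 : ℝ)) (hint _)).trans ?_
    refine (mul_le_mul_of_nonneg_left (hmgf _ (by rwa [abs_neg])) (Real.exp_pos _).le).trans ?_
    rw [← Real.exp_add]
    refine Real.exp_le_exp.2 (le_of_eq ?_)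
    ring
  set A := {ω | (1 - ε) * (S * μ) ≤ ∑ j ∈ Finset.range S, Y j ω ∧
        ∑ j ∈ Finset.range S, Y j ω ≤ (1 + ε) * (S * μ)} with hA
  have hcover : (Set.univ : Set Ω) ⊆
      A ∪ ({ω | (1 + ε) * (S * μ) ≤ X ω} ∪ {ω | X ω ≤ (1 - ε) * (S * μ)}) := by
    intro ω _
    simp only [hA, Set.mem_union, Set.mem_ofPred_eq, ← hXa]
    rcases le_total ((1 + ε) * (S * μ)) (X ω) with h | h
    · exact Or.inr (Or.inl h)
    · rcases le_total (X ω) ((1 - ε) * (S * μ)) with h' | h'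
      · exact Or.inr (Or.inr h')
      · exact Or.inl ⟨h', h⟩
  have h2 := measureReal_mono (μ := P) hcover
  rw [probReal_univ] at h2
  have h3 := measureReal_union_le (μ := P) A
    ({ω | (1 + ε) * (S * μ) ≤ X ω} ∪ {ω | X ω ≤ (1 - ε) * (S * μ)})
  have h4 := measureReal_union_le (μ := P) {ω | (1 + ε) * (S * μ) ≤ X ω}
    {ω | X ω ≤ (1 - ε) * (S * μ)}
  linarith

/-! ### The estimator -/

theorem vertexBits_eq_block (ω : ℕ → Bool) {n b j v : ℕ} (hv : v < n) :
    vertexBits ω n b j v =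
      bitsVal (extendBlock fun i : Fin (n * b) => ω (j * (n * b) + i)) (v * b) b := by
  refine bitsVal_congr fun i hi => ?_
  have : v * b + i < n * b := by
    calc v * b + i < (v + 1) * b := by rw [add_mul]; omega
      _ ≤ n * b := Nat.mul_le_mul_right b hv
  rw [extendBlock, dif_pos this]
  congr 1
  ring

/-- What a sample contributes to the numerator of the output: the sum of the numbers of coloured
paths with `c` inner vertices, `lo ≤ c ≤ K`, with weights `2 ^ (b * c)`. -/
noncomputable def sampleValue (ω : ℕ → Bool) (I : PathInstance) (K b a lo j : ℕ) : ℝ :=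
  ∑ c ∈ Finset.range (K + 1), if lo ≤ c then
    2 ^ (b * c) * (I.graph.coloredCount I.z (randomColoring ω I K b a j) (c + 1) 1 I.s : ℝ) else 0

/-- The sample `j` depends only on the `j`-th block of `n * b` coin tosses, in the same way for all
`j`. -/
theorem exists_sampleValue_eq_block (I : PathInstance) (K b a lo : ℕ) :
    ∃ Φ : (Fin (I.n * b) → Bool) → ℝ, ∀ ω j,
      sampleValue ω I K b a lo j = Φ fun i => ω (j * (I.n * b) + i) := by
  refine ⟨fun g => ∑ c ∈ Finset.range (K + 1), if lo ≤ c then 2 ^ (b * c) *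
    (I.graph.coloredCount I.z
      (coloring I.s I.z K a fun v => bitsVal (extendBlock g) (v * b) b) (c + 1) 1 I.s : ℝ)
      else 0, fun ω j => ?_⟩
  have : randomColoring ω I K b a j = coloring I.s I.z K a fun v =>
      bitsVal (extendBlock fun i : Fin (I.n * b) => ω (j * (I.n * b) + i)) (v * b) b := by
    unfold randomColoring
    congr 1
    funext v
    exact vertexBits_eq_block ω v.2
  rw [sampleValue, this]

theorem iIndepFun_sampleValue (I : PathInstance) (K b a lo : ℕ) :
    iIndepFun (fun j ω => sampleValue ω I K b a lo j) fairCoins := by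
  obtain ⟨Φ, hΦ⟩ := exists_sampleValue_eq_block I K b a lo
  have := (iIndepFun_blocks (I.n * b)).comp (fun _ => Φ) fun _ => measurable_of_countable _
  convert this using 2
  funext ω
  exact hΦ ω _

theorem measurable_sampleValue (I : PathInstance) (K b a lo j : ℕ) :
    Measurable fun ω => sampleValue ω I K b a lo j := by
  obtain ⟨Φ, hΦ⟩ := exists_sampleValue_eq_block I K b a lo
  simp_rw [hΦ]
  exact (measurable_of_countable Φ).comp (by fun_prop)

theorem coloring_source {I : PathInstance} (hsz : I.s ≠ I.z) (ω : ℕ → Bool) (K b a j : ℕ) :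
    randomColoring ω I K b a j I.s = K + 1 := by
  simp [randomColoring, coloring, hsz]

theorem coloredCount_le_pathSet {I : PathInstance} (hsz : I.s ≠ I.z) (ω : ℕ → Bool)
    {K b a j c : ℕ} (hc : c ≤ K) :
    I.graph.coloredCount I.z (randomColoring ω I K b a j) (c + 1) 1 I.s ≤
      (I.graph.pathSet I.s I.z (c + 1)).card := by
  rw [I.graph.coloredCount_eq_pathSet I.s I.z _ _ (by rw [coloring_source hsz]; omega)]
  exact Finset.card_filter_le _ _

/-- The event that a given path with `c` inner vertices is coloured properly. -/
theorem fairCoins_colored {I : PathInstance} {K b a j c : ℕ}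
    (ha : 0 < a) (hKa : K * a ≤ 2 ^ b) (hc : c ≤ K) {Q : List (Fin I.n × ℕ)}
    (hQ : Q ∈ I.graph.pathSet I.s I.z (c + 1)) :
    MeasurableSet {ω | Colored (randomColoring ω I K b a j) Q} ∧
      fairCoins {ω | Colored (randomColoring ω I K b a j) Q} = (a * 2⁻¹ ^ b) ^ c := by
  obtain ⟨h1, h2, h3⟩ := (I.graph.mem_pathSet _ _ _ _).1 hQ
  obtain ⟨h4, h5⟩ := List.nodup_cons.1 h3
  obtain ⟨J, r, k1, k2, k3, k4⟩ := exists_colored_iff (K := K) (a := a) h2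
    (by rintro rfl; simp at h1) h5 h4
  have hset : {ω | Colored (randomColoring ω I K b a j) Q} =
      {ω | ∀ v ∈ J, vertexBits ω I.n b j v / a = r v} := by
    ext ω
    exact k4 _
  rw [hset]
  constructor
  · have : {ω | ∀ v ∈ J, vertexBits ω I.n b j v / a = r v} =
        ⋂ v ∈ J, {ω | vertexBits ω I.n b j v / a = r v} := by
      ext ω
      simp
    rw [this]
    refine Finset.measurableSet_biInter _ fun v _ => ?_
    exact ((measurable_of_countable (· / a)).comp (measurable_bitsVal _ b))
      (measurableSet_singleton (r v))
  · rw [fairCoins_forall_vertexBits b a j ha J r fun v hv => ?_, show J.card = c by omega]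
    have := k3 v hv
    exact (Nat.mul_le_mul_right a (by omega)).trans hKa

theorem integral_coloredCount {I : PathInstance} (hsz : I.s ≠ I.z) {K b a j c : ℕ}
    (ha : 0 < a) (hKa : K * a ≤ 2 ^ b) (hc : c ≤ K) :
    Integrable (fun ω =>
      (I.graph.coloredCount I.z (randomColoring ω I K b a j) (c + 1) 1 I.s : ℝ)) fairCoins ∧
    ∫ ω, (I.graph.coloredCount I.z (randomColoring ω I K b a j) (c + 1) 1 I.s : ℝ) ∂fairCoins =
      (I.graph.pathSet I.s I.z (c + 1)).card * (a * 2⁻¹ ^ b) ^ c := by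
  have h1 : (fun ω =>
      (I.graph.coloredCount I.z (randomColoring ω I K b a j) (c + 1) 1 I.s : ℝ)) =
      fun ω => ∑ Q ∈ I.graph.pathSet I.s I.z (c + 1),
        Set.indicator {ω | Colored (randomColoring ω I K b a j) Q} (fun _ => (1 : ℝ)) ω := by
    funext ω
    rw [I.graph.coloredCount_eq_pathSet I.s I.z _ _ (by rw [coloring_source hsz]; omega),
      Finset.card_filter]
    push_cast
    refine Finset.sum_congr rfl fun Q _ => ?_
    simp [Set.indicator_apply]
  have h2 : ∀ Q ∈ I.graph.pathSet I.s I.z (c + 1), Integrable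
      (Set.indicator {ω | Colored (randomColoring ω I K b a j) Q} (fun _ => (1 : ℝ)))
        fairCoins := fun Q hQ =>
    (integrable_const _).indicator (fairCoins_colored ha hKa hc hQ).1
  rw [h1]
  refine ⟨integrable_finsetSum _ h2, ?_⟩
  rw [integral_finsetSum _ h2, Finset.sum_congr rfl (g := fun _ => ((a : ℝ) * 2⁻¹ ^ b) ^ c),
    Finset.sum_const, nsmul_eq_mul]
  intro Q hQ
  obtain ⟨h3, h4⟩ := fairCoins_colored (j := j) ha hKa hc hQ
  rw [integral_indicator_const _ h3, smul_eq_mul, mul_one, Measure.real, h4]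
  simp

/-- The number of paths with at least `lo` and at most `K` inner vertices. -/
def targetCount (I : PathInstance) (K lo : ℕ) : ℕ :=
  ∑ c ∈ Finset.range (K + 1), if lo ≤ c then (I.graph.pathSet I.s I.z (c + 1)).card else 0

theorem sampleValue_nonneg (ω : ℕ → Bool) (I : PathInstance) (K b a lo j : ℕ) :
    0 ≤ sampleValue ω I K b a lo j :=
  Finset.sum_nonneg fun c _ => by split_ifs <;> positivity

theorem sampleValue_le {I : PathInstance} (hsz : I.s ≠ I.z) (ω : ℕ → Bool) (K b a lo j : ℕ) :
    sampleValue ω I K b a lo j ≤ 2 ^ (b * K) * targetCount I K lo := by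
  rw [sampleValue, targetCount, Nat.cast_sum, Finset.mul_sum]
  refine Finset.sum_le_sum fun c hc => ?_
  have hcK : c ≤ K := by have := Finset.mem_range.1 hc; omega
  split_ifs
  · refine mul_le_mul (pow_le_pow_right₀ one_le_two (Nat.mul_le_mul_left b hcK))
      (Nat.cast_le.2 (coloredCount_le_pathSet hsz ω hcK)) (Nat.cast_nonneg _) (by positivity)
  · simp

/-- The weights `2 ^ (b * c)` lead to the factor `a ^ c`. It does not depend on `c` in either of the
two cases that are used: a single number `c = K` of inner vertices, or `a = 1`. -/
theorem integral_sampleValue {I : PathInstance} (hsz : I.s ≠ I.z) {K b a lo : ℕ} (j : ℕ)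
    (ha : 0 < a) (hKa : K * a ≤ 2 ^ b) (hlo : lo = K ∨ a = 1) :
    ∫ ω, sampleValue ω I K b a lo j ∂fairCoins = a ^ K * targetCount I K lo := by
  unfold sampleValue
  rw [integral_finsetSum]
  · rw [targetCount, Nat.cast_sum, Finset.mul_sum]
    refine Finset.sum_congr rfl fun c hc => ?_
    have hcK : c ≤ K := by have := Finset.mem_range.1 hc; omega
    split_ifs with h
    · have hac : (a : ℝ) ^ c = a ^ K := by
        rcases hlo with h' | h'
        · rw [show c = K by omega]
        · simp [h']
      rw [integral_const_mul, (integral_coloredCount hsz ha hKa hcK).2, mul_pow, hac, pow_mul,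
        inv_pow, inv_pow]
      have : ((2 : ℝ) ^ b) ^ c ≠ 0 := by positivity
      field_simp
    · simp
  · intro c hc
    have hcK : c ≤ K := by have := Finset.mem_range.1 hc; omega
    split_ifs
    · exact (integral_coloredCount hsz ha hKa hcK).1.const_mul _
    · exact integrable_const _

/-- With the chosen number of samples, the output is an `ε`-approximation with probability at least
`1 - δ`. -/
theorem le_fairCoins_approx {I : PathInstance} (hsz : I.s ≠ I.z) {K b a lo E L : ℕ}
    (ha : 0 < a) (hKa : K * a ≤ 2 ^ b) (hlo : lo = K ∨ a = 1)
    (hp : 2 ^ (b * K) ≤ 2 * (K ^ K * a ^ K)) {ε δ : ℝ} (hE0 : 0 < E)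
    (hE : 1 ≤ E * ε) (hL : 1 ≤ 2 ^ L * δ) :
    1 - δ ≤ fairCoins.real {ω |
      (1 - ε) * targetCount I K lo ≤
        (∑ j ∈ Finset.range (sampleSize K E L), sampleValue ω I K b a lo j) /
          (sampleSize K E L * a ^ K) ∧
      (∑ j ∈ Finset.range (sampleSize K E L), sampleValue ω I K b a lo j) /
          (sampleSize K E L * a ^ K) ≤ (1 + ε) * targetCount I K lo} := by
  set S := sampleSize K E L with hS
  have hδ : 0 < δ := by
    by_contra h
    have : (2 : ℝ) ^ L * δ ≤ 0 := mul_nonpos_of_nonneg_of_nonpos (by positivity) (not_lt.1 h)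
    linarith
  have hKK : 0 < K ^ K := by
    rcases Nat.eq_zero_or_pos K with rfl | h
    · simp
    · positivity
  have hSpos : 0 < S := by
    rw [hS, sampleSize]
    positivity
  have haR : (0 : ℝ) < a := Nat.cast_pos.2 ha
  have hSR : (0 : ℝ) < S := Nat.cast_pos.2 hSpos
  have hER : (0 : ℝ) < E := Nat.cast_pos.2 hE0
  rcases Nat.eq_zero_or_pos (targetCount I K lo) with hN | hN
  · -- without paths to be counted, all samples are `0`
    have h0 : ∀ ω j, sampleValue ω I K b a lo j = 0 := fun ω j =>
      le_antisymm (by simpa [hN] using sampleValue_le hsz ω K b a lo j)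
        (sampleValue_nonneg _ _ _ _ _ _ _)
    simp [hN, h0, hδ.le]
  · have hNR : (0 : ℝ) < targetCount I K lo := Nat.cast_pos.2 hN
    set N : ℝ := ((targetCount I K lo : ℕ) : ℝ) with hNdef
    set D : ℝ := 2 ^ (b * K) * N with hD
    have hDpos : 0 < D := by positivity
    set μ : ℝ := a ^ K * N / D with hμ
    have hind : iIndepFun (fun j ω => sampleValue ω I K b a lo j / D) fairCoins :=
      (iIndepFun_sampleValue I K b a lo).comp (fun _ x => x / D) fun _ => by fun_prop
    -- `chernoff` needs an error of at most `1`, hence `1 / E ≤ ε` instead of `ε`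
    have hc := chernoff (ε := 1 / E) hind
      (fun j => (measurable_sampleValue I K b a lo j).div_const D)
      (fun j ω => div_nonneg (sampleValue_nonneg _ _ _ _ _ _ _) hDpos.le)
      (fun j ω => (div_le_one hDpos).2 (sampleValue_le hsz ω K b a lo j))
      (μ := μ) (fun j => by
        rw [integral_div, integral_sampleValue hsz j ha hKa hlo]) S (by positivity)
      (by rw [div_le_one hER]; exact_mod_cast hE0)
    have hexp : 2 * Real.exp (-(S * μ * (1 / E) ^ 2 / 4)) ≤ δ := by
      have h1 : (L + 1 : ℝ) ≤ S * μ * (1 / E) ^ 2 / 4 := by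
        have hμ' : μ = a ^ K / 2 ^ (b * K) := by
          rw [hμ, hD]
          field_simp
        -- the inverse of the mean is at most `2 * K ^ K`, a factor of the number of samples
        have h2 : (1 : ℝ) ≤ 2 * (K ^ K * μ) := by
          rw [hμ', ← mul_div_assoc, ← mul_div_assoc, le_div_iff₀ (by positivity), one_mul]
          exact_mod_cast hp
        have h3 : S * μ * (1 / E) ^ 2 / 4 = (L + 1) * (2 * (K ^ K * μ)) := by
          rw [hS, sampleSize]
          push_cast
          field_simp
          ring
        rw [h3]
        exact le_mul_of_one_le_right (by positivity) h2
      have h4 : Real.exp (-(S * μ * (1 / E) ^ 2 / 4)) ≤ (1 / 2) ^ (L + 1) := by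
        calc Real.exp (-(S * μ * (1 / E) ^ 2 / 4)) ≤ Real.exp (((L + 1 : ℕ) : ℝ) * (-1)) := by
              refine Real.exp_le_exp.2 ?_
              push_cast
              linarith
          _ = Real.exp (-1) ^ (L + 1) := Real.exp_nat_mul _ _
          _ ≤ (1 / 2) ^ (L + 1) := by
              refine pow_le_pow_left₀ (Real.exp_pos _).le ?_ _
              rw [Real.exp_neg, one_div]
              exact inv_anti₀ two_pos (by have := Real.add_one_le_exp 1; linarith)
      have h5 : 2 * (1 / 2 : ℝ) ^ (L + 1) ≤ δ := by
        rw [pow_succ, one_div, inv_pow]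
        have : (0 : ℝ) < 2 ^ L := by positivity
        have h6 : ((2 : ℝ) ^ L)⁻¹ ≤ δ := by
          rw [inv_eq_one_div, div_le_iff₀ this]
          linarith
        linarith
      linarith
    refine le_trans (by linarith) (hc.trans (measureReal_mono fun ω => ?_))
    rintro ⟨h1, h2⟩
    have hε : 1 / (E : ℝ) ≤ ε := by rw [div_le_iff₀ hER]; linarith
    have hden : (0 : ℝ) < S * a ^ K := by positivity
    rw [← Finset.sum_div, hμ, ← mul_div_assoc, ← mul_div_assoc, div_le_div_iff_of_pos_right hDpos]
      at h1 h2
    constructor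
    · rw [le_div_iff₀ hden]
      refine le_trans ?_ h1
      have : (1 - ε) * (S * (a ^ K * N)) ≤ (1 - 1 / E) * (S * (a ^ K * N)) :=
        mul_le_mul_of_nonneg_right (by linarith) (by positivity)
      linarith
    · rw [div_le_iff₀ hden]
      refine h2.trans ?_
      have : (1 + 1 / E) * (S * (a ^ K * N)) ≤ (1 + ε) * (S * (a ^ K * N)) :=
        mul_le_mul_of_nonneg_right (by linarith) (by positivity)
      linarith

/-! ### Lengths of paths in graphs of bounded vertex cover number or treedepth -/

/-- The vertices of a path form a chain, so one of them is an ancestor of all others. -/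
theorem exists_least_of_isChain {V : Type*} [PartialOrder V] {H : SimpleGraph V}
    (hc : ∀ v : V, IsChain (· ≤ ·) (Set.Iic v)) (ha : ∀ u v : V, H.Adj u v → u ≤ v ∨ v ≤ u)
    {l : List V} (hl : l ≠ []) (hch : l.IsChain H.Adj) : ∃ m ∈ l, ∀ x ∈ l, m ≤ x := by
  induction l with
  | nil => exact absurd rfl hl
  | cons a l ih =>
    cases l with
    | nil => exact ⟨a, by simp, by simp⟩
    | cons b l =>
      obtain ⟨m, hm, hmin⟩ := ih (by simp) hch.tail
      have hmb : m ≤ b := hmin b (by simp)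
      have hab : m ≤ a ∨ a ≤ m := by
        rcases ha a b (List.isChain_cons_cons.1 hch).1 with h | h
        · exact (hc b).total hmb h
        · exact Or.inl (hmb.trans h)
      rcases hab with h | h
      · refine ⟨m, List.mem_cons_of_mem _ hm, fun x hx => ?_⟩
        rcases List.mem_cons.1 hx with rfl | hx
        · exact h
        · exact hmin x hx
      · refine ⟨a, by simp, fun x hx => ?_⟩
        rcases List.mem_cons.1 hx with rfl | hx
        · exact le_rfl
        · exact h.trans (hmin x hx)

/-- A path in a graph of treedepth at most `d` has fewer than `2 ^ d` vertices: its topmost vertex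
splits it into two paths in graphs of smaller treedepth. -/
theorem HasTreedepthAtMost.length_lt {V : Type*} {H : SimpleGraph V} {d : ℕ}
    (h : HasTreedepthAtMost H d) {l : List V} (hch : l.IsChain H.Adj) (hnd : l.Nodup) :
    l.length + 1 ≤ 2 ^ d := by
  obtain ⟨_, hc, ha, hd⟩ := h
  have hfin : ∀ v : V, (Set.Iic v).Finite := fun v =>
    Set.finite_of_encard_le_coe (hd v)
  have hle : ∀ v : V, (Set.Iic v).ncard ≤ d := fun v => by
    have := hd v
    rw [← (hfin v).cast_ncard_eq] at this
    exact_mod_cast this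
  have hlt : ∀ u v : V, u < v → (Set.Iic u).ncard < (Set.Iic v).ncard := fun u v huv =>
    Set.ncard_lt_ncard (Set.Iic_ssubset_Iic.2 huv) (hfin v)
  -- paths in the part of the forest below depth `d - j`
  have key : ∀ (j : ℕ) (l : List V), l.IsChain H.Adj → l.Nodup →
      (∀ x ∈ l, d < (Set.Iic x).ncard + j) → l.length + 1 ≤ 2 ^ j := by
    intro j
    induction j with
    | zero =>
      intro l _ _ hl
      cases l with
      | nil => simp
      | cons x l =>
        have := hl x (by simp)
        have := hle x
        omega
    | succ j ih =>
      intro l hch hnd hl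
      by_cases hl0 : l = []
      · subst hl0
        simpa using Nat.one_le_two_pow
      obtain ⟨m, hm, hmin⟩ := exists_least_of_isChain hc ha hl0 hch
      obtain ⟨l₁, l₂, rfl⟩ := List.append_of_mem hm
      obtain ⟨c1, c2, -⟩ := List.isChain_append.1 hch
      rw [List.nodup_append] at hnd
      obtain ⟨n1, n2, n3⟩ := hnd
      obtain ⟨n4, n5⟩ := List.nodup_cons.1 n2
      have hm' := hl m (by simp)
      have h1 := ih l₁ c1 n1 fun x hx => by
        have := hlt m x (lt_of_le_of_ne (hmin x (by simp [hx])) fun h =>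
          n3 x hx m (by simp) h.symm)
        omega
      have h2 := ih l₂ c2.tail n5 fun x hx => by
        have := hlt m x (lt_of_le_of_ne (hmin x (by simp [hx])) fun h => n4 (h ▸ hx))
        omega
      rw [List.length_append, List.length_cons, pow_succ]
      omega
  refine key d l hch hnd fun x _ => ?_
  have : 0 < (Set.Iic x).ncard := (Set.ncard_pos (hfin x)).2 ⟨x, le_rfl⟩
  omega

theorem hasTreedepthAtMost_treedepth {V : Type*} [Finite V] (H : SimpleGraph V) :
    HasTreedepthAtMost H (treedepth H) := by
  refine Nat.sInf_mem (s := {d | HasTreedepthAtMost H d}) ⟨Nat.card V, ?_⟩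
  obtain ⟨e⟩ := Finite.exists_equiv_fin V |>.choose_spec
  let o : LinearOrder V := LinearOrder.lift' e e.injective
  refine ⟨o.toPartialOrder, fun v x _ y _ _ => le_total x y, fun u v _ => le_total u v,
    fun v => ?_⟩
  rw [← Set.ncard_univ, (Set.finite_univ).cast_ncard_eq]
  exact Set.encard_le_encard (Set.subset_univ _)

theorem length_lt_two_pow_treedepth {V : Type*} [Finite V] {H : SimpleGraph V} {l : List V}
    (hch : l.IsChain H.Adj) (hnd : l.Nodup) : l.length + 1 ≤ 2 ^ treedepth H :=
  (hasTreedepthAtMost_treedepth H).length_lt hch hnd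

open Classical in
theorem length_le_two_mul_countP {V : Type*} {H : SimpleGraph V} {C : Set V}
    (hC : H.IsVertexCover C) : ∀ l : List V, l.IsChain H.Adj →
      l.length ≤ 2 * l.countP (fun v => decide (v ∈ C)) + 1
  | [], _ => by simp
  | [x], _ => by simp
  | x :: y :: l, h => by
    have h1 := length_le_two_mul_countP hC l h.tail.tail
    have h2 : x ∈ C ∨ y ∈ C := hC (List.isChain_cons_cons.1 h).1
    simp only [List.length_cons, List.countP_cons, decide_eq_true_eq]
    rcases h2 with h2 | h2 <;> simp only [h2, if_true] <;> omega

/-- Every second vertex of a path belongs to a given vertex cover. -/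
theorem length_le_vertexCoverNumber {V : Type*} [Finite V] {H : SimpleGraph V} {l : List V}
    (hch : l.IsChain H.Adj) (hnd : l.Nodup) : l.length ≤ 2 * vertexCoverNumber H + 1 := by
  classical
  obtain ⟨C, hC, hcov⟩ := H.vertexCoverNum_exists
  have h1 := length_le_two_mul_countP hcov l hch
  have h2 : l.countP (fun v => decide (v ∈ C)) ≤ vertexCoverNumber H := by
    rw [vertexCoverNumber, ← hC, ← Set.ncard_def, List.countP_eq_length_filter,
      ← List.toFinset_card_of_nodup (hnd.filter _), ← Set.ncard_coe_finset]
    refine Set.ncard_le_ncard (fun v hv => ?_) (Set.toFinite C)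
    simpa using (List.mem_filter.1 (List.mem_toFinset.1 hv)).2
  omega

theorem exists_path_bound_vertexCoverNumber : ∃ g : ℕ → ℕ, Computable g ∧
    ∀ (V : Type) [Finite V] (H : SimpleGraph V) (u v : V) (q : H.Walk u v), q.IsPath →
      q.length ≤ g (vertexCoverNumber H) := by
  refine ⟨fun n => 2 * n, (Primrec.nat_mul.comp (Primrec.const 2) Primrec.id).to_comp, ?_⟩
  intro V _ H u v q hq
  have := length_le_vertexCoverNumber q.isChain_adj_support hq.support_nodup
  rw [q.length_support] at this
  beta_reduce
  omega

theorem primrec_two_pow : Primrec fun n : ℕ => 2 ^ n := by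
  have : Primrec fun n : ℕ => Nat.rec (motive := fun _ => ℕ) 1 (fun _ y => y + y) n :=
    Primrec.nat_rec₁ 1 (Primrec.nat_add.comp Primrec.snd Primrec.snd).to₂
  refine this.of_eq fun n => ?_
  induction n with
  | zero => rfl
  | succ n ih => rw [pow_succ, ← ih]; simp only; omega

theorem exists_path_bound_treedepth : ∃ g : ℕ → ℕ, Computable g ∧
    ∀ (V : Type) [Finite V] (H : SimpleGraph V) (u v : V) (q : H.Walk u v), q.IsPath →
      q.length ≤ g (treedepth H) := by
  refine ⟨fun n => 2 ^ n, primrec_two_pow.to_comp, ?_⟩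
  intro V _ H u v q hq
  have := length_lt_two_pow_treedepth q.isChain_adj_support hq.support_nodup
  rw [q.length_support] at this
  beta_reduce
  omega

/-! ### From the core program to approximation schemes -/

/-- The number `E = ⌈1 / ε⌉` together with the integer form of its definition that the machine
tests. -/
theorem exists_ceil_inv {ε : ℚ} (hε : 0 < ε) : ∃ E : ℕ, 0 < E ∧
    (∀ q < E, q * ε.num.toNat < ε.den) ∧ ε.den ≤ E * ε.num.toNat ∧ 1 ≤ (E : ℝ) * ε ∧
    (E : ℝ) ≤ 1 / ε + 1 := by
  have hεR : (0 : ℝ) < ε := by exact_mod_cast hε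
  have hnum : ((ε.num.toNat : ℕ) : ℝ) = ε * ε.den := by
    have h1 : ((ε.num.toNat : ℕ) : ℤ) = ε.num := Int.toNat_of_nonneg (Rat.num_nonneg.2 hε.le)
    have h2 : (ε.num : ℚ) = ε * ε.den := (Rat.mul_den_eq_num ε).symm
    calc ((ε.num.toNat : ℕ) : ℝ) = ((ε.num : ℤ) : ℝ) := by exact_mod_cast congrArg Int.cast h1
      _ = ε * ε.den := by exact_mod_cast h2
  have hden : (0 : ℝ) < ε.den := by exact_mod_cast ε.den_pos
  refine ⟨⌈1 / (ε : ℝ)⌉₊, Nat.ceil_pos.2 (by positivity), fun q hq => ?_, ?_, ?_,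
    (Nat.ceil_lt_add_one (by positivity)).le⟩
  · have := Nat.lt_ceil.1 hq
    rw [lt_div_iff₀ hεR] at this
    have h : (q : ℝ) * ε.num.toNat < ε.den := by
      rw [hnum, ← mul_assoc]
      nlinarith
    exact_mod_cast h
  · have := Nat.le_ceil (1 / (ε : ℝ))
    rw [div_le_iff₀ hεR] at this
    have h : (ε.den : ℝ) ≤ ⌈1 / (ε : ℝ)⌉₊ * ε.num.toNat := by
      rw [hnum, ← mul_assoc]
      nlinarith
    exact_mod_cast h
  · have := Nat.le_ceil (1 / (ε : ℝ))
    rwa [div_le_iff₀ hεR] at this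

/-- The number `L = ⌈log₂ (1 / δ)⌉` together with the integer form of its definition that the
machine tests. -/
theorem exists_log_inv {δ : ℚ} (hδ : 0 < δ) (hδ1 : δ < 1) : ∃ L : ℕ,
    (∀ q < L, 2 ^ q * δ.num.toNat < δ.den) ∧ δ.den ≤ 2 ^ L * δ.num.toNat ∧
    1 ≤ (2 : ℝ) ^ L * δ ∧ (L : ℝ) ≤ 2 * Real.log (1 / δ) + 1 := by
  have hδR : (0 : ℝ) < δ := by exact_mod_cast hδ
  have hδ1R : (δ : ℝ) < 1 := by exact_mod_cast hδ1
  have hnum : ((δ.num.toNat : ℕ) : ℝ) = δ * δ.den := by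
    have h1 : ((δ.num.toNat : ℕ) : ℤ) = δ.num := Int.toNat_of_nonneg (Rat.num_nonneg.2 hδ.le)
    have h2 : (δ.num : ℚ) = δ * δ.den := (Rat.mul_den_eq_num δ).symm
    calc ((δ.num.toNat : ℕ) : ℝ) = ((δ.num : ℤ) : ℝ) := by exact_mod_cast congrArg Int.cast h1
      _ = δ * δ.den := by exact_mod_cast h2
  have hden : (0 : ℝ) < δ.den := by exact_mod_cast δ.den_pos
  have hinv : (1 : ℝ) ≤ 1 / δ := by rw [le_div_iff₀ hδR]; linarith
  have hlog : 0 ≤ Real.log (1 / (δ : ℝ)) := Real.log_nonneg hinv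
  have hlogb : 0 ≤ Real.logb 2 (1 / (δ : ℝ)) := Real.logb_nonneg one_lt_two hinv
  have hle : (1 : ℝ) ≤ 2 ^ ⌈Real.logb 2 (1 / (δ : ℝ))⌉₊ * δ := by
    have := Nat.le_ceil (Real.logb 2 (1 / (δ : ℝ)))
    rw [Real.logb_le_iff_le_rpow one_lt_two (by positivity), Real.rpow_natCast,
      div_le_iff₀ hδR] at this
    exact this
  refine ⟨⌈Real.logb 2 (1 / (δ : ℝ))⌉₊, fun q hq => ?_, ?_, hle, ?_⟩
  · have := Nat.lt_ceil.1 hq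
    rw [Real.lt_logb_iff_rpow_lt one_lt_two (by positivity), Real.rpow_natCast,
      lt_div_iff₀ hδR] at this
    have h : (2 : ℝ) ^ q * δ.num.toNat < δ.den := by
      rw [hnum, ← mul_assoc]
      nlinarith
    exact_mod_cast h
  · have h : (δ.den : ℝ) ≤ 2 ^ ⌈Real.logb 2 (1 / (δ : ℝ))⌉₊ * δ.num.toNat := by
      rw [hnum, ← mul_assoc]
      nlinarith
    exact_mod_cast h
  · refine (Nat.ceil_lt_add_one hlogb).le.trans ?_
    have : Real.logb 2 (1 / (δ : ℝ)) ≤ 2 * Real.log (1 / δ) := by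
      rw [Real.logb, div_le_iff₀ (Real.log_pos one_lt_two)]
      nlinarith [Real.log_two_gt_d9]
    linarith

theorem PathInstance.length_triples (I : PathInstance) :
    I.triples.length = I.graph.timeEdges.card := by
  have := congrArg Multiset.card I.triples_eq
  simpa using this

theorem PathInstance.length_triples_le (I : PathInstance) :
    I.triples.length ≤ I.n ^ 2 * I.graph.lifetime := by
  rw [I.length_triples]
  have hsub : I.graph.timeEdges ⊆ ((Finset.univ ×ˢ Finset.univ) ×ˢ
      Finset.Icc 1 I.graph.lifetime : Finset ((Fin I.n × Fin I.n) × ℕ)).image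
        fun x => (s(x.1.1, x.1.2), x.2) := by
    rintro ⟨e, t⟩ he
    induction e with
    | _ u v =>
      exact Finset.mem_image.2 ⟨((u, v), t), by simpa using I.graph.label_mem _ he, rfl⟩
  refine (Finset.card_le_card hsub).trans (Finset.card_image_le.trans (le_of_eq ?_))
  simp [Finset.card_product, sq]

theorem PathInstance.n_pos (I : PathInstance) : 0 < I.n := I.s.pos

/-- The running time of the core program, when a colour is drawn with few coins and few leftover
outcomes. -/
theorem coreCost_le (I : PathInstance) {K b a E L : ℕ} (hE : 0 < E) (hb : b ≤ 2 * K)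
    (hab : 2 ^ b / a ≤ 2 * (K + 1)) (hKa : K * a ≤ 4 * K ^ 2 + 1) :
    coreCost I K b a E L ≤
      200 * (sampleSize K E L * (K + 1) * (I.n ^ 2 * I.graph.lifetime ^ 2)) := by
  set T := I.graph.lifetime with hT
  have hn := I.n_pos
  have hT1 : 0 < T := I.graph.lifetime_pos
  have hm : I.triples.length ≤ I.n ^ 2 * T := I.length_triples_le
  set n := I.n
  have hKK : K ≤ K ^ K ∧ 0 < K ^ K := by
    rcases Nat.eq_zero_or_pos K with rfl | h
    · simp
    · exact ⟨Nat.le_self_pow h.ne' K, by positivity⟩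
  set P := n ^ 2 * T ^ 2 with hP
  have hPpos : 0 < P := by positivity
  have hnP : n ≤ P := by
    calc n ≤ n ^ 2 := Nat.le_self_pow two_ne_zero n
      _ ≤ P := Nat.le_mul_of_pos_right _ (by positivity)
  have hTP : T ≤ P := by
    calc T ≤ T ^ 2 := Nat.le_self_pow two_ne_zero T
      _ ≤ P := Nat.le_mul_of_pos_left _ (by positivity)
  have hTmP : T * I.triples.length ≤ P := by
    calc T * I.triples.length ≤ T * (n ^ 2 * T) := Nat.mul_le_mul_left _ hm
      _ = P := by rw [hP]; ring
  have hs : sampleCost I K b a ≤ 90 * ((K + 1) * P) := by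
    have h1 : n * (b * 5 + 2 ^ b / a * 3 + 10) ≤ P * (26 * (K + 1)) :=
      Nat.mul_le_mul hnP (by omega)
    have h2 : T * ((K + 1) * (I.triples.length * 40 + 5) + 5) =
        40 * ((K + 1) * (T * I.triples.length)) + 5 * ((K + 1) * T) + 5 * T := by ring
    have h3 : (K + 1) * (T * I.triples.length) ≤ (K + 1) * P := Nat.mul_le_mul_left _ hTmP
    have h4 : (K + 1) * T ≤ (K + 1) * P := Nat.mul_le_mul_left _ hTP
    have h5 : P ≤ (K + 1) * P := Nat.le_mul_of_pos_left _ (by omega)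
    have h6 : P * (26 * (K + 1)) = 26 * ((K + 1) * P) := by ring
    have h7 : sampleCost I K b a = n * (b * 5 + 2 ^ b / a * 3 + 10) +
      T * ((K + 1) * (I.triples.length * 40 + 5) + 5) + 7 := rfl
    omega
  set S := sampleSize K E L with hS
  have hS1 : 8 * E ≤ S := by
    rw [hS, sampleSize]
    calc 8 * E = 8 * 1 * (E * (1 * 1)) := by ring
      _ ≤ 8 * (L + 1) * (E * (E * K ^ K)) := by gcongr <;> omega
  have hS2 : 8 * (L + 1) ≤ S := by
    rw [hS, sampleSize]
    calc 8 * (L + 1) = 8 * (L + 1) * (1 * (1 * 1)) := by ring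
      _ ≤ 8 * (L + 1) * (E * (E * K ^ K)) := by gcongr <;> omega
  have hS3 : 8 * K ≤ S := by
    rw [hS, sampleSize]
    calc 8 * K = 8 * 1 * (1 * (1 * K)) := by ring
      _ ≤ 8 * (L + 1) * (E * (E * K ^ K)) := by gcongr <;> omega
  have hSk : S ≤ S * (K + 1) := Nat.le_mul_of_pos_right _ (by omega)
  have hSkP : S * (K + 1) ≤ S * (K + 1) * P := Nat.le_mul_of_pos_right _ hPpos
  have hK2 : 8 * (K * (K + 1)) ≤ S * (K + 1) := by
    rw [← mul_assoc]
    exact Nat.mul_le_mul_right _ hS3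
  have g1 : S * (sampleCost I K b a + 5) ≤ 90 * (S * (K + 1) * P) + 5 * S := by
    calc S * (sampleCost I K b a + 5) ≤ S * (90 * ((K + 1) * P) + 5) :=
          Nat.mul_le_mul_left _ (by omega)
      _ = _ := by ring
  have g2 : K * (3 * K + 7) = 3 * (K * (K + 1)) + 4 * K := by ring
  have g3 : K * (3 * a + 7) ≤ 12 * (K * (K + 1)) + 3 + 7 * K := by
    calc K * (3 * a + 7) = 3 * (K * a) + 7 * K := by ring
      _ ≤ 3 * (4 * K ^ 2 + 1) + 7 * K := by omega
      _ ≤ _ := by nlinarith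
  have g4 : (K + 1) * (b * 3 + 8) ≤ 6 * (K * (K + 1)) + 8 * K + 8 := by
    calc (K + 1) * (b * 3 + 8) ≤ (K + 1) * (2 * K * 3 + 8) := by gcongr
      _ = _ := by ring
  have g5 : coreCost I K b a E L = 9 * E + 27 * L + K * (3 * K + 7) + 63 +
    S * (sampleCost I K b a + 5) + K * (3 * a + 7) + (K + 1) * (b * 3 + 8) := rfl
  omega

/-- The event that the samples lead to an `ε`-approximation. -/
def GoodSamples (I : PathInstance) (K b a lo E L : ℕ) (ε : ℚ) (ω : ℕ → Bool) : Prop :=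
  (1 - (ε : ℝ)) * targetCount I K lo ≤
      (∑ j ∈ Finset.range (sampleSize K E L), sampleValue ω I K b a lo j) /
        (sampleSize K E L * a ^ K) ∧
    (∑ j ∈ Finset.range (sampleSize K E L), sampleValue ω I K b a lo j) /
        (sampleSize K E L * a ^ K) ≤ (1 + (ε : ℝ)) * targetCount I K lo

theorem outputsApprox_of_goodSamples {I : PathInstance} {K b a lo E L : ℕ} {ε : ℚ}
    {ω : ℕ → Bool} (ha : 0 < a) (hE : 0 < E) (h : GoodSamples I K b a lo E L ε ω) {τ : State}
    (h1 : τ.var 1 = sampleSize K E L * a ^ K)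
    (h0 : τ.var 0 = ∑ c ∈ Finset.range (K + 1), if lo ≤ c then 2 ^ (b * c) *
        ∑ j ∈ Finset.range (sampleSize K E L),
          I.graph.coloredCount I.z (randomColoring ω I K b a j) (c + 1) 1 I.s else 0) :
    OutputsApprox ε (targetCount I K lo) τ := by
  have hKK : 0 < K ^ K := by
    rcases Nat.eq_zero_or_pos K with rfl | h
    · simp
    · positivity
  have e1 : (τ.var 1 : ℝ) = sampleSize K E L * a ^ K := by rw [h1]; push_cast; ring
  have e0 : (τ.var 0 : ℝ) =
      ∑ j ∈ Finset.range (sampleSize K E L), sampleValue ω I K b a lo j := by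
    unfold sampleValue
    rw [h0, Finset.sum_comm]
    push_cast
    refine Finset.sum_congr rfl fun c _ => ?_
    split_ifs
    · rw [Finset.mul_sum]
    · simp
  refine ⟨?_, ?_, ?_⟩
  · rw [h1, sampleSize]
    positivity
  · have := h.1
    rw [← e0, ← e1] at this
    rw [← Rat.cast_le (K := ℝ)]
    push_cast
    exact this
  · have := h.2
    rw [← e0, ← e1] at this
    rw [← Rat.cast_le (K := ℝ)]
    push_cast
    exact this

/-- A bound for all outcomes of the coins, and a correct output on an event `G` of large
probability. -/
theorem approximatesWithin_of_runs {F : CountingProblem} {p : Program} {I : F.Inst} {ε δ : ℚ}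
    {B : ℝ} {N : ℕ} (G : (ℕ → Bool) → Prop)
    (h : ∀ ω, Runs ω p N (F.start I ε δ) fun τ => G ω → OutputsApprox ε (F.count I) τ)
    (hN : (N : ℝ) ≤ B) (hG : 1 - (δ : ℝ) ≤ fairCoins.real {ω | G ω}) :
    F.ApproximatesWithin p I ε δ B := by
  constructor
  · intro ω
    obtain ⟨t, τ, he, ht, -⟩ := h ω
    exact ⟨t, τ, he, (Nat.cast_le.2 ht).trans hN⟩
  · calc ENNReal.ofReal (1 - (δ : ℝ)) ≤ ENNReal.ofReal (fairCoins.real {ω | G ω}) :=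
          ENNReal.ofReal_le_ofReal hG
      _ = fairCoins {ω | G ω} := ofReal_measureReal
      _ ≤ _ := measure_mono fun ω hω => by
          obtain ⟨t, τ, he, -, hq⟩ := h ω
          exact ⟨t, τ, he, hq hω⟩

theorem outputsApprox_of_eq {ε : ℚ} (hε : 0 < ε) {N : ℕ} {τ : State} (h1 : τ.var 1 = 1)
    (h0 : τ.var 0 = N) : OutputsApprox ε N τ := by
  have hN : (0 : ℚ) ≤ N := Nat.cast_nonneg N
  refine ⟨by simp [h1], ?_, ?_⟩ <;> rw [h1, h0] <;> simp only [Nat.cast_one, div_one] <;> nlinarith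

/-- The initial state of both problems, after the variable `14` has been set to `1`. -/
theorem hasInput_of_start {F : CountingProblem} {J : F.Inst} {I : PathInstance} {ε δ : ℚ}
    {rest : List ℕ} (hh : F.header J = I.numbers ++ rest) (hl : rest.length ≤ 1)
    (ht : F.table J = I.tables) : HasInput I ((F.start J ε δ).setVar 14 1) := by
  have hz : rest[6]? = none := by
    rw [List.getElem?_eq_none_iff]
    omega
  constructor
  · simp [CountingProblem.start, hh, PathInstance.numbers]
  · simp [CountingProblem.start, hh, PathInstance.numbers]
  · simp [CountingProblem.start, hh, PathInstance.numbers, I.length_triples]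
  · simp [CountingProblem.start, hh, PathInstance.numbers]
  · simp [CountingProblem.start, hh, PathInstance.numbers]
  · simp
  · simp [CountingProblem.start, hh, PathInstance.numbers, hz]
  · intro j hj
    simp [CountingProblem.start, ht, PathInstance.tables, hj]
  · intro j hj
    simp [CountingProblem.start, ht, PathInstance.tables, hj]
  · intro j hj
    simp [CountingProblem.start, ht, PathInstance.tables, hj]

theorem start_arr {F : CountingProblem} {J : F.Inst} {I : PathInstance} {ε δ : ℚ}
    (ht : F.table J = I.tables) {a : ℕ} (ha : 3 ≤ a) (i : ℕ) :
    (F.start J ε δ).arr a i = 0 := by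
  have : I.tables[a]? = none := by
    rw [List.getElem?_eq_none_iff]
    simpa [PathInstance.tables] using ha
  simp [CountingProblem.start, ht, this]

/-! ### Paths with a given number of edges -/

/-- Put the least `b` with `2 * K ^ 2 ≤ 2 ^ b` into the variable `12` and `2 ^ b` into `72`. -/
def bitParamProg : Program :=
  mulProg 70 10 10 71 ;; (.add 70 70 70 ;; .const 12 0 ;; .const 72 1) ;;
    .whileLT 72 70 (.add 72 72 72 ;; .add 12 12 14)

theorem runs_bitParamProg {ω : ℕ → Bool} {σ : State} {K b : ℕ} (h1 : σ.var 14 = 1)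
    (hK : σ.var 10 = K) (hlt : ∀ q < b, 2 ^ q < 2 * K ^ 2) (hle : 2 * K ^ 2 ≤ 2 ^ b) :
    Runs ω bitParamProg (3 * K + b * 3 + 7) σ (fun τ => τ.var 12 = b ∧ τ.var 72 = 2 ^ b) := by
  refine (Runs.seq (B' := 3 + (b * (2 + 1) + 1))
    ((runs_mulProg h1 rfl rfl).mono (by rw [hK]) fun _ _ h => h) ?_).mono (by omega)
    fun _ _ h => h
  intro τ₁ hF₁ h70
  rw [hK] at h70
  have a14 : τ₁.var 14 = 1 := by rw [hF₁.var 14 rfl, h1]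
  refine Runs.seq (Q := fun υ => υ = ((τ₁.setVar 70 (2 * K ^ 2)).setVar 12 0).setVar 72 1)
    (Runs.of_result rfl le_rfl (by
      simp only [Program.result, h70]
      rw [show K * K + K * K = 2 * K ^ 2 by ring])) ?_
  rintro _ - rfl
  refine (Runs.whileLT (B := 2) (fun τ => τ.var 12 ≤ b ∧ τ.var 72 = 2 ^ τ.var 12)
    (fun τ => b - τ.var 12) (by simp) ?_).mono (by simp) ?_
  · rintro τ hF ⟨hI, hI'⟩ hlt'
    have k70 : τ.var 70 = 2 * K ^ 2 := by rw [hF.var 70 rfl]; simp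
    have k14 : τ.var 14 = 1 := by rw [hF.var 14 rfl]; simp [a14]
    have hne : τ.var 12 ≠ b := fun h => by
      rw [hI', k70, h] at hlt'
      omega
    refine Runs.of_result rfl le_rfl ?_
    simp [Program.result, k14, hI', pow_succ]
    omega
  · rintro τ hF ⟨⟨hI, hI'⟩, hlt'⟩
    have k70 : τ.var 70 = 2 * K ^ 2 := by rw [hF.var 70 rfl]; simp
    have : τ.var 12 = b := by
      by_contra hne
      have := hlt (τ.var 12) (by omega)
      omega
    rw [hI', this]
    exact ⟨rfl, rfl⟩

/-- Put `⌊2 ^ b / max K 1⌋` into the variable `13`; the maximum avoids a division by `0`, which on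
the machine would not end. -/
def shareParamProg : Program :=
  (.add 41 72 15 ;; .add 13 10 15 ;; .ifLT 10 14 (.const 13 1) .skip ;; .sub 17 13 14) ;;
    divProg ;; .add 13 44 15

theorem runs_shareParamProg {ω : ℕ → Bool} {σ : State} {K : ℕ} (h1 : σ.var 14 = 1)
    (h0 : σ.var 15 = 0) (hK : σ.var 10 = K) :
    Runs ω shareParamProg (σ.var 72 / max K 1 * 3 + 8) σ
      (fun τ => τ.var 13 = σ.var 72 / max K 1) := by
  refine (Runs.seq (B := 5) (B' := σ.var 72 / max K 1 * 3 + 2 + 1)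
    (Q := fun υ => υ.var 41 = σ.var 72 ∧ υ.var 13 = max K 1 ∧ υ.var 17 = max K 1 - 1)
    (Runs.of_result rfl le_rfl ?_) ?_).mono (by omega) fun _ _ h => h
  · rcases Nat.eq_zero_or_pos K with rfl | h
    · simp [Program.result, h0, h1, hK]
    · rw [max_eq_left (show 1 ≤ K from h)]
      simp [Program.result, h0, h1, hK, h.ne']
  · rintro τ hF ⟨h41, h13, h17⟩
    refine Runs.seq ((runs_divProg (by rw [hF.var 14 rfl, h1]) (by omega) h13 h17).mono
      (by rw [h41]) fun _ _ h => h) ?_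
    intro τ' hF' h44
    refine Runs.of_result rfl le_rfl ?_
    simp [Program.result, h44, h41, hF'.var 15 rfl, hF.var 15 rfl, h0]

/-- The algorithm for paths with exactly `k` edges, where `k` is the variable `9`. If `s = z` or
`k = 0`, then the number of paths is known. -/
def shortPathProg : Program :=
  .const 14 1 ;; ifNe 7 8
    (.ifLT 15 9
      ((.sub 10 9 14 ;; .add 11 10 15) ;; bitParamProg ;; shareParamProg ;; coreProg)
      (.const 0 0 ;; .const 1 1))
    (.const 1 1 ;; .ifLT 15 9 (.const 0 0) (.const 0 1))

theorem targetCount_self (I : PathInstance) (K : ℕ) :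
    targetCount I K K = (I.graph.pathSet I.s I.z (K + 1)).card := by
  rw [targetCount, Finset.sum_eq_single_of_mem K (by simp), if_pos le_rfl]
  intro c hc hne
  have := Finset.mem_range.1 hc
  rw [if_neg (by omega)]

/-- The parameters for paths with exactly `K` inner vertices: each colour is drawn with a
probability close to `1 / K`. -/
theorem exists_params (K : ℕ) : ∃ b : ℕ, (∀ q < b, 2 ^ q < 2 * K ^ 2) ∧ 2 * K ^ 2 ≤ 2 ^ b ∧
    b ≤ 2 * K ∧ 2 ^ b ≤ 4 * K ^ 2 + 1 ∧ 0 < 2 ^ b / max K 1 ∧ K * (2 ^ b / max K 1) ≤ 2 ^ b ∧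
    2 ^ b / (2 ^ b / max K 1) ≤ 2 * (K + 1) ∧
    2 ^ (b * K) ≤ 2 * (K ^ K * (2 ^ b / max K 1) ^ K) := by
  have hex : 2 * K ^ 2 ≤ 2 ^ (2 * K) := by
    rw [pow_mul]
    induction K with
    | zero => simp
    | succ K ih =>
      rcases Nat.eq_zero_or_pos K with rfl | h
      · norm_num
      · rw [pow_succ (2 ^ 2) K]
        nlinarith
  classical
  have hex' : ∃ b, 2 * K ^ 2 ≤ 2 ^ b := ⟨_, hex⟩
  set b := Nat.find hex' with hb
  have hlt : ∀ q < b, 2 ^ q < 2 * K ^ 2 := fun q hq => not_le.1 (Nat.find_min hex' hq)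
  have hle : 2 * K ^ 2 ≤ 2 ^ b := Nat.find_spec hex'
  have hup : 2 ^ b ≤ 4 * K ^ 2 + 1 := by
    rcases Nat.eq_zero_or_pos b with h0 | h0
    · simp [h0]
    · have := hlt (b - 1) (by omega)
      have h2 : 2 ^ b = 2 * 2 ^ (b - 1) := by
        rw [← pow_succ', Nat.sub_add_cancel h0]
      omega
  refine ⟨b, hlt, hle, Nat.find_min' hex' hex, hup, ?_⟩
  rcases Nat.eq_zero_or_pos K with rfl | hK
  · have : b = 0 := (Nat.find_eq_zero hex').2 (by simp)
    simp [this]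
  rw [max_eq_left hK]
  set x := 2 ^ b with hx
  set a := x / K with ha
  have h1 : K * a ≤ x := Nat.mul_div_le x K
  have h2 : x < K * (a + 1) := Nat.lt_mul_div_succ x hK
  have h3 : K ≤ x := by nlinarith
  have ha0 : 0 < a := Nat.div_pos h3 hK
  refine ⟨ha0, h1, ?_, ?_⟩
  · refine Nat.div_le_of_le_mul ?_
    nlinarith
  · rw [pow_mul, ← hx, ← mul_pow]
    have hxR : (0 : ℝ) < x := by exact_mod_cast (by omega : 0 < x)
    -- rounding down loses less than `K ≤ x / (2 * K)`, and Bernoulli's inequality applies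
    have h4 : 1 - 1 / (2 * K : ℝ) ≤ K * a / x := by
      have hKR : (0 : ℝ) < K := by exact_mod_cast hK
      have h5 : (x : ℝ) ≤ K * a + K := by exact_mod_cast (by nlinarith : x ≤ K * a + K)
      have h6 : (2 * K ^ 2 : ℝ) ≤ x := by exact_mod_cast hle
      rw [le_div_iff₀ hxR, sub_mul, one_mul]
      have h7 : (K : ℝ) ≤ 1 / (2 * K) * x := by
        rw [one_div, inv_mul_eq_div, le_div_iff₀ (by positivity)]
        linarith
      linarith
    have h8 : (1 : ℝ) / 2 ≤ (K * a / x) ^ K := by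
      have hKR : (1 : ℝ) ≤ K := by exact_mod_cast hK
      have h9 : -2 ≤ -(1 / (2 * K : ℝ)) := by
        have : 1 / (2 * K : ℝ) ≤ 1 := by rw [div_le_one (by linarith)]; linarith
        linarith
      have := one_add_mul_le_pow h9 K
      have h10 : (1 : ℝ) + K * -(1 / (2 * K)) = 1 / 2 := by field_simp; ring
      rw [h10] at this
      refine this.trans (pow_le_pow_left₀ ?_ (by linarith) K)
      have : 1 / (2 * K : ℝ) ≤ 1 := by rw [div_le_one (by linarith)]; linarith
      linarith
    rw [div_pow, le_div_iff₀ (by positivity)] at h8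
    have : (x : ℝ) ^ K ≤ 2 * (K * a) ^ K := by linarith
    exact_mod_cast this

/-- `K ^ K` samples suffice up to a constant, and `K ^ K ≤ K! * exp K`. -/
theorem sampleSize_le {K E L : ℕ} {ε δ : ℝ} (hε : 0 < ε) (hE : (E : ℝ) ≤ 1 / ε + 1)
    (hL : (L : ℝ) ≤ 2 * Real.log (1 / δ) + 1) :
    (sampleSize K E L * (K + 1) : ℝ) ≤ 128 * (((K + 1).factorial : ℝ) * Real.exp (K + 1 : ℕ) *
      max 1 (Real.log (1 / δ)) * max 1 (1 / ε ^ 2)) := by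
  have h1 : (K ^ K * (K + 1) : ℝ) ≤ ((K + 1).factorial : ℝ) * Real.exp (K + 1 : ℕ) := by
    have h := Real.pow_div_factorial_le_exp (K : ℝ) (Nat.cast_nonneg K) K
    rw [div_le_iff₀ (by positivity)] at h
    have h' : Real.exp K ≤ Real.exp (K + 1 : ℕ) := Real.exp_le_exp.2 (by push_cast; linarith)
    calc (K ^ K * (K + 1) : ℝ) ≤ Real.exp (K + 1 : ℕ) * K.factorial * (K + 1) := by
          refine mul_le_mul_of_nonneg_right (h.trans ?_) (by positivity)
          exact mul_le_mul_of_nonneg_right h' (by positivity)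
      _ = _ := by rw [Nat.factorial_succ]; push_cast; ring
  have h2 : ((L : ℝ) + 1) ≤ 4 * max 1 (Real.log (1 / δ)) := by
    have := le_max_left 1 (Real.log (1 / δ))
    have := le_max_right 1 (Real.log (1 / δ))
    linarith
  have h3 : (E * E : ℝ) ≤ 4 * max 1 (1 / ε ^ 2) := by
    have hinv : 0 < 1 / ε := by positivity
    have h4 : (E * E : ℝ) ≤ (1 / ε + 1) * (1 / ε + 1) :=
      mul_le_mul hE hE (Nat.cast_nonneg E) (by positivity)
    have h5 : 1 / ε ^ 2 = (1 / ε) * (1 / ε) := by field_simp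
    rw [h5]
    rcases le_total 1 (1 / ε) with h | h
    · have := le_max_right 1 (1 / ε * (1 / ε))
      nlinarith
    · have := le_max_left 1 (1 / ε * (1 / ε))
      nlinarith
  calc (sampleSize K E L * (K + 1) : ℝ)
      = 8 * ((K ^ K * (K + 1)) * (L + 1) * (E * E)) := by
        rw [sampleSize]
        push_cast
        ring
    _ ≤ 8 * ((((K + 1).factorial : ℝ) * Real.exp (K + 1 : ℕ)) *
          (4 * max 1 (Real.log (1 / δ))) * (4 * max 1 (1 / ε ^ 2))) := by
        gcongr
    _ = _ := by ring

theorem runs_shortPathProg (I : PathInstance) (k : ℕ) {ε δ : ℚ} (hε : 0 < ε) (hδ : 0 < δ)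
    (hδ1 : δ < 1) :
    shortTemporalPath.ApproximatesWithin shortPathProg (I, k) ε δ
      (27000 * ((k.factorial : ℝ) * Real.exp k * max 1 (Real.log (1 / (δ : ℝ))) *
        max 1 (1 / (ε : ℝ) ^ 2) * (I.n : ℝ) ^ 2 * (I.graph.lifetime : ℝ) ^ 2)) := by
  have hεR : (0 : ℝ) < ε := by exact_mod_cast hε
  have hδR : (0 : ℝ) < δ := by exact_mod_cast hδ
  have hP : (1 : ℝ) ≤ (I.n : ℝ) ^ 2 * (I.graph.lifetime : ℝ) ^ 2 := by
    have h1 : 0 < I.n ^ 2 * I.graph.lifetime ^ 2 :=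
      Nat.mul_pos (pow_pos I.n_pos 2) (pow_pos I.graph.lifetime_pos 2)
    exact_mod_cast h1
  have hsmall : (10 : ℝ) ≤ 27000 * ((k.factorial : ℝ) * Real.exp k *
      max 1 (Real.log (1 / (δ : ℝ))) * max 1 (1 / (ε : ℝ) ^ 2) * (I.n : ℝ) ^ 2 *
        (I.graph.lifetime : ℝ) ^ 2) := by
    have h1 : (1 : ℝ) ≤ k.factorial := by exact_mod_cast k.factorial_pos
    have h2 : (1 : ℝ) ≤ Real.exp k := Real.one_le_exp (Nat.cast_nonneg k)
    have h3 : (1 : ℝ) ≤ max 1 (Real.log (1 / (δ : ℝ))) := le_max_left _ _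
    have h4 : (1 : ℝ) ≤ max 1 (1 / (ε : ℝ) ^ 2) := le_max_left _ _
    rw [mul_assoc _ ((I.n : ℝ) ^ 2)]
    have h5 := one_le_mul_of_one_le_of_one_le (one_le_mul_of_one_le_of_one_le
      (one_le_mul_of_one_le_of_one_le (one_le_mul_of_one_le_of_one_le h1 h2) h3) h4) hP
    linarith
  set σ := shortTemporalPath.start (I, k) ε δ with hσ
  have hI : HasInput I (σ.setVar 14 1) :=
    hasInput_of_start (F := shortTemporalPath) (J := (I, k)) (rest := [k]) rfl (by simp) rfl
  have h9 : (σ.setVar 14 1).var 9 = k := by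
    simp [hσ, CountingProblem.start, shortTemporalPath, PathInstance.numbers]
  have h9' : σ.var 9 = k := h9
  have h15 : σ.var 15 = 0 := hI.zero
  have hcount : shortTemporalPath.count (I, k) = (I.graph.pathSet I.s I.z k).card :=
    I.graph.numPathsOfLength_eq _ _ _
  by_cases hsz : I.s = I.z
  · refine approximatesWithin_of_runs (N := 10) (fun _ => True) (fun ω => ?_)
      (by simpa using hsmall) (by simpa using hδR.le)
    refine Runs.seq (B := 1) (B' := 9) (Q := fun υ => υ = σ.setVar 14 1)
      (Runs.of_result rfl le_rfl rfl) ?_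
    rintro _ - rfl
    refine (Runs.ifNe (B := 5) (fun h => absurd (by rw [hI.s, hI.z, hsz]) h)
      fun _ => Runs.of_result rfl (by decide) fun _ => ?_).mono (by norm_num) fun _ _ h => h
    rw [hcount]
    cases k with
    | zero =>
      rw [TemporalGraph.card_pathSet_zero, if_pos hsz]
      refine outputsApprox_of_eq hε ?_ ?_ <;> simp [Program.result, h9', h15]
    | succ k =>
      rw [hsz, TemporalGraph.pathSet_self_succ]
      refine outputsApprox_of_eq hε ?_ ?_ <;> simp [Program.result, h9', h15]
  have hne : (σ.setVar 14 1).var 7 ≠ (σ.setVar 14 1).var 8 := by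
    rw [hI.s, hI.z]
    exact fun h => hsz (Fin.ext h)
  cases k with
  | zero =>
    refine approximatesWithin_of_runs (N := 10) (fun _ => True) (fun ω => ?_)
      (by simpa using hsmall) (by simpa using hδR.le)
    refine Runs.seq (B := 1) (B' := 9) (Q := fun υ => υ = σ.setVar 14 1)
      (Runs.of_result rfl le_rfl rfl) ?_
    rintro _ - rfl
    refine (Runs.ifNe (B := 5) (fun _ => Runs.ite (B := 4)
      (fun h => absurd h (by rw [h9]; omega)) fun _ => Runs.of_result rfl (by decide) fun _ => ?_)
      (fun h => absurd h hne)).mono (by norm_num) fun _ _ h => h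
    rw [hcount, TemporalGraph.card_pathSet_zero, if_neg hsz]
    refine outputsApprox_of_eq hε ?_ ?_ <;> simp [Program.result]
  | succ K =>
    obtain ⟨E, hE0, hElt, hEle, hE1, hE2⟩ := exists_ceil_inv hε
    obtain ⟨L, hLlt, hLle, hL1, hL2⟩ := exists_log_inv hδ hδ1
    obtain ⟨b, hblt, hble, hb, hup, ha, hKa, hdiv, hp⟩ := exists_params K
    set a := 2 ^ b / max K 1 with ha_def
    refine approximatesWithin_of_runs (N := 21 * K + 34 + coreCost I K b a E L)
      (fun ω => GoodSamples I K b a K E L ε ω) (fun ω => ?_) ?_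
      (le_fairCoins_approx hsz ha hKa (Or.inl rfl) hp hE0 hE1 hL1)
    · have haK : a ≤ 4 * K + 1 := by
        refine Nat.div_le_of_le_mul ?_
        rcases Nat.eq_zero_or_pos K with rfl | h
        · simpa using hup
        · rw [max_eq_left h]
          nlinarith
      refine (Runs.seq (B := 1) (B' := (2 + ((3 * K + b * 3 + 7) + ((a * 3 + 8) +
        coreCost I K b a E L)) + 1) + 3)
        (Q := fun υ => υ = σ.setVar 14 1) (Runs.of_result rfl le_rfl rfl) ?_).mono (by omega)
        fun _ _ h => h
      rintro _ - rfl
      refine Runs.ifNe (fun _ => Runs.ite (fun _ => ?_)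
        fun h => absurd (by rw [h9, hI.zero]; omega) h) (fun h => absurd h hne)
      refine Runs.seq (Q := fun υ => υ = ((σ.setVar 14 1).setVar 10 K).setVar 11 K)
        (Runs.of_result rfl le_rfl (by simp [Program.result, h9', h15])) ?_
      rintro _ hF₁ rfl
      have hI₁ := hI.frame hF₁ rfl rfl
      refine Runs.seq (runs_bitParamProg (K := K) hI₁.one (by simp) hblt hble) ?_
      rintro τ₂ hF₂ ⟨h12, h72⟩
      have hI₂ := hI₁.frame hF₂ rfl rfl
      have k10 : τ₂.var 10 = K := by rw [hF₂.var 10 rfl]; simp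
      refine Runs.seq ((runs_shareParamProg hI₂.one hI₂.zero k10).mono (by rw [h72])
        fun _ _ h => h) ?_
      intro τ₃ hF₃ h13
      have hI₃ := hI₂.frame hF₃ rfl rfl
      have e0 : τ₃.var 0 = ε.num.toNat := by
        rw [hF₃.var 0 rfl, hF₂.var 0 rfl]; rfl
      have e1 : τ₃.var 1 = ε.den := by
        rw [hF₃.var 1 rfl, hF₂.var 1 rfl]; rfl
      have e2 : τ₃.var 2 = δ.num.toNat := by
        rw [hF₃.var 2 rfl, hF₂.var 2 rfl]; rfl
      have e3 : τ₃.var 3 = δ.den := by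
        rw [hF₃.var 3 rfl, hF₂.var 3 rfl]; rfl
      refine (runs_coreProg hI₃ ha hsz (lo := K) (K := K) (b := b) (E := E) (L := L)
        (by rw [hF₃.coins rfl, hF₂.coins rfl]; rfl)
        (by rw [hF₃.var 10 rfl, k10]) (by rw [hF₃.var 11 rfl, hF₂.var 11 rfl]; simp)
        (by rw [hF₃.var 12 rfl, h12]) (by rw [h13, h72]) (by rwa [e0, e1]) (by rwa [e0, e1])
        (by rwa [e2, e3]) (by rwa [e2, e3]) (fun c => ?_)).mono le_rfl ?_
      · rw [hF₃.arr 33 rfl, hF₂.arr 33 rfl]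
        have h33 := start_arr (F := shortTemporalPath) (J := (I, K + 1)) (I := I) (ε := ε) (δ := δ)
          rfl (le_refl 3 |>.trans (by norm_num : 3 ≤ 33)) c
        exact h33
      · rintro τ - ⟨h1, h0⟩ hG
        rw [hcount, ← targetCount_self]
        exact outputsApprox_of_goodSamples ha hE0 hG h1 h0
    · have h1 := coreCost_le I (L := L) hE0 hb hdiv (hKa.trans hup)
      have h2 : 21 * K + 34 ≤ 8 * (sampleSize K E L * (K + 1) *
          (I.n ^ 2 * I.graph.lifetime ^ 2)) := by
        have h3 : 8 ≤ sampleSize K E L := by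
          have : 0 < K ^ K := by
            rcases Nat.eq_zero_or_pos K with rfl | h
            · simp
            · positivity
          calc 8 = 8 * 1 * (1 * (1 * 1)) := by norm_num
            _ ≤ 8 * (L + 1) * (E * (E * K ^ K)) := by gcongr <;> omega
        have h4 : 0 < I.n ^ 2 * I.graph.lifetime ^ 2 :=
          Nat.mul_pos (pow_pos I.n_pos 2) (pow_pos I.graph.lifetime_pos 2)
        calc 21 * K + 34 ≤ 8 * (8 * (K + 1) * 1) := by omega
          _ ≤ _ := by gcongr; omega
      have h3 : ((21 * K + 34 + coreCost I K b a E L : ℕ) : ℝ) ≤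
          208 * ((sampleSize K E L * (K + 1) : ℝ) * (I.n ^ 2 * I.graph.lifetime ^ 2)) := by
        exact_mod_cast (by omega : 21 * K + 34 + coreCost I K b a E L ≤
          208 * (sampleSize K E L * (K + 1) * (I.n ^ 2 * I.graph.lifetime ^ 2)))
      have h4 := sampleSize_le (K := K) hεR hE2 hL2
      have h5 := mul_le_mul_of_nonneg_right h4 (zero_le_one.trans hP)
      have h6 : (0 : ℝ) ≤ ((K + 1).factorial : ℝ) * Real.exp (K + 1 : ℕ) *
          max 1 (Real.log (1 / (δ : ℝ))) * max 1 (1 / (ε : ℝ) ^ 2) * (I.n : ℝ) ^ 2 *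
            (I.graph.lifetime : ℝ) ^ 2 := by positivity
      calc ((21 * K + 34 + coreCost I K b a E L : ℕ) : ℝ) ≤ _ := h3
        _ ≤ 208 * (128 * (((K + 1).factorial : ℝ) * Real.exp (K + 1 : ℕ) *
            max 1 (Real.log (1 / (δ : ℝ))) * max 1 (1 / (ε : ℝ) ^ 2)) *
              ((I.n : ℝ) ^ 2 * (I.graph.lifetime : ℝ) ^ 2)) := by linarith
        _ ≤ _ := by linarith

/-! ### Depth-first search -/

/-- The state of a depth-first search from `s` in `H`: the set `vis` of visited vertices, the stack
`st` (its top first), the stack `A v` just after `v` was pushed, and the maximal height `h` of the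
stack so far. -/
structure DepthFirst {V : Type*} (H : SimpleGraph V) (s : V) (vis : Set V) (st : List V)
    (A : V → List V) (h : ℕ) : Prop where
  root : s ∈ vis
  head : ∀ v ∈ vis, ∃ l, A v = v :: l
  nodup : ∀ v ∈ vis, (A v).Nodup
  chain : ∀ v ∈ vis, (A v).IsChain H.Adj
  mem : ∀ v ∈ vis, ∀ w ∈ A v, w ∈ vis ∧ A w <:+ A v
  stack : st = [] ∨ ∃ v ∈ vis, st = A v
  comparable : ∀ x ∈ vis, ∀ y ∈ vis, H.Adj x y → x ∈ A y ∨ y ∈ A x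
  finished : ∀ x ∈ vis, x ∉ st → ∀ y, H.Adj x y → y ∈ vis
  length_le : ∀ v ∈ vis, (A v).length ≤ h
  exists_length : ∃ v ∈ vis, (A v).length = h

namespace DepthFirst

variable {V : Type*} {H : SimpleGraph V} {s u w : V} {vis : Set V} {st : List V}
  {A : V → List V} {h : ℕ}

theorem init (H : SimpleGraph V) (s : V) : DepthFirst H s {s} [s] (fun v => [v]) 1 := by
  constructor <;> simp

theorem stack_subset (hd : DepthFirst H s vis st A h) {v : V} (hv : v ∈ st) : v ∈ vis := by
  rcases hd.stack with rfl | ⟨x, hx, rfl⟩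
  · simp at hv
  · exact (hd.mem x hx v hv).1

theorem cons_eq (hd : DepthFirst H s vis (u :: st) A h) : u ∈ vis ∧ A u = u :: st := by
  rcases hd.stack with h | ⟨x, hx, h⟩
  · simp at h
  · obtain ⟨l, hl⟩ := hd.head x hx
    obtain ⟨rfl, rfl⟩ := List.cons.inj (h.trans hl)
    exact ⟨hx, hl⟩

open Classical in
/-- Visit the neighbour `w` of the vertex on top of the stack. -/
theorem push (hd : DepthFirst H s vis (u :: st) A h) (hw : w ∉ vis) (hadj : H.Adj u w) :
    DepthFirst H s (insert w vis) (w :: u :: st) (Function.update A w (w :: u :: st))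
      (max h (st.length + 2)) := by
  obtain ⟨hu, hA⟩ := hd.cons_eq
  have hne : ∀ v ∈ vis, v ≠ w := fun v hv h => hw (h ▸ hv)
  have hup : ∀ v ∈ vis, Function.update A w (w :: u :: st) v = A v := fun v hv => by
    simp [hne v hv]
  have hself : Function.update A w (w :: u :: st) w = w :: u :: st := by simp
  constructor
  · exact Or.inr hd.root
  · rintro v (rfl | hv)
    · exact ⟨_, hself⟩
    · rw [hup v hv]
      exact hd.head v hv
  · rintro v (rfl | hv)
    · rw [hself]
      refine List.nodup_cons.2 ⟨fun hv => hw (hd.stack_subset hv), hA ▸ hd.nodup u hu⟩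
    · rw [hup v hv]
      exact hd.nodup v hv
  · rintro v (rfl | hv)
    · rw [hself]
      exact List.isChain_cons_cons.2 ⟨hadj.symm, hA ▸ hd.chain u hu⟩
    · rw [hup v hv]
      exact hd.chain v hv
  · rintro v (rfl | hv) x hx
    · rw [hself] at hx ⊢
      rcases List.mem_cons.1 hx with rfl | hx
      · exact ⟨Or.inl rfl, by rw [hself]⟩
      · rw [← hA] at hx
        obtain ⟨h1, h2⟩ := hd.mem u hu x hx
        refine ⟨Or.inr h1, ?_⟩
        rw [hup x h1, ← hA]
        exact h2.trans (List.suffix_cons _ _)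
    · rw [hup v hv] at hx ⊢
      obtain ⟨h1, h2⟩ := hd.mem v hv x hx
      exact ⟨Or.inr h1, by rwa [hup x h1]⟩
  · exact Or.inr ⟨w, Or.inl rfl, hself.symm⟩
  · -- a visited neighbour of the unvisited vertex `w` is not finished, hence on the stack
    have hst : ∀ x ∈ vis, H.Adj x w → x ∈ w :: u :: st := fun x hx hxw => by
      by_contra hmem
      exact hw (hd.finished x hx (fun h => hmem (List.mem_cons_of_mem _ h)) w hxw)
    rintro x (rfl | hx) y (rfl | hy) hxy
    · exact absurd hxy (H.loopless.irrefl _)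
    · refine Or.inr ?_
      rw [hself]
      exact hst y hy hxy.symm
    · refine Or.inl ?_
      rw [hself]
      exact hst x hx hxy
    · rw [hup x hx, hup y hy]
      exact hd.comparable x hx y hy hxy
  · rintro x (rfl | hx) hmem y hxy
    · simp at hmem
    · exact Or.inr (hd.finished x hx (fun h => hmem (List.mem_cons_of_mem _ h)) y hxy)
  · rintro v (rfl | hv)
    · rw [hself]
      simp
    · rw [hup v hv]
      exact (hd.length_le v hv).trans (le_max_left _ _)
  · obtain ⟨v, hv, hlen⟩ := hd.exists_length
    rcases le_total (st.length + 2) h with hle | hle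
    · exact ⟨v, Or.inr hv, by rw [hup v hv, hlen, max_eq_left hle]⟩
    · exact ⟨w, Or.inl rfl, by rw [hself, max_eq_right hle]; simp⟩

/-- Remove the vertex on top of the stack, all of whose neighbours have been visited. -/
theorem pop (hd : DepthFirst H s vis (u :: st) A h) (hfin : ∀ y, H.Adj u y → y ∈ vis) :
    DepthFirst H s vis st A h := by
  obtain ⟨hu, hA⟩ := hd.cons_eq
  refine { hd with stack := ?_, finished := fun x hx hmem y hxy => ?_ }
  · cases st with
    | nil => exact Or.inl rfl
    | cons x l =>
      obtain ⟨hx, hsuf⟩ := hd.mem u hu x (by simp [hA])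
      refine Or.inr ⟨x, hx, ?_⟩
      obtain ⟨l', hl'⟩ := hd.head x hx
      have hnd := hd.nodup u hu
      rw [hA] at hsuf hnd
      rcases List.suffix_cons_iff.1 hsuf with h | h
      · rw [hl'] at h
        simp [(List.cons.inj h).1] at hnd
      · rcases List.suffix_cons_iff.1 h with h | h
        · exact h.symm
        · have : x ∈ l := h.subset (by simp [hl'])
          simp [this] at hnd
  · by_cases h : x = u
    · exact hfin y (h ▸ hxy)
    · exact hd.finished x hx (by simp [h, hmem]) y hxy

/-- The search tree of a finished search shows that the component has treedepth at most `h`. -/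
theorem hasTreedepthAtMost (hd : DepthFirst H s vis [] A h) :
    HasTreedepthAtMost (H.induce vis) h := by
  have hself : ∀ v ∈ vis, v ∈ A v := fun v hv => by
    obtain ⟨l, hl⟩ := hd.head v hv
    simp [hl]
  refine ⟨
    { le := fun x y => A x <:+ A y
      le_refl := fun x => List.suffix_rfl
      le_trans := fun x y z h h' => h.trans h'
      le_antisymm := fun x y h h' => ?_ }, ?_, ?_, ?_⟩
  · have heq := h.eq_of_length_le h'.length_le
    obtain ⟨l, hl⟩ := hd.head x x.2
    obtain ⟨l', hl'⟩ := hd.head y y.2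
    rw [hl, hl'] at heq
    exact Subtype.ext (List.cons.inj heq).1
  · intro v x hx y hy _
    exact List.suffix_or_suffix_of_suffix hx hy
  · intro x y hxy
    rcases hd.comparable x x.2 y y.2 hxy with h | h
    · exact Or.inl (hd.mem y y.2 x h).2
    · exact Or.inr (hd.mem x x.2 y h).2
  · intro v
    classical
    calc _ ≤ ((A v).toFinset : Set V).encard := by
          refine Set.encard_le_encard_of_injOn (f := Subtype.val) (fun x hx => ?_)
            Subtype.val_injective.injOn
          exact List.mem_toFinset.2 (List.IsSuffix.subset hx (hself x x.2))
      _ ≤ h := by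
          rw [Set.encard_coe_eq_coe_finsetCard]
          exact_mod_cast (List.toFinset_card_le _).trans (hd.length_le v v.2)

/-- The height of the stack of a finished search bounds the lengths of all paths from `s`. -/
theorem length_lt (hd : DepthFirst H s vis [] A h) {l : List V} (hch : (s :: l).IsChain H.Adj)
    (hnd : (s :: l).Nodup) : (s :: l).length + 1 ≤ 2 ^ h := by
  have hvis : ∀ (l : List V) (x : V), x ∈ vis → (x :: l).IsChain H.Adj →
      ∀ y ∈ x :: l, y ∈ vis := by
    intro l
    induction l with
    | nil =>
      intro x hx _ y hy
      rwa [List.mem_singleton.1 hy]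
    | cons a l ih =>
      intro x hx hc y hy
      obtain ⟨h1, h2⟩ := List.isChain_cons_cons.1 hc
      rcases List.mem_cons.1 hy with rfl | hy
      · exact hx
      · exact ih a (hd.finished x hx (by simp) a h1) h2 y hy
  generalize hl : s :: l = L at *
  have hL : ∀ y ∈ L, y ∈ vis := by
    subst hl
    exact hvis l s hd.root hch
  lift L to List vis using hL
  rw [List.length_map]
  refine hd.hasTreedepthAtMost.length_lt ?_ hnd.of_map
  rw [List.isChain_map] at hch
  exact hch

end DepthFirst

/-! ### Depth-first search as a program -/

/-- Look for a neighbour `w` of the vertex in the variable `82` that is not marked in the array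
`40`, and put `w + 1` into the variable `84`, or `0` if there is none. -/
def scanProg : Program :=
  .const 84 0 ;; forLoop 83 6 (.load 85 0 83 ;; .load 86 1 83 ;;
    ifEq 85 82 (.load 87 40 86 ;; ifEq 87 15 (.add 84 86 14)) ;;
    ifEq 86 82 (.load 87 40 85 ;; ifEq 87 15 (.add 84 85 14)))

/-- One round of the search: visit a neighbour of the top of the stack, or remove the top. The array
`41` and the variable `80` hold the stack and its height, the variable `81` holds the maximal
height. -/
def visitProg : Program :=
  (.sub 82 80 14 ;; .load 82 41 82) ;; scanProg ;;
    .ifLT 15 84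
      (.sub 84 84 14 ;; .store 40 84 14 ;; .store 41 80 84 ;; .add 80 80 14 ;;
        .ifLT 81 80 (.add 81 80 15) .skip)
      (.sub 80 80 14)

/-- Depth-first search from the source. -/
def searchProg : Program :=
  (.store 40 7 14 ;; .const 80 0 ;; .store 41 80 7 ;; .const 80 1 ;; .const 81 1) ;;
    .whileLT 15 80 visitProg

/-- The array contents `f` hold the stack, with its bottom in the cell `0`. -/
def HoldsStack {n : ℕ} (f : ℕ → ℕ) : List (Fin n) → Prop
  | [] => True
  | u :: l => f l.length = u ∧ HoldsStack f l

theorem HoldsStack.congr {n : ℕ} {f g : ℕ → ℕ} {l : List (Fin n)} (h : HoldsStack f l)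
    (hfg : ∀ i < l.length, g i = f i) : HoldsStack g l := by
  induction l with
  | nil => trivial
  | cons u l ih =>
    exact ⟨(hfg _ (by simp)).trans h.1, ih h.2 fun i hi => hfg i (by simp; omega)⟩

open Classical in
/-- The array contents `f` mark the elements of the set `vis`. -/
def Marks {n : ℕ} (f : ℕ → ℕ) (vis : Set (Fin n)) : Prop :=
  ∀ v : Fin n, f v = if v ∈ vis then 1 else 0

theorem PathInstance.adj_of_getElem (I : PathInstance) {j : ℕ} (hj : j < I.triples.length) :
    I.graph.underlying.Adj I.triples[j].1 I.triples[j].2.1 :=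
  ⟨_, I.mem_timeEdges (List.getElem_mem hj)⟩

theorem PathInstance.exists_getElem_of_adj (I : PathInstance) {u v : Fin I.n}
    (h : I.graph.underlying.Adj u v) : ∃ (j : ℕ) (hj : j < I.triples.length),
      (I.triples[j].1 = u ∧ I.triples[j].2.1 = v) ∨
        (I.triples[j].1 = v ∧ I.triples[j].2.1 = u) := by
  obtain ⟨t, ht⟩ := h
  rw [← Finset.mem_val, ← I.triples_eq, Multiset.mem_coe, List.mem_map] at ht
  obtain ⟨e, he, heq⟩ := ht
  obtain ⟨j, hj, rfl⟩ := List.getElem_of_mem he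
  refine ⟨j, hj, ?_⟩
  simpa using (Prod.ext_iff.1 heq).1

theorem runs_scanProg {ω : ℕ → Bool} {I : PathInstance} {σ : State} (hI : HasInput I σ)
    {u : Fin I.n} (hu : σ.var 82 = u) {vis : Set (Fin I.n)} (hv : Marks (σ.arr 40) vis) :
    Runs ω scanProg (I.triples.length * 20 + 3) σ (fun τ =>
      (τ.var 84 = 0 ∧ ∀ w, I.graph.underlying.Adj u w → w ∈ vis) ∨
      ∃ w : Fin I.n, τ.var 84 = w + 1 ∧ I.graph.underlying.Adj u w ∧ w ∉ vis) := by
  refine (Runs.seq (B := 1) (B' := I.triples.length * (18 + 2) + 2)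
    (Q := fun υ => υ = σ.setVar 84 0) (Runs.of_result rfl le_rfl rfl) ?_).mono (by omega)
    fun _ _ h => h
  rintro _ hF₁ rfl
  have hI₁ := hI.frame hF₁ rfl rfl
  refine (Runs.forLoop I.triples.length (fun i τ =>
      (τ.var 84 = 0 ∧ ∀ (j : ℕ) (hj : j < I.triples.length), j < i →
        (I.triples[j].1 = u → I.triples[j].2.1 ∈ vis) ∧
        (I.triples[j].2.1 = u → I.triples[j].1 ∈ vis)) ∨
      ∃ w : Fin I.n, τ.var 84 = w + 1 ∧ I.graph.underlying.Adj u w ∧ w ∉ vis)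
    hI₁.one hI₁.m (by decide) (by simp) ?_).mono le_rfl ?_
  · intro j hj τ hF h83 hinv
    have hI₂ := hI₁.frame hF rfl rfl
    have h82 : τ.var 82 = u := by rw [hF.var 82 rfl]; simp [hu]
    have h40 : Marks (τ.arr 40) vis := by rw [hF.arr 40 rfl]; simpa using hv
    have hadj := I.adj_of_getElem hj
    have e0 := hI₂.fst j hj
    have e1 := hI₂.snd j hj
    have hstep : ∀ i (hi : i < I.triples.length), i < j + 1 → i < j ∨ i = j := by omega
    classical
    refine (Runs.of_result (Q := fun τ' => τ'.var 84 =
      if I.triples[j].2.1 = u ∧ I.triples[j].1 ∉ vis then (I.triples[j].1 : ℕ) + 1 else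
      if I.triples[j].1 = u ∧ I.triples[j].2.1 ∉ vis then (I.triples[j].2.1 : ℕ) + 1 else
        τ.var 84) rfl (by decide) ?_).mono le_rfl fun τ' _ h84 => ?_
    · have m1 := h40 I.triples[j].1
      have m2 := h40 I.triples[j].2.1
      generalize I.triples[j].1 = x at *
      generalize I.triples[j].2.1 = y at *
      by_cases hxu : x = u <;> by_cases hyu : y = u <;> by_cases hxv : x ∈ vis <;>
        by_cases hyv : y ∈ vis <;>
        simp_all [Program.result, Program.result_ifEq, hI₂.one, hI₂.zero, Fin.val_inj]
    · simp only [State.setVar_var, show 84 ≠ 83 by decide, if_false]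
      split_ifs at h84 with c1 c2
      · exact Or.inr ⟨_, h84, c1.1 ▸ hadj.symm, c1.2⟩
      · exact Or.inr ⟨_, h84, c2.1 ▸ hadj, c2.2⟩
      · rcases hinv with ⟨h0, hall⟩ | ⟨w, hw, hw'⟩
        · refine Or.inl ⟨h84.trans h0, fun i hi hij => ?_⟩
          rcases Nat.lt_succ_iff_lt_or_eq.1 hij with h | rfl
          · exact hall i hi h
          · exact ⟨fun h => by_contra fun h' => c2 ⟨h, h'⟩,
              fun h => by_contra fun h' => c1 ⟨h, h'⟩⟩
        · exact Or.inr ⟨w, h84.trans hw, hw'⟩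
  · rintro τ - (⟨h, hall⟩ | h)
    · refine Or.inl ⟨h, fun w hw => ?_⟩
      obtain ⟨j, hj, ⟨h1, h2⟩ | ⟨h1, h2⟩⟩ := I.exists_getElem_of_adj hw
      · exact h2 ▸ (hall j hj hj).1 h1
      · exact h1 ▸ (hall j hj hj).2 h2
    · exact Or.inr h

/-- The search with the set `vis` and the stack `st` is in the state `σ`. -/
structure SearchState (I : PathInstance) (vis : Set (Fin I.n)) (st : List (Fin I.n))
    (A : Fin I.n → List (Fin I.n)) (h : ℕ) (σ : State) : Prop where
  search : DepthFirst I.graph.underlying I.s vis st A h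
  marks : Marks (σ.arr 40) vis
  stack : HoldsStack (σ.arr 41) st
  height : σ.var 80 = st.length
  max : σ.var 81 = h

/-- The number of unmarked vertices. -/
def unmarked (n : ℕ) (f : ℕ → ℕ) : ℕ :=
  (Finset.univ.filter fun v : Fin n => f v = 0).card

/-- Visiting a vertex pushes one element and marks one vertex, so that twice the number of unmarked
vertices plus the height of the stack decreases in every round. -/
theorem runs_visitProg {ω : ℕ → Bool} {I : PathInstance} {σ : State} (hI : HasInput I σ)
    {vis : Set (Fin I.n)} {st : List (Fin I.n)} {A : Fin I.n → List (Fin I.n)} {h : ℕ}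
    (hσ : SearchState I vis st A h σ) (hpos : 0 < σ.var 80) :
    Runs ω visitProg (I.triples.length * 20 + 12) σ (fun τ =>
      (∃ vis st A h, SearchState I vis st A h τ) ∧
        2 * unmarked I.n (τ.arr 40) + τ.var 80 < 2 * unmarked I.n (σ.arr 40) + σ.var 80) := by
  obtain ⟨hd, hm, hs, h80, h81⟩ := hσ
  cases st with
  | nil => simp [h80] at hpos
  | cons u l =>
    have hlen : σ.var 80 - 1 = l.length := by simp [h80]
    refine (Runs.seq (B := 2) (B' := (I.triples.length * 20 + 3) + 7)
      (Q := fun υ => υ = (σ.setVar 82 l.length).setVar 82 u)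
      (Runs.of_result rfl le_rfl (by simp [Program.result, hI.one, hlen, hs.1])) ?_).mono
      (by omega) fun _ _ h => h
    rintro _ hF₁ rfl
    have hI₁ := hI.frame hF₁ rfl rfl
    refine Runs.seq (runs_scanProg hI₁ (u := u) (vis := vis) (by simp) (by simpa using hm)) ?_
    intro τ hF hscan
    have hI₂ := hI₁.frame hF rfl rfl
    have k80 : τ.var 80 = l.length + 1 := by rw [hF.var 80 rfl]; simp [h80]
    have k81 : τ.var 81 = h := by rw [hF.var 81 rfl]; simp [h81]
    have k40 : τ.arr 40 = σ.arr 40 := by rw [hF.arr 40 rfl]; simp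
    have k41 : τ.arr 41 = σ.arr 41 := by rw [hF.arr 41 rfl]; simp
    refine Runs.ite (B := 6) (fun hlt => ?_) fun hlt => ?_
    · rw [hI₂.zero] at hlt
      obtain ⟨w, h84, hadj, hw⟩ := hscan.resolve_left fun h => hlt.ne' h.1
      refine Runs.of_result rfl (by decide) ?_
      have hτ : ∀ υ : State, υ.arr 40 = Function.update (σ.arr 40) w 1 →
          υ.arr 41 = Function.update (σ.arr 41) (l.length + 1) w →
          υ.var 80 = l.length + 2 → υ.var 81 = max h (l.length + 2) →
          (∃ vis st A h, SearchState I vis st A h υ) ∧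
            2 * unmarked I.n (υ.arr 40) + υ.var 80 < 2 * unmarked I.n (σ.arr 40) + σ.var 80 := by
        intro υ u40 u41 u80 u81
        refine ⟨⟨_, _, _, _, hd.push hw hadj, fun v => ?_, ⟨by simp [u41], ?_⟩, u80, u81⟩, ?_⟩
        · by_cases hv : v = w
          · simp [u40, hv]
          · have : (v : ℕ) ≠ w := fun h => hv (Fin.ext h)
            rw [u40, Function.update_of_ne this, hm v]
            by_cases hvis : v ∈ vis
            · rw [if_pos hvis, if_pos (Set.mem_insert_of_mem w hvis)]
            · rw [if_neg hvis, if_neg fun h => (Set.mem_insert_iff.1 h).elim hv hvis]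
        · refine hs.congr fun i hi => ?_
          rw [u41, Function.update_of_ne (by simp at hi; omega)]
        · have hsub : unmarked I.n (υ.arr 40) < unmarked I.n (σ.arr 40) := by
            refine Finset.card_lt_card (Finset.ssubset_iff_of_subset ?_ |>.2 ⟨w, ?_, ?_⟩)
            · intro v hv
              by_cases h : (v : ℕ) = w <;> simp_all
            · simp [hm w, hw]
            · simp [u40]
          rw [u80, h80, List.length_cons]
          omega
      by_cases hmax : h < l.length + 2
      · apply hτ <;> simp [Program.result, h84, k80, k81, k40, k41, hI₂.one, hI₂.zero, hmax,
          hmax.le]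
      · apply hτ <;> simp [Program.result, h84, k80, k81, k40, k41, hI₂.one, hmax,
          not_lt.1 hmax]
    · rw [hI₂.zero] at hlt
      have hall := (hscan.resolve_right fun ⟨w, h84, _⟩ => hlt (by omega)).2
      refine Runs.of_result rfl (by decide) ⟨⟨vis, l, A, h, hd.pop hall, ?_, ?_, ?_, ?_⟩, ?_⟩
      · simpa [Program.result, k40] using hm
      · simpa [Program.result, k41] using hs.2
      · simp [Program.result, k80, hI₂.one]
      · simp [Program.result, k81]
      · simp [Program.result, k80, k40, h80, hI₂.one]

/-- Depth-first search computes a number `h` such that all paths from the source have fewer than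
`2 ^ h` vertices, while some path has `h` vertices. -/
theorem runs_searchProg {ω : ℕ → Bool} {I : PathInstance} {σ : State} (hI : HasInput I σ)
    (h40 : ∀ i, σ.arr 40 i = 0) :
    Runs ω searchProg (2 * I.n * (I.triples.length * 20 + 13) + 6) σ (fun τ =>
      (∀ l : List (Fin I.n), (I.s :: l).IsChain I.graph.underlying.Adj → (I.s :: l).Nodup →
        (I.s :: l).length + 1 ≤ 2 ^ τ.var 81) ∧
      ∃ l : List (Fin I.n), l.IsChain I.graph.underlying.Adj ∧ l.Nodup ∧
        l.length = τ.var 81) := by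
  refine (Runs.seq (B := 5) (B' := 2 * I.n * (I.triples.length * 20 + 12 + 1) + 1)
    (Q := fun υ => SearchState I {I.s} [I.s] (fun v => [v]) 1 υ ∧
      2 * unmarked I.n (υ.arr 40) + υ.var 80 ≤ 2 * I.n)
    (Runs.of_result rfl le_rfl ?_) ?_).mono (le_of_eq (by ring)) fun _ _ h => h
  · have hm : Marks (Function.update (σ.arr 40) I.s 1) {I.s} := fun v => by
      by_cases hv : v = I.s
      · simp [hv]
      · have : (v : ℕ) ≠ I.s := fun h => hv (Fin.ext h)
        simp [hv, this, h40]
    refine ⟨⟨.init _ _, ?_, ?_, ?_, ?_⟩, ?_⟩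
    · simpa [Program.result, hI.s, hI.one] using hm
    · simp [Program.result, hI.s, HoldsStack]
    · simp [Program.result]
    · simp [Program.result]
    · have : unmarked I.n (Function.update (σ.arr 40) I.s 1) < I.n := by
        calc _ < (Finset.univ : Finset (Fin I.n)).card :=
              Finset.card_lt_card (Finset.ssubset_iff_of_subset (Finset.subset_univ _) |>.2
                ⟨I.s, Finset.mem_univ _, by simp⟩)
          _ = I.n := by simp
      simp [Program.result, hI.s, hI.one]
      omega
  · rintro τ hF ⟨hτ, hle⟩
    have hI₁ := hI.frame hF rfl rfl
    refine (Runs.whileLT (B := I.triples.length * 20 + 12)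
      (fun τ => ∃ vis st A h, SearchState I vis st A h τ)
      (fun τ => 2 * unmarked I.n (τ.arr 40) + τ.var 80) ⟨_, _, _, _, hτ⟩ ?_).mono
      (by gcongr) ?_
    · rintro υ hF₂ ⟨vis, st, A, h, hυ⟩ hlt
      have hI₂ := hI₁.frame hF₂ rfl rfl
      exact runs_visitProg hI₂ hυ (by rwa [hI₂.zero] at hlt)
    · rintro υ hF₂ ⟨⟨vis, st, A, h, hυ⟩, hlt⟩
      have hI₂ := hI₁.frame hF₂ rfl rfl
      rw [hI₂.zero, hυ.height] at hlt
      obtain rfl : st = [] := List.length_eq_zero_iff.1 (by omega)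
      rw [hυ.max]
      refine ⟨fun l => hυ.search.length_lt, ?_⟩
      obtain ⟨v, hv, hlen⟩ := hυ.search.exists_length
      exact ⟨A v, hυ.search.chain v hv, hυ.search.nodup v hv, hlen⟩

/-! ### All paths -/

/-- The algorithm for all paths: depth-first search finds a number `h` such that all paths have
less than `2 ^ h` vertices, and the core program is run with `2 ^ h` colours. -/
def pathProg : Program :=
  .const 14 1 ;; ifNe 7 8
    (searchProg ;; (.const 10 1 ;; forLoop 88 81 (.add 10 10 10)) ;;
      (.const 11 0 ;; .add 12 81 15 ;; .const 13 1) ;; coreProg)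
    (.const 0 1 ;; .const 1 1)

/-- With `K` colours, all paths are taken into account if no path has `K` vertices or more. -/
theorem targetCount_zero {I : PathInstance} (hsz : I.s ≠ I.z) {K : ℕ}
    (hK : ∀ l : List (Fin I.n), (I.s :: l).IsChain I.graph.underlying.Adj → (I.s :: l).Nodup →
      (I.s :: l).length + 1 ≤ K) : targetCount I K 0 = I.graph.numPaths I.s I.z := by
  rw [I.graph.numPaths_eq I.s I.z (K + 2), Finset.sum_range_succ', I.graph.card_pathSet_zero,
    if_neg hsz, add_zero, targetCount]
  · exact Finset.sum_congr rfl fun c _ => if_pos (Nat.zero_le c)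
  · intro k Q hQ
    obtain ⟨rfl, hw, hnd⟩ := (I.graph.mem_pathSet _ _ _ _).1 hQ
    have hch : ∀ (Q : List (Fin I.n × ℕ)) (t : ℕ) (u : Fin I.n), I.graph.IsWalk I.z t u Q →
        (u :: Q.map Prod.fst).IsChain I.graph.underlying.Adj := by
      intro Q
      induction Q with
      | nil => simp
      | cons x Q ih =>
        intro t u h
        exact List.isChain_cons_cons.2 ⟨⟨x.2, h.2.1⟩, ih _ _ h.2.2⟩
    have := hK _ (hch Q 1 I.s hw) hnd
    simp only [List.length_cons, List.length_map] at this
    omega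

/-- The running time of the program for all paths. -/
def pathCost (I : PathInstance) (h E L : ℕ) : ℕ :=
  2 * I.n * (I.triples.length * 20 + 13) + h * 3 + 20 + coreCost I (2 ^ h) h 1 E L

/-- The running time depends on the height `h` of the search tree, which is at most `g` because a
branch of the tree is a path. -/
theorem runs_pathProg (I : PathInstance) {g : ℕ}
    (hg : ∀ l : List (Fin I.n), l.IsChain I.graph.underlying.Adj → l.Nodup → l.length ≤ g)
    {ε δ : ℚ} (hε : 0 < ε) (hδ : 0 < δ) {E L : ℕ} (hE0 : 0 < E)
    (hElt : ∀ q < E, q * ε.num.toNat < ε.den) (hEle : ε.den ≤ E * ε.num.toNat)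
    (hE1 : 1 ≤ (E : ℝ) * ε) (hLlt : ∀ q < L, 2 ^ q * δ.num.toNat < δ.den)
    (hLle : δ.den ≤ 2 ^ L * δ.num.toNat) (hL1 : 1 ≤ (2 : ℝ) ^ L * δ) :
    ∃ h ≤ g, temporalPath.ApproximatesWithin pathProg I ε δ (pathCost I h E L) := by
  set σ := temporalPath.start I ε δ with hσ
  have hI : HasInput I (σ.setVar 14 1) :=
    hasInput_of_start (F := temporalPath) (J := I) (rest := []) (by simp [temporalPath])
      (by simp) rfl
  have hcount : temporalPath.count I = I.graph.numPaths I.s I.z := rfl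
  by_cases hsz : I.s = I.z
  · refine ⟨0, Nat.zero_le g, approximatesWithin_of_runs (N := 10) (fun _ => True) (fun ω => ?_)
      ?_ (by simpa using hδ.le)⟩
    · refine Runs.seq (B := 1) (B' := 9) (Q := fun υ => υ = σ.setVar 14 1)
        (Runs.of_result rfl le_rfl rfl) ?_
      rintro _ - rfl
      refine (Runs.ifNe (B := 5) (fun h => absurd (by rw [hI.s, hI.z, hsz]) h)
        fun _ => Runs.of_result rfl (by decide) fun _ => ?_).mono (by norm_num) fun _ _ h => h
      have hone : I.graph.numPaths I.s I.z = 1 := by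
        rw [I.graph.numPaths_eq I.s I.z 1, Finset.sum_range_one, I.graph.card_pathSet_zero,
          if_pos hsz]
        intro k Q hQ
        cases k with
        | zero => exact one_pos
        | succ k => simp [hsz, TemporalGraph.pathSet_self_succ] at hQ
      rw [hcount, hone]
      refine outputsApprox_of_eq hε ?_ ?_ <;> simp [Program.result]
    · exact_mod_cast (by unfold pathCost; omega : 10 ≤ pathCost I 0 E L)
  have hne : (σ.setVar 14 1).var 7 ≠ (σ.setVar 14 1).var 8 := by
    rw [hI.s, hI.z]
    exact fun h => hsz (Fin.ext h)
  have h40 : ∀ i, (σ.setVar 14 1).arr 40 i = 0 := fun i =>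
    start_arr (F := temporalPath) (J := I) (I := I) (ε := ε) (δ := δ) rfl (by norm_num : 3 ≤ 40) i
  have h33 : ∀ i, (σ.setVar 14 1).arr 33 i = 0 := fun i =>
    start_arr (F := temporalPath) (J := I) (I := I) (ε := ε) (δ := δ) rfl (by norm_num : 3 ≤ 33) i
  -- the search does not toss coins, so its result is the same for all `ω`
  obtain ⟨t, τ, he, ht, hlt, l, hl⟩ := runs_searchProg (ω := fun _ => false) hI h40
  set h := τ.var 81 with h_def
  set K := 2 ^ h with hK
  have hcost : pathCost I h E L =
    2 * I.n * (I.triples.length * 20 + 13) + h * 3 + 20 + coreCost I K h 1 E L := rfl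
  have hKK : 2 ^ (h * K) = K ^ K := by rw [hK, ← pow_mul]
  refine ⟨h, hl.2.2 ▸ hg l hl.1 hl.2.1, approximatesWithin_of_runs (N := pathCost I h E L)
    (fun ω => GoodSamples I K h 1 0 E L ε ω) (fun ω => ?_) le_rfl
    (le_fairCoins_approx hsz one_pos ?_ (Or.inr rfl) ?_ hE0 hE1 hL1)⟩
  · refine (Runs.seq (B := 1) (B' := ((2 * I.n * (I.triples.length * 20 + 13) + 6) +
      ((1 + (h * (1 + 2) + 2)) + (3 + coreCost I K h 1 E L))) + 3)
      (Q := fun υ => υ = σ.setVar 14 1) (Runs.of_result rfl le_rfl rfl) ?_).mono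
      (by rw [hcost]; omega) fun _ _ h => h
    rintro _ - rfl
    refine Runs.ifNe (fun _ => ?_) (fun h => absurd h hne)
    refine Runs.seq (Q := fun υ => υ.var 81 = h) ⟨t, τ, he.of_tosses rfl ω, ht, rfl⟩ ?_
    intro τ₁ hF₁ h81
    have hI₁ := hI.frame hF₁ rfl rfl
    refine Runs.seq (Q := fun υ => υ.var 10 = K) ?_ ?_
    · refine Runs.seq (Q := fun υ => υ = τ₁.setVar 10 1) (Runs.of_result rfl le_rfl rfl) ?_
      rintro _ - rfl
      refine Runs.forLoop h (fun i υ => υ.var 10 = 2 ^ i) (by simpa using hI₁.one)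
        (by simpa using h81) (by decide) (by simp) ?_
      intro j _ υ _ _ h10
      refine Runs.of_result rfl le_rfl ?_
      simp [Program.result, h10, pow_succ]
      omega
    · intro τ₂ hF₂ h10
      have hI₂ := hI₁.frame hF₂ rfl rfl
      have h81' : τ₂.var 81 = h := by rw [hF₂.var 81 rfl, h81]
      refine Runs.seq (Q := fun υ => υ = ((τ₂.setVar 11 0).setVar 12 h).setVar 13 1)
        (Runs.of_result rfl le_rfl (by simp [Program.result, h81', hI₂.zero])) ?_
      rintro _ hF₃ rfl
      have hI₃ := hI₂.frame hF₃ rfl rfl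
      have e0 : τ₂.var 0 = ε.num.toNat := by rw [hF₂.var 0 rfl, hF₁.var 0 rfl]; rfl
      have e1 : τ₂.var 1 = ε.den := by rw [hF₂.var 1 rfl, hF₁.var 1 rfl]; rfl
      have e2 : τ₂.var 2 = δ.num.toNat := by rw [hF₂.var 2 rfl, hF₁.var 2 rfl]; rfl
      have e3 : τ₂.var 3 = δ.den := by rw [hF₂.var 3 rfl, hF₁.var 3 rfl]; rfl
      refine (runs_coreProg hI₃ one_pos hsz (lo := 0) (K := K) (b := h) (E := E) (L := L)
        (by simp only [State.setVar_coins]; rw [hF₂.coins rfl, hF₁.coins rfl]; rfl)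
        (by simp [h10]) (by simp) (by simp) (by simp) (by simpa [e0, e1] using hElt)
        (by simpa [e0, e1] using hEle) (by simpa [e2, e3] using hLlt)
        (by simpa [e2, e3] using hLle) (fun c => ?_)).mono le_rfl ?_
      · simp only [State.setVar_arr]
        rw [hF₂.arr 33 rfl, hF₁.arr 33 rfl]
        exact h33 c
      · rintro υ - ⟨h1, h0⟩ hG
        rw [hcount, ← targetCount_zero hsz (K := K) fun l hl hnd => hlt l hl hnd]
        exact outputsApprox_of_goodSamples one_pos hE0 hG h1 h0
  · rw [mul_one]
  · rw [hKK]
    simp only [one_pow, mul_one]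
    omega

/-- A bound for the running time, as a product of a function of the number `h` and a polynomial. -/
theorem pathCost_le (I : PathInstance) {g h E L : ℕ} (hh : h ≤ g) (hE0 : 0 < E) {ε δ : ℝ}
    (hε : 0 < ε) (hδ : 0 ≤ Real.log (1 / δ)) (hE : (E : ℝ) ≤ 1 / ε + 1)
    (hL : (L : ℝ) ≤ 2 * Real.log (1 / δ) + 1) :
    (pathCost I h E L : ℝ) ≤ (2 ^ (g * 2 ^ g) * (2 ^ g + 1) : ℕ) *
      ((4800 : ℕ) * ((I.n + I.graph.timeEdges.card : ℕ) + 1 / ε + Real.log (1 / δ) + 1) ^ 7) := by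
  set K := 2 ^ h with hK
  set S := sampleSize K E L with hS
  set z := I.n + I.graph.timeEdges.card with hz
  have hK1 : 0 < K := by positivity
  have hhK : h < K := Nat.lt_two_pow_self
  have hlen : I.triples.length ≤ z := by rw [I.length_triples]; omega
  have hT : I.graph.lifetime ≤ z := by
    have h1 : Finset.Icc 1 I.graph.lifetime ⊆ I.graph.timeEdges.image Prod.snd := fun t ht => by
      obtain ⟨e, he, rfl⟩ := I.graph.label_used t ht
      exact Finset.mem_image_of_mem _ he
    have h2 := (Finset.card_le_card h1).trans Finset.card_image_le
    simp at h2
    omega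
  have hn : I.n ≤ z := by omega
  have hz1 : 0 < z := by have := I.n_pos; omega
  have hcore := coreCost_le I (K := K) (b := h) (a := 1) (L := L) hE0 (by omega)
    (by rw [Nat.div_one]; omega) (by nlinarith)
  rw [← hS] at hcore
  have hKK : 0 < K ^ K := by positivity
  have hS8 : 8 ≤ S := by
    calc 8 = 8 * 1 * (1 * (1 * 1)) := by norm_num
      _ ≤ 8 * (L + 1) * (E * (E * K ^ K)) := by gcongr <;> omega
  have hnat : pathCost I h E L ≤ 300 * (S * (K + 1) * z ^ 4) := by
    have h1 : I.n ^ 2 * I.graph.lifetime ^ 2 ≤ z ^ 4 := by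
      calc I.n ^ 2 * I.graph.lifetime ^ 2 ≤ z ^ 2 * z ^ 2 := by gcongr
        _ = z ^ 4 := by ring
    have h2 : S * (K + 1) * (I.n ^ 2 * I.graph.lifetime ^ 2) ≤ S * (K + 1) * z ^ 4 := by gcongr
    have h3 : z ^ 2 ≤ z ^ 4 := Nat.pow_le_pow_right hz1 (by norm_num)
    have h4 : 8 * ((K + 1) * z ^ 4) ≤ S * (K + 1) * z ^ 4 := by
      rw [mul_assoc]
      gcongr
    have h5 : 2 * I.n * (I.triples.length * 20 + 13) ≤ 66 * z ^ 2 := by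
      calc 2 * I.n * (I.triples.length * 20 + 13) ≤ 2 * z * (z * 20 + 13 * z) := by
            gcongr
            omega
        _ = 66 * z ^ 2 := by ring
    have h6 : 1 ≤ z ^ 4 := Nat.one_le_pow _ _ hz1
    have h7 : 2 * z ^ 4 ≤ (K + 1) * z ^ 4 := Nat.mul_le_mul_right _ (by omega)
    have h8 : (K + 1) * 1 ≤ (K + 1) * z ^ 4 := by gcongr
    have h9 : pathCost I h E L =
      2 * I.n * (I.triples.length * 20 + 13) + h * 3 + 20 + coreCost I K h 1 E L := rfl
    omega
  set X : ℝ := (z : ℝ) + 1 / ε + Real.log (1 / δ) + 1 with hX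
  have hz0 : (0 : ℝ) ≤ z := Nat.cast_nonneg z
  have hinv : 0 < 1 / ε := by positivity
  have hSX : (S : ℝ) ≤ 8 * (2 * X) * (X * (X * K ^ K)) := by
    rw [hS, sampleSize]
    push_cast
    have hEX : (E : ℝ) ≤ X := by linarith
    have hLX : (L : ℝ) + 1 ≤ 2 * X := by linarith
    gcongr
  have hzX : (z : ℝ) ≤ X := by linarith
  have hX1 : 1 ≤ X := by linarith
  -- this is where the height `h` is replaced by its bound in terms of the parameter
  have hKg : K ^ K * (K + 1) ≤ 2 ^ (g * 2 ^ g) * (2 ^ g + 1) := by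
    rw [hK, ← pow_mul]
    gcongr <;> norm_num
  calc (pathCost I h E L : ℝ) ≤ 300 * (S * (K + 1) * z ^ 4) := by exact_mod_cast hnat
    _ ≤ 300 * (8 * (2 * X) * (X * (X * K ^ K)) * (K + 1) * X ^ 4) := by gcongr
    _ = (K ^ K * (K + 1) : ℕ) * (4800 * X ^ 7) := by push_cast; ring
    _ ≤ _ := by gcongr; norm_num

/-- If the paths of the underlying graphs are bounded by a computable function of a parameter, then
there is an FPTRAS with this parameter. -/
theorem admitsFPTRAS_of_path_bound {κ : PathInstance → ℕ} {g : ℕ → ℕ} (hg : Primrec g)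
    (hκ : ∀ (I : PathInstance) (l : List (Fin I.n)), l.IsChain I.graph.underlying.Adj → l.Nodup →
      l.length ≤ g (κ I)) : temporalPath.AdmitsFPTRAS κ := by
  refine ⟨pathProg, fun k => 2 ^ (g k * 2 ^ g k) * (2 ^ g k + 1), 4800, 7, ?_, ?_⟩
  · have h1 : Primrec fun k => 2 ^ g k := primrec_two_pow.comp hg
    exact (Primrec.nat_mul.comp (primrec_two_pow.comp (Primrec.nat_mul.comp hg h1))
      (Primrec.succ.comp h1)).to_comp
  · intro I ε δ hε hδ hδ1
    have hεR : (0 : ℝ) < ε := by exact_mod_cast hε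
    have hδR : (0 : ℝ) < δ := by exact_mod_cast hδ
    have hδ1R : (δ : ℝ) < 1 := by exact_mod_cast hδ1
    obtain ⟨E, hE0, hElt, hEle, hE1, hE2⟩ := exists_ceil_inv hε
    obtain ⟨L, hLlt, hLle, hL1, hL2⟩ := exists_log_inv hδ hδ1
    obtain ⟨h, hh, hap⟩ := runs_pathProg I (hκ I) hε hδ hE0 hElt hEle hE1 hLlt hLle hL1
    have hlog : 0 ≤ Real.log (1 / (δ : ℝ)) :=
      Real.log_nonneg (by rw [le_div_iff₀ hδR]; linarith)
    have hle := pathCost_le I hh hE0 hεR hlog hE2 hL2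
    exact ⟨fun ω => (hap.1 ω).imp fun t ⟨τ, he, ht⟩ => ⟨τ, he, ht.trans hle⟩, hap.2⟩

end TemporalPaths

theorem corollary10 :
    (∃ (p : TemporalPaths.Program) (C : ℝ),
      ∀ (I : TemporalPaths.PathInstance) (k : ℕ) (ε δ : ℚ), 0 < ε → 0 < δ → δ < 1 →
        TemporalPaths.shortTemporalPath.ApproximatesWithin p (I, k) ε δ
          (C * ((k.factorial : ℝ) * Real.exp k * max 1 (Real.log (1 / (δ : ℝ))) *
            max 1 (1 / (ε : ℝ) ^ 2) * (I.n : ℝ) ^ 2 * (I.graph.lifetime : ℝ) ^ 2))) ∧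
    (∃ g : ℕ → ℕ, Computable g ∧
      ∀ (V : Type) [Finite V] (H : SimpleGraph V) (u v : V) (q : H.Walk u v), q.IsPath →
        q.length ≤ g (TemporalPaths.vertexCoverNumber H)) ∧
    (∃ g : ℕ → ℕ, Computable g ∧
      ∀ (V : Type) [Finite V] (H : SimpleGraph V) (u v : V) (q : H.Walk u v), q.IsPath →
        q.length ≤ g (TemporalPaths.treedepth H)) ∧
    TemporalPaths.temporalPath.AdmitsFPTRAS
      (fun I : TemporalPaths.PathInstance =>
        TemporalPaths.vertexCoverNumber I.graph.underlying) ∧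
    TemporalPaths.temporalPath.AdmitsFPTRAS
      (fun I : TemporalPaths.PathInstance => TemporalPaths.treedepth I.graph.underlying) := by
  refine ⟨⟨TemporalPaths.shortPathProg, 27000, fun I k ε δ => TemporalPaths.runs_shortPathProg I k⟩,
    TemporalPaths.exists_path_bound_vertexCoverNumber, TemporalPaths.exists_path_bound_treedepth,
    TemporalPaths.admitsFPTRAS_of_path_bound (g := fun n => 2 * n + 1) ?_
      fun I l hch hnd => TemporalPaths.length_le_vertexCoverNumber hch hnd,
    TemporalPaths.admitsFPTRAS_of_path_bound TemporalPaths.primrec_two_pow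
      fun I l hch hnd => (Nat.le_succ _).trans (TemporalPaths.length_lt_two_pow_treedepth hch hnd)⟩
  exact Primrec.succ.comp (Primrec.nat_mul.comp (Primrec.const 2) Primrec.id)
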